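/- **Setting.** Points of $\mathrm{Gr}(2,4)\subset\mathbb{P}^5$ are lines in complex projective $3$-space, given by their Plücker vectors, and $\langle A X\rangle=a_{12}x_{34}-a_{13}x_{24}+a_{14}x_{23}+a_{23}x_{14}-a_{24}x_{13}+a_{34}x_{12}$; two lines $A,X$ meet if and only if $\langle AX\rangle=0$. For a graph $G$ on $[\ell]$ let $V_G\subseteq \mathrm{Gr}(2,4)^\ell$ be the variety of all $(L_1,\dots,L_\ell)$ with $\langle L_iL_j\rangle=0$ for all edges $ij$ of $G$, and let $d=\dim V_G$. A Landau diagram $\mathcal{L}=G_u\cup H_u$ consists of $G$, of $d$ external vertices $1,\dots,d$, where $j$ is joined by a pendant edge to a vertex $a(j)\in[\ell]$ (so $u_i=|a^{-1}(i)|$ and $|u|=d$), and of a graph $H_u$ on the external vertices. It is planar if $G_u$ can be drawn in a disk with the external vertices $1,\dots,d$ on the boundary circle in this cyclic order and $H_u$ is a subgraph of the boundary cycle. Let $V$ be an irreducible component of $V_G$. For $\mathbf{M}=(M_1,\dots,M_d)\in(\mathbb{C}^6)^d$ the fiber $\psi^{-1}_V(\mathbf{M})$ is the set of all $\mathbf{L}\in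 V$ with $\langle M_jL_{a(j)}\rangle=0$ for all $j$. The LS degree $\gamma_V$ is the number of points in this fiber for generic $\mathbf{M}$ (a coefficient of the multidegree of $V$). If $\gamma_V\ge 2$, the LS discriminant $\Delta_V$ of $V$ is the reduced real polynomial in the $6d$ Plücker coordinates of $\mathbf{M}$ that defines the hypersurface where points of the fiber come together. Precisely, $\Delta_V$ is squarefree, and an irreducible real polynomial $p$ divides $\Delta_V$ if and only if for all complex $\mathbf{M}$ with $p(\mathbf{M})=0$ the fiber $\psi_V^{-1}(\mathbf{M})$ does not consist of exactly $\gamma_V$ points. This determines $\Delta_V$ up to a nonzero real scalar. A real $4\times n$ matrix $Z=[z_1|\cdots|z_n]$ is totally positive if all its $4\times4$ minors are positive; $\mathrm{Gr}_{>0}(4,n)$ is the set of row spans of such matrices. Positions for $\mathcal{L}$ are integers $1=p_1<\dots<p_d\le n\le 2d$ such that, for cyclically consecutive external vertices $j,j+1$, the positions satisfy $p_{j+1}=p_j+1$ (for $j=d$: $p_d=n$) if and only if $\{j,j+1\}\in H_u$. A tuple $\mathbf{M}$ is positive for $\mathcal{L}$ if, for some such positions and some totally positive $Z$, each $M_j$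 is the line spanned by $z_{p_j}$ and $z_{p_j+1}$ (where $z_{n+1}=z_1$). The Reality Conjecture holds for $\mathcal{L}$ if for every positive $\mathbf{M}$ and every irreducible component $V$ of $V_G$ the fiber $\psi_V^{-1}(\mathbf{M})$ has exactly $\gamma_V$ points and all of them are real. A polynomial $f$ in the Plücker coordinates of $\mathbf{M}$ is Grassmann copositive for $\mathcal{L}$ if, for all positions for $\mathcal{L}$, substituting for $M_j$ the Plücker vector of $z_{p_j},z_{p_j+1}$ gives a polynomial in the entries of $Z$ that is strictly positive on $\mathrm{Gr}_{>0}(4,n)$, i.e. for all totally positive $Z$. **Theorem.** Let $\mathcal{L}=G_u\cup H_u$ be a planar Landau diagram with $|u|=d=\dim V_G$. (1) If the Reality Conjecture holds for $\mathcal{L}$, then for each irreducible component $V$ of $V_G$ with $\gamma_V\ge2$ the LS discriminant $\Delta_V$ exists and, for the right choice of its overall sign, is Grassmann copositive; so is, up to sign, each real polynomial factor of $\Delta_V$, in particular each irreducible one. (2) If $G$ is a tree, then the conclusion of (1) holds unconditionally. -/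

import Mathlib

open MvPolynomial
open scoped LinearAlgebra.Projectivization

noncomputable section

namespace Landau

/-! ### Lines in projective three-space in Plücker coordinates -/

/-- The Plücker coordinates `(p₁₂, p₁₃, p₁₄, p₂₃, p₂₄, p₃₄)` of the line spanned by `v` and `w`. -/
def plucker {R : Type*} [CommRing R] (v w : Fin 4 → R) : Fin 6 → R :=
  ![v 0 * w 1 - v 1 * w 0, v 0 * w 2 - v 2 * w 0, v 0 * w 3 - v 3 * w 0,
    v 1 * w 2 - v 2 * w 1, v 1 * w 3 - v 3 * w 1, v 2 * w 3 - v 3 * w 2]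

/-- The inner product `⟨A X⟩` of Plücker vectors. A nonzero vector `X` represents a line if and
only if `⟨X X⟩ = 0`, and two lines `A`, `X` meet if and only if `⟨A X⟩ = 0`. -/
def pairing {R : Type*} [CommRing R] (A X : Fin 6 → R) : R :=
  A 0 * X 5 - A 1 * X 4 + A 2 * X 3 + A 3 * X 2 - A 4 * X 1 + A 5 * X 0

/-- On the Plücker vectors of two lines the pairing is the determinant of the `4 × 4` matrix
obtained by stacking them, so that it vanishes if and only if the lines meet. -/
theorem pairing_plucker {R : Type*} [CommRing R] (v w v' w' : Fin 4 → R) :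
    pairing (plucker v w) (plucker v' w') = (Matrix.of ![v, w, v', w']).det := by
  simp [pairing, plucker, Matrix.det_succ_row_zero, Fin.sum_univ_succ, Fin.succAbove]
  ring

/-! ### The incidence variety and its irreducible components -/

/-- The multihomogeneous coordinate ring of `(ℙ⁵)^ℓ`; the variable `(i, k)` is the `k`-th Plücker
coordinate of the line `L i`. -/
abbrev CoordRing (ℓ : ℕ) : Type := MvPolynomial (Fin ℓ × Fin 6) ℂ

/-- The vector of the six Plücker variables of the line `L i`. -/
def lineVar {ℓ : ℕ} (i : Fin ℓ) : Fin 6 → CoordRing ℓ := fun k => X (i, k)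

/-- The ideal of the incidence variety `V_G ⊆ Gr(2,4)^ℓ ⊆ (ℙ⁵)^ℓ`: the Plücker relations
`⟨L_i L_i⟩ = 0` and the incidences `⟨L_i L_j⟩ = 0` for all edges `ij` of `G`. -/
def incidenceIdeal {ℓ : ℕ} (G : SimpleGraph (Fin ℓ)) : Ideal (CoordRing ℓ) :=
  Ideal.span ({f | ∃ i, f = pairing (lineVar i) (lineVar i)} ∪
    {f | ∃ i j, G.Adj i j ∧ f = pairing (lineVar i) (lineVar j)})

/-- `P` is the prime ideal of an irreducible component `V_{G,σ}` of `V_G`: a minimal prime of the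
incidence ideal that has a zero in `(ℙ⁵)^ℓ`, i.e. one with all `ℓ` Plücker vectors nonzero. -/
def IsComponent {ℓ : ℕ} (G : SimpleGraph (Fin ℓ)) (P : Ideal (CoordRing ℓ)) : Prop :=
  P ∈ (incidenceIdeal G).minimalPrimes ∧
    ∃ x : Fin ℓ → Fin 6 → ℂ, (∀ i, x i ≠ 0) ∧
      ∀ f ∈ P, eval (fun ik : Fin ℓ × Fin 6 => x ik.1 ik.2) f = 0

/-- `dim V_G = d`. The multicone over a component in `(ℂ⁶)^ℓ` has dimension `ℓ` larger than the
component itself. -/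
def HasIncidenceDim {ℓ : ℕ} (G : SimpleGraph (Fin ℓ)) (d : ℕ) : Prop :=
  (⨆ P : {P : Ideal (CoordRing ℓ) // IsComponent G P}, ringKrullDim (CoordRing ℓ ⧸ P.1)) =
    ((d + ℓ : ℕ) : WithBot ℕ∞)

/-! ### Fibers of the Landau map, LS degree and LS discriminant -/

section Fiber

variable {ℓ d : ℕ}

/-- The fiber of the Landau map, restricted to the component with prime ideal `P`, over the
external data `M` (one vector in `ℂ⁶` for each external line): all configurations of `ℓ` internal
lines on the component such that the line at the vertex `a j` satisfies `⟨M_j L_{a j}⟩ = 0` for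
every external line `j`. All conditions are (multi)homogeneous, so the choice of representatives
is irrelevant. -/
def fiber (P : Ideal (CoordRing ℓ)) (a : Fin d → Fin ℓ) (M : Fin d → Fin 6 → ℂ) :
    Set (Fin ℓ → ℙ ℂ (Fin 6 → ℂ)) :=
  {L | (∀ f ∈ P, eval (fun ik : Fin ℓ × Fin 6 => (L ik.1).rep ik.2) f = 0) ∧
    ∀ j, pairing (M j) (L (a j)).rep = 0}

/-- The LS degree of a component: the coefficient of its multidegree, that is, the number of
points of the component that satisfy the Schubert conditions for generic external data. (The set
on the right-hand side is the singleton of this number when generic fibers are finite.) -/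
def lsDegree (P : Ideal (CoordRing ℓ)) (a : Fin d → Fin ℓ) : ℕ :=
  sInf {n : ℕ | ∃ F : MvPolynomial (Fin d × Fin 6) ℂ, F ≠ 0 ∧
    ∀ M : Fin d → Fin 6 → ℂ, eval (fun jk : Fin d × Fin 6 => M jk.1 jk.2) F ≠ 0 →
      (fiber P a M).encard = n}

/-- The locus of external data for which points in the fiber come together: the fiber does not
consist of LS degree many distinct points. -/
def collisionLocus (P : Ideal (CoordRing ℓ)) (a : Fin d → Fin ℓ) : Set (Fin d → Fin 6 → ℂ) :=
  {M | (fiber P a M).encard ≠ lsDegree P a}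

/-- `Δ`, a polynomial in the Plücker coordinates of the external lines, is an LS discriminant of
the component with prime ideal `P`: it is the reduced equation of the hypersurface part of the
collision locus, i.e. it is squarefree, and its irreducible factors are the irreducible
polynomials all of whose complex zeros lie in the collision locus. This determines `Δ` up to a
nonzero scalar. -/
structure IsLSDiscriminant (P : Ideal (CoordRing ℓ)) (a : Fin d → Fin ℓ)
    (Δ : MvPolynomial (Fin d × Fin 6) ℝ) : Prop where
  squarefree : Squarefree Δ
  dvd_iff : ∀ p : MvPolynomial (Fin d × Fin 6) ℝ, Irreducible p →
    (p ∣ Δ ↔ ∀ M : Fin d → Fin 6 → ℂ,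
      aeval (fun jk : Fin d × Fin 6 => M jk.1 jk.2) p = 0 → M ∈ collisionLocus P a)

/-- All lines of the configuration are real: each has a real Plücker vector. -/
def IsRealConfig (L : Fin ℓ → ℙ ℂ (Fin 6 → ℂ)) : Prop :=
  ∀ i, ∃ (w : Fin 6 → ℝ) (hw : (fun k => (w k : ℂ)) ≠ 0), L i = Projectivization.mk ℂ _ hw

end Fiber

/-! ### Planar Landau diagrams -/

/-- A Landau diagram `G_u ∪ H_u` with `ℓ` internal and `d` external lines: a graph `G` on the
internal vertices, a pendant edge from each external vertex `j` to the internal vertex `attach j`,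
and a graph `H` of prescribed incidences between external lines. -/
structure LandauDiagram (ℓ d : ℕ) where
  G : SimpleGraph (Fin ℓ)
  attach : Fin d → Fin ℓ
  H : SimpleGraph (Fin d)

namespace LandauDiagram

variable {ℓ d : ℕ} (D : LandauDiagram ℓ d)

/-- The half-edges of the graph obtained from `G_u` by identifying all `d` external vertices with
one point `∞` (contracting the boundary of the disk). The pendant edge `j` has the half-edges
`(j, false)` at `attach j` and `(j, true)` at `∞`. -/
abbrev HalfEdge : Type := D.G.Dart ⊕ (Fin d × Bool)

/-- The vertex at which a half-edge starts; `none` is the point `∞`. -/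
def HalfEdge.base : D.HalfEdge → Option (Fin ℓ)
  | .inl e => some e.fst
  | .inr (j, false) => some (D.attach j)
  | .inr (_, true) => none

/-- The other half of the same edge. -/
def HalfEdge.flip : D.HalfEdge → D.HalfEdge
  | .inl e => .inl e.symm
  | .inr (j, b) => .inr (j, !b)

/-- The involution that exchanges the two halves of every edge. -/
def edgePerm : Equiv.Perm D.HalfEdge :=
  Function.Involutive.toPerm (HalfEdge.flip D) (by
    rintro (e | ⟨j, b⟩) <;> simp [HalfEdge.flip])

/-- The number of cycles (including fixed points) of a permutation. -/
def numCycles {α : Type*} (f : Equiv.Perm α) : ℕ :=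
  Nat.card (Quotient (Equiv.Perm.SameCycle.setoid f))

/-- The number of connected components of the map with vertex permutation `ρ` and edge
permutation `ε`: the number of orbits of the group generated by `ρ` and `ε`. -/
def numOrbits {α : Type*} (ρ ε : Equiv.Perm α) : ℕ :=
  Nat.card (MulAction.orbitRel.Quotient (Subgroup.closure {ρ, ε}) α)

/-- The Landau diagram is planar: `G_u` can be drawn in a disk with the external vertices
`0, …, d-1` on the boundary circle in this cyclic order, and `H` is a subgraph of the boundary
cycle. After contracting the boundary of the disk to the point `∞`, such a drawing is a drawing on
the sphere in which the pendant edges occur in their cyclic order around `∞`. It is given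
combinatorially by a rotation system `ρ` (the cycles of `ρ` are the cyclic orders of the
half-edges around the vertices) of genus zero, i.e. satisfying Euler's formula
`#vertices - #edges + #faces = 2 · #components`, the faces being the cycles of `ρ * ε`. -/
def IsPlanar : Prop :=
  D.H ≤ SimpleGraph.cycleGraph d ∧
  ∃ ρ : Equiv.Perm D.HalfEdge,
    (∀ x y, HalfEdge.base D x = HalfEdge.base D y ↔ ρ.SameCycle x y) ∧
    (∀ j : Fin d, ρ (.inr (j, true)) = .inr (finRotate d j, true)) ∧
    numCycles ρ + numCycles (ρ * D.edgePerm) =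
      numCycles D.edgePerm + 2 * numOrbits ρ D.edgePerm

/-! ### Positive external data -/

end LandauDiagram

/-- A real `k × n` matrix is totally positive if all its maximal minors (with increasing columns)
are positive. The row spans of these matrices form the positive Grassmannian `Gr_{>0}(k,n)`. -/
def TotallyPositive {k n : ℕ} (Z : Matrix (Fin k) (Fin n) ℝ) : Prop :=
  ∀ c : Fin k → Fin n, StrictMono c → 0 < (Z.submatrix id c).det

/-- A polynomial in the entries of a `k × n` matrix is Grassmann copositive if it is strictly
positive on `Gr_{>0}(k,n)`. -/
def GrassmannCopositive {k n : ℕ} (f : MvPolynomial (Fin k × Fin n) ℝ) : Prop :=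
  ∀ Z : Matrix (Fin k) (Fin n) ℝ, TotallyPositive Z →
    0 < eval (fun rc : Fin k × Fin n => Z rc.1 rc.2) f

/-- The Plücker vectors of the lines spanned by the columns `p j` and `p j + 1` of `Z`, where the
column after the last one is the first one. -/
def consecutiveLines {R : Type*} [CommRing R] {d n : ℕ} (Z : Matrix (Fin 4) (Fin n) R)
    (p : Fin d → Fin n) : Fin d → Fin 6 → R :=
  fun j => plucker (fun r => Z r (p j)) (fun r => Z r (finRotate n (p j)))

/-- The polynomial in the entries of a `4 × n` matrix that arises from a polynomial `f` in the
Plücker coordinates of `d` external lines when the `j`-th line is spanned by the columns `p j` and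
`p j + 1`. -/
def twistorPolynomial {d n : ℕ} (f : MvPolynomial (Fin d × Fin 6) ℝ) (p : Fin d → Fin n) :
    MvPolynomial (Fin 4 × Fin n) ℝ :=
  aeval (fun jk : Fin d × Fin 6 =>
    consecutiveLines (Matrix.mvPolynomialX (Fin 4) (Fin n) ℝ) p jk.1 jk.2) f

namespace LandauDiagram

variable {ℓ d : ℕ} (D : LandauDiagram ℓ d)

/-- The admissible positions `p 0 < ⋯ < p (d-1)` (counted from `0`) of the external lines among
`n ≤ 2d` columns: the first line uses the first column, and cyclically consecutive external lines
share a column if and only if the diagram prescribes that they are incident. -/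
structure IsPositioned {n : ℕ} (p : Fin d → Fin n) : Prop where
  le_two_mul : n ≤ 2 * d
  strictMono : StrictMono p
  first : ∀ j : Fin d, j.val = 0 → (p j).val = 0
  adj_iff : ∀ i j : Fin d, i.val + 1 = j.val → (D.H.Adj i j ↔ (p j).val = (p i).val + 1)
  adj_last_iff : ∀ i j : Fin d, i.val + 1 = d → j.val = 0 → (D.H.Adj i j ↔ (p i).val + 1 = n)

/-- The tuple `M` of real lines is positive for the diagram: the lines are spanned by consecutive
columns, at admissible positions, of a totally positive matrix. -/
def IsPositive (M : Fin d → Fin 6 → ℝ) : Prop :=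
  ∃ (n : ℕ) (p : Fin d → Fin n) (Z : Matrix (Fin 4) (Fin n) ℝ),
    D.IsPositioned p ∧ TotallyPositive Z ∧ M = consecutiveLines Z p

/-- The Reality Conjecture holds for the diagram: on each irreducible component of `V_G`, the
fiber of the Landau map over every positive `M` has LS degree many points, and all are real. -/
def RealityHolds : Prop :=
  ∀ P : Ideal (CoordRing ℓ), IsComponent D.G P →
    ∀ M : Fin d → Fin 6 → ℝ, D.IsPositive M →
      (fiber P D.attach (fun j k => (M j k : ℂ))).encard = lsDegree P D.attach ∧
      ∀ L ∈ fiber P D.attach (fun j k => (M j k : ℂ)), IsRealConfig L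

/-- A polynomial in the Plücker coordinates of the external lines is Grassmann copositive for the
diagram: at all admissible positions of the external lines, it gives a Grassmann copositive
polynomial on `Gr(4,n)`. -/
def IsCopositive (f : MvPolynomial (Fin d × Fin 6) ℝ) : Prop :=
  ∀ (n : ℕ) (p : Fin d → Fin n), D.IsPositioned p → GrassmannCopositive (twistorPolynomial f p)

/-- For each irreducible component of `V_G` with LS degree at least two, the LS discriminant
exists and, for the right choice of the overall sign, is Grassmann copositive; the same is true of
each of its factors (in particular of its irreducible factors). -/
def DiscriminantsCopositive : Prop :=
  ∀ P : Ideal (CoordRing ℓ), IsComponent D.G P → 2 ≤ lsDegree P D.attach →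
    (∃ Δ, IsLSDiscriminant P D.attach Δ) ∧
    ∀ Δ, IsLSDiscriminant P D.attach Δ →
      ∀ f, f ∣ Δ → D.IsCopositive f ∨ D.IsCopositive (-f)

end LandauDiagram

end Landau

end

/-!
Positive data avoid the collision locus, and they form a connected set; this is why the factors of
the discriminant have constant sign on them.

In more detail, suppose that all fibers over positive data have as many points as the generic fiber
(`LandauDiagram.copositive_of_encard_fiber`). The discriminant exists because the collision locus
lies in a complex hypersurface, hence also in the real hypersurface whose equation is the product of
a complex equation with its conjugate (`exists_real_polynomial_of_ne_zero`); the discriminant is the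
product of those irreducible real factors whose complex zeros all lie in the locus
(`exists_squarefree_prod_irreducible`). No factor of it has a zero outside the collision locus
(`IsLSDiscriminant.aeval_ne_zero`), in particular none on positive data. All positive data come from
totally positive matrices with one and the same choice of positions, as columns that are not used
can be deleted (`LandauDiagram.IsPositioned.exists_tight`), and the totally positive matrices of a
given size form a connected set (`isPreconnected_positiveTuples`). So every factor has constant
sign. The Reality Conjecture contains the hypothesis on the fibers, and it remains to prove this
hypothesis for planar trees.

For a tree, a component of the incidence variety consists of all incident configurations of lines,
because configurations are parametrized by polynomials, one vertex after the other
(`forall_eval_eq_zero_iff_isIncident`). If the generic fiber is finite and not empty, then there are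
`3 ℓ + 1` external lines (`sum_excess_eq_one`). Moreover, every edge separates the tree into a
branch with three external lines for each vertex and one with an additional external line: with even
more external lines on one side, special positions of them would leave no solution at all
(`forces_insert_biUnion`), although every fiber is nonempty (`exists_solvesOn_univ`). Directing the
edge away from the side with the additional line, each vertex has exactly four inputs, external
lines or neighbours (`card_inputs`). The direction has no cycles, so a fiber is found by solving one
vertex after the other, and each time one has to find the common transversals of four lines. If the
Gram determinant of these lines never vanishes (`Nondegenerate`), there are always two of them, and
the fiber has `2 ^ ℓ` points (`encard_fiber_eq_two_pow`). Nondegeneracy is an open condition, so if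
it holds for some data, then `2 ^ ℓ` is also the number of points of the generic fiber
(`encard_fiber_eq_lsDegree`).

Nondegeneracy over positive data follows from planarity and from a statement about real lines.
Planarity, i.e. Euler's formula, implies that the contour of the tree meets the external vertices in
their cyclic order (`LandauDiagram.Path.isChain`). So all lines of a configuration are obtained from
the external lines by taking common transversals of four lines that come from successive blocks of
external lines (`LandauDiagram.IsPlanar.exists_constructions`). On the other hand, the lines through
consecutive columns of a totally positive matrix are in positive position: brackets of their points
in increasing order are positive, except that adjacent lines may meet
(`IsPositiveLoop.positivePosition`). The Gram determinant of four lines in positive position is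
positive (`gram_pos`), so that they have two real transversals, and each of them can replace
the four lines: it is again in positive position with the lines that follow them
(`PositivePosition.exists_transversal`). This property is proved by locating the two transversals
on the first line and comparing ratios of brackets by Plücker relations (`IsTransversal.pos`).
Positive position is preserved by cyclic rotations, up to signs (`PositivePosition.rotate`), so the
argument applies to the transversals of all blocks in turn
(`Construction.exists_positivePosition`).
-/


noncomputable section

namespace Landau

/-! ### Real equations of complex hypersurfaces -/

/-- A nonzero complex polynomial divides a nonzero real one, its product with its complex
conjugate; hence the zeros of a complex polynomial lie in a hypersurface defined over `ℝ`. -/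
theorem exists_real_polynomial_of_ne_zero {σ : Type*} (F : MvPolynomial σ ℂ) (hF : F ≠ 0) :
    ∃ N : MvPolynomial σ ℝ, N ≠ 0 ∧ ∀ x : σ → ℂ, eval x F = 0 → aeval x N = 0 := by
  have hinj : Function.Injective (starRingEnd ℂ) := (starRingEnd ℂ).injective
  set F' := map (starRingEnd ℂ) F with hF'
  have hF0 : F' ≠ 0 := fun h => hF (map_injective _ hinj (by rw [← hF', h, map_zero]))
  have hconj : map (starRingEnd ℂ) (F * F') = F * F' := by
    rw [map_mul, hF', map_map]
    have : (starRingEnd ℂ).comp (starRingEnd ℂ) = RingHom.id ℂ := by ext x; simp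
    rw [this, map_id, mul_comm]
  have hre : ∀ m, (((coeff m (F * F')).re : ℝ) : ℂ) = coeff m (F * F') := by
    intro m
    have := congrArg (coeff m) hconj
    rw [coeff_map] at this
    exact Complex.conj_eq_iff_re.mp this
  obtain ⟨N, hN⟩ : ∃ N : MvPolynomial σ ℝ, map (algebraMap ℝ ℂ) N = F * F' := by
    have : F * F' ∈ Set.range (map (algebraMap ℝ ℂ)) := by
      rw [mem_range_map_iff_coeffs_subset]
      intro c hc
      obtain ⟨m, -, rfl⟩ := mem_coeffs_iff.mp (Finset.mem_coe.mp hc)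
      exact ⟨_, hre m⟩
    exact this
  refine ⟨N, ?_, fun x hx => ?_⟩
  · rintro rfl
    rw [map_zero] at hN
    exact mul_ne_zero hF hF0 hN.symm
  · have := congrArg (eval x) hN
    rw [map_mul, hx, zero_mul, eval_map] at this
    exact this

/-- Inside a real hypersurface `N = 0` there are only finitely many irreducible real hypersurfaces
of a given kind; the product of their equations is squarefree. -/
theorem exists_squarefree_prod_irreducible {σ : Type*} [Finite σ] (N : MvPolynomial σ ℝ)
    (hN : N ≠ 0) (Z : Set (σ → ℂ)) (hZ : ∀ x ∈ Z, aeval x N = 0) :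
    ∃ Δ : MvPolynomial σ ℝ, Squarefree Δ ∧ ∀ p, Irreducible p →
      (p ∣ Δ ↔ ∀ x : σ → ℂ, aeval x p = 0 → x ∈ Z) := by
  classical
  let _ := Classical.choice (inferInstance : Nonempty (NormalizationMonoid (MvPolynomial σ ℝ)))
  let T : Finset (MvPolynomial σ ℝ) :=
    (UniqueFactorizationMonoid.normalizedFactors N).toFinset.filter
      fun p => ∀ x : σ → ℂ, aeval x p = 0 → x ∈ Z
  have hT : ∀ p ∈ T, p ∈ UniqueFactorizationMonoid.normalizedFactors N ∧
      ∀ x : σ → ℂ, aeval x p = 0 → x ∈ Z := by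
    intro p hp
    simpa only [T, Finset.mem_filter, Multiset.mem_toFinset] using hp
  have hirr : ∀ p ∈ T, Irreducible p := fun p hp =>
    UniqueFactorizationMonoid.irreducible_of_normalized_factor p (hT p hp).1
  refine ⟨∏ p ∈ T, p, ?_, fun p hp => ⟨fun h => ?_, fun h => ?_⟩⟩
  · refine Finset.squarefree_prod_of_pairwise_isCoprime (fun p hp q hq hpq => ?_)
      fun p hp => (hirr p hp).squarefree
    rw [Function.onFun, (hirr p hp).isRelPrime_iff_not_dvd]
    intro hd
    exact hpq (UniqueFactorizationMonoid.mem_normalizedFactors_eq_of_associated (hT p hp).1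
      (hT q hq).1 ((hirr p hp).associated_of_dvd (hirr q hq) hd))
  · obtain ⟨q, hq, hpq⟩ := (hp.prime.dvd_finsetProd_iff _).mp h
    intro x hx
    refine (hT q hq).2 x ?_
    obtain ⟨r, hr⟩ := hpq
    rw [hr, map_mul, hx, zero_mul]
  · have hdvd : p ∣ N := by
      have : N ∈ vanishingIdeal ℝ (zeroLocus ℂ (Ideal.span {p})) := by
        intro x hx
        exact hZ x (h x (hx p (Ideal.mem_span_singleton_self p)))
      rw [vanishingIdeal_zeroLocus_eq_radical] at this
      obtain ⟨k, hk⟩ := this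
      exact hp.prime.dvd_of_dvd_pow (Ideal.mem_span_singleton.mp hk)
    obtain ⟨q, hq, hpq⟩ := UniqueFactorizationMonoid.exists_mem_normalizedFactors_of_dvd hN hp hdvd
    refine hpq.dvd.trans (Finset.dvd_prod_of_mem (fun p => p) ?_)
    simp only [T, Finset.mem_filter, Multiset.mem_toFinset]
    refine ⟨hq, fun x hx => h x ?_⟩
    obtain ⟨r, hr⟩ := hpq.symm.dvd
    rw [hr, map_mul, hx, zero_mul]

/-- A polynomial that vanishes at a point has an irreducible factor vanishing there. -/
theorem exists_irreducible_dvd_aeval_eq_zero {σ : Type*} [Finite σ] (Δ : MvPolynomial σ ℝ)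
    (hΔ : Δ ≠ 0) (x : σ → ℂ) (hx : aeval x Δ = 0) :
    ∃ p, Irreducible p ∧ p ∣ Δ ∧ aeval x p = 0 := by
  induction Δ using WfDvdMonoid.induction_on_irreducible with
  | zero => exact absurd rfl hΔ
  | unit u hu =>
    exact absurd hx ((hu.map (aeval (R := ℝ) x)).ne_zero)
  | mul a i ha hi ih =>
    rw [map_mul, mul_eq_zero] at hx
    rcases hx with hx | hx
    · exact ⟨i, hi, dvd_mul_right _ _, hx⟩
    · obtain ⟨p, h1, h2, h3⟩ := ih ha hx
      exact ⟨p, h1, h2.mul_left _, h3⟩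

variable {ℓ d : ℕ}

/-- A positive LS degree is attained: off some hypersurface all fibers have exactly this
cardinality. -/
theorem exists_generic_fiber_encard (P : Ideal (CoordRing ℓ)) (a : Fin d → Fin ℓ)
    (h : lsDegree P a ≠ 0) :
    ∃ F : MvPolynomial (Fin d × Fin 6) ℂ, F ≠ 0 ∧
      ∀ M : Fin d → Fin 6 → ℂ, eval (fun jk : Fin d × Fin 6 => M jk.1 jk.2) F ≠ 0 →
        (fiber P a M).encard = lsDegree P a := by
  unfold lsDegree at h ⊢
  generalize hS : {n : ℕ | _} = S at h ⊢
  have hmem : sInf S ∈ S := Nat.sInf_mem (Nat.nonempty_of_pos_sInf (Nat.pos_of_ne_zero h))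
  have key : ∀ n ∈ S, ∃ F : MvPolynomial (Fin d × Fin 6) ℂ, F ≠ 0 ∧
      ∀ M : Fin d → Fin 6 → ℂ, eval (fun jk : Fin d × Fin 6 => M jk.1 jk.2) F ≠ 0 →
        (fiber P a M).encard = n := by
    intro n hn
    rw [← hS] at hn
    exact hn
  exact key _ hmem

/-- The collision locus lies in a real hypersurface; its discriminant is the product of those
irreducible factors of an equation of this hypersurface whose zeros all lie in the locus. -/
theorem exists_isLSDiscriminant (P : Ideal (CoordRing ℓ)) (a : Fin d → Fin ℓ)
    (h : lsDegree P a ≠ 0) : ∃ Δ, IsLSDiscriminant P a Δ := by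
  obtain ⟨F, hF, hFn⟩ := exists_generic_fiber_encard P a h
  obtain ⟨N, hN, hFN⟩ := exists_real_polynomial_of_ne_zero F hF
  obtain ⟨Δ, h1, h2⟩ := exists_squarefree_prod_irreducible N hN
    {x | (fun j k => x (j, k)) ∈ collisionLocus P a} (by
      intro x hx
      refine hFN x ?_
      by_contra hne
      exact hx (hFn (fun j k => x (j, k)) hne))
  refine ⟨Δ, ⟨h1, fun p hp => ?_⟩⟩
  rw [h2 p hp]
  constructor
  · intro H M hM
    exact H (fun jk => M jk.1 jk.2) hM
  · intro H x hx
    exact H (fun j k => x (j, k)) hx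

/-- No factor of an LS discriminant vanishes at a point outside the collision locus. -/
theorem IsLSDiscriminant.aeval_ne_zero {P : Ideal (CoordRing ℓ)} {a : Fin d → Fin ℓ}
    {Δ f : MvPolynomial (Fin d × Fin 6) ℝ} (hΔ : IsLSDiscriminant P a Δ) (hf : f ∣ Δ)
    (M : Fin d → Fin 6 → ℂ) (hM : M ∉ collisionLocus P a) :
    aeval (fun jk : Fin d × Fin 6 => M jk.1 jk.2) f ≠ 0 := by
  intro h0
  have hΔ0 : aeval (fun jk : Fin d × Fin 6 => M jk.1 jk.2) Δ = 0 := by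
    obtain ⟨r, rfl⟩ := hf
    rw [map_mul, h0, zero_mul]
  obtain ⟨p, hp, hpΔ, hp0⟩ := exists_irreducible_dvd_aeval_eq_zero Δ hΔ.squarefree.ne_zero _ hΔ0
  exact hM ((hΔ.dvd_iff p hp).mp hpΔ M hp0)

/-! ### Brackets and totally positive matrices with four rows -/

/-- The bracket `⟨u v w x⟩`, i.e. the determinant with rows `u`, `v`, `w`, `x`. -/
def br {R : Type*} [CommRing R] (u v w x : Fin 4 → R) : R :=
  pairing (plucker u v) (plucker w x)

theorem br_eq {R : Type*} [CommRing R] (u v w x : Fin 4 → R) : br u v w x =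
    (u 0 * v 1 - u 1 * v 0) * (w 2 * x 3 - w 3 * x 2)
    - (u 0 * v 2 - u 2 * v 0) * (w 1 * x 3 - w 3 * x 1)
    + (u 0 * v 3 - u 3 * v 0) * (w 1 * x 2 - w 2 * x 1)
    + (u 1 * v 2 - u 2 * v 1) * (w 0 * x 3 - w 3 * x 0)
    - (u 1 * v 3 - u 3 * v 1) * (w 0 * x 2 - w 2 * x 0)
    + (u 2 * v 3 - u 3 * v 2) * (w 0 * x 1 - w 1 * x 0) := by
  simp [br, pairing, plucker]

theorem det_submatrix_eq_br {R : Type*} [CommRing R] {n : ℕ} (Z : Matrix (Fin 4) (Fin n) R)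
    (c : Fin 4 → Fin n) : (Z.submatrix id c).det =
      br (fun r => Z r (c 0)) (fun r => Z r (c 1)) (fun r => Z r (c 2)) (fun r => Z r (c 3)) := by
  rw [br, pairing_plucker, ← Matrix.det_transpose]
  congr 1
  ext i j
  fin_cases i <;> rfl

theorem totallyPositive_iff_br {n : ℕ} (Z : Matrix (Fin 4) (Fin n) ℝ) : TotallyPositive Z ↔
    ∀ i j k l : Fin n, i < j → j < k → k < l →
      0 < br (fun r => Z r i) (fun r => Z r j) (fun r => Z r k) (fun r => Z r l) := by
  constructor
  · intro h i j k l hij hjk hkl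
    have := h ![i, j, k, l] (by
      rw [Fin.strictMono_iff_lt_succ]
      intro t
      fin_cases t <;> simpa)
    rw [det_submatrix_eq_br] at this
    exact this
  · intro h c hc
    rw [det_submatrix_eq_br]
    exact h _ _ _ _ (hc (by decide)) (hc (by decide)) (hc (by decide))

/-! ### The totally positive matrices form a connected set -/

/-- An open subset of a product is preconnected if its projection to the first factor is
preconnected and all fibers over the projection are nonempty and preconnected. -/
theorem isPreconnected_of_open_fibration {X Y : Type*} [TopologicalSpace X] [TopologicalSpace Y]
    {E : Set (X × Y)} {B : Set X} (hE : IsOpen E) (hB : IsPreconnected B)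
    (hEB : ∀ p ∈ E, p.1 ∈ B) (hne : ∀ x ∈ B, ∃ y, (x, y) ∈ E)
    (hf : ∀ x ∈ B, IsPreconnected {y | (x, y) ∈ E}) : IsPreconnected E := by
  rcases isEmpty_or_nonempty Y with _ | _
  · rw [Set.eq_empty_of_forall_notMem fun p (_ : p ∈ E) => isEmptyElim p.2]
    exact isPreconnected_empty
  refine isPreconnected_of_forall_constant fun f hfc => ?_
  have hfib : ∀ x ∈ B, ∀ y y', (x, y) ∈ E → (x, y') ∈ E → f (x, y) = f (x, y') := by
    intro x hx y y' hy hy'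
    refine (hf x hx).constant (f := fun y => f (x, y)) ?_ hy hy'
    exact hfc.comp (by fun_prop) fun z hz => hz
  choose! s hs using hne
  have hg : ContinuousOn (fun x => f (x, s x)) B := by
    intro x hx
    have h1 : ∀ᶠ p in nhds (x, s x), p ∈ E ∧ f p = f (x, s x) := by
      have hc : ContinuousAt f (x, s x) := hfc.continuousAt (hE.mem_nhds (hs x hx))
      have h2 := hc.tendsto.eventually (isOpen_discrete {f (x, s x)}|>.mem_nhds rfl)
      exact Filter.Eventually.and (hE.mem_nhds (hs x hx)) h2
    have h2 : ∀ᶠ x' in nhds x, (x', s x) ∈ E ∧ f (x', s x) = f (x, s x) :=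
      ((by fun_prop : Continuous fun x' : X => (x', s x)).tendsto x).eventually h1
    refine ContinuousWithinAt.congr_of_eventuallyEq (f := fun _ => f (x, s x))
      continuousWithinAt_const ?_ rfl
    filter_upwards [nhdsWithin_le_nhds h2, self_mem_nhdsWithin] with x' hx' hB'
    rw [← hx'.2]
    exact hfib x' hB' _ _ (hs x' hB') hx'.1
  intro p hp q hq
  have h1 := hB.constant hg (hEB p hp) (hEB q hq)
  rw [← Prod.mk.eta (p := p), ← Prod.mk.eta (p := q),
    hfib p.1 (hEB p hp) p.2 (s p.1) hp (hs _ (hEB p hp)),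
    hfib q.1 (hEB q hq) q.2 (s q.1) hq (hs _ (hEB q hq))]
  exact h1

theorem continuous_snoc (n : ℕ) : Continuous fun p : (Fin n → Fin 4 → ℝ) × (Fin 4 → ℝ) =>
    (Fin.snoc p.1 p.2 : Fin (n + 1) → Fin 4 → ℝ) := by
  refine continuous_pi fun i => ?_
  induction i using Fin.lastCases with
  | last => simpa using continuous_snd
  | cast i => simpa using! (continuous_apply i).comp continuous_fst

/-- For `k ≤ 3`, the linearly independent `k`-tuples in `ℝ⁴` form a connected set: a span of fewer
than three vectors has codimension at least two, so its complement is connected. -/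
theorem isPreconnected_linearIndependent {k : ℕ} (hk : k ≤ 3) :
    IsPreconnected {z : Fin k → Fin 4 → ℝ | LinearIndependent ℝ z} := by
  induction k with
  | zero => exact Set.Subsingleton.isPreconnected fun x _ y _ => Subsingleton.elim x y
  | succ k ih =>
    have hcont : Continuous fun p : (Fin k → Fin 4 → ℝ) × (Fin 4 → ℝ) =>
        (Fin.snoc p.1 p.2 : Fin (k + 1) → Fin 4 → ℝ) := continuous_snoc _
    have hpre : IsPreconnected {p : (Fin k → Fin 4 → ℝ) × (Fin 4 → ℝ) |
        LinearIndependent ℝ (Fin.snoc p.1 p.2 : Fin (k + 1) → Fin 4 → ℝ)} := by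
      have hconn : ∀ x : Fin k → Fin 4 → ℝ,
          IsConnected ((Submodule.span ℝ (Set.range x) : Set (Fin 4 → ℝ))ᶜ) := by
        intro x
        refine isConnected_compl_of_one_lt_codim ?_
        have h1 := Submodule.finrank_quotient_add_finrank (Submodule.span ℝ (Set.range x))
        have h2 : Module.finrank ℝ (Submodule.span ℝ (Set.range x)) ≤ k := by
          simpa using! finrank_range_le_card (R := ℝ) x
        rw [Module.finrank_fin_fun] at h1
        rw [← Module.finrank_eq_rank]
        exact_mod_cast (by omega : 1 < Module.finrank ℝ (_ ⧸ Submodule.span ℝ (Set.range x)))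
      refine isPreconnected_of_open_fibration (B := {z | LinearIndependent ℝ z})
        (isOpen_setOfPred_linearIndependent.preimage hcont) (ih (by omega)) ?_ ?_ ?_
      · intro p hp
        exact (linearIndependent_finSnoc.mp hp).1
      · intro x hx
        obtain ⟨y, hy⟩ := (hconn x).nonempty
        exact ⟨y, linearIndependent_finSnoc.mpr ⟨hx, hy⟩⟩
      · intro x hx
        have : {y | (x, y) ∈ {p : (Fin k → Fin 4 → ℝ) × (Fin 4 → ℝ) |
            LinearIndependent ℝ (Fin.snoc p.1 p.2 : Fin (k + 1) → Fin 4 → ℝ)}} =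
            (Submodule.span ℝ (Set.range x) : Set (Fin 4 → ℝ))ᶜ := by
          ext y
          exact linearIndependent_finSnoc.trans ⟨fun h => h.2, fun h => ⟨hx, h⟩⟩
        rw [this]
        exact (hconn x).isPreconnected
    convert hpre.image _ hcont.continuousOn using 1
    ext z
    constructor
    · intro hz
      exact ⟨(Fin.init z, z (Fin.last k)), by simpa using hz, by simp⟩
    · rintro ⟨p, hp, rfl⟩
      exact hp

theorem isLinearMap_br (u v w : Fin 4 → ℝ) : IsLinearMap ℝ (br u v w) where
  map_add x y := by simp only [br_eq, Pi.add_apply]; ring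
  map_smul c x := by simp only [br_eq, Pi.smul_apply, smul_eq_mul]; ring

theorem continuous_br {X : Type*} [TopologicalSpace X] {u v w x : X → Fin 4 → ℝ}
    (hu : Continuous u) (hv : Continuous v) (hw : Continuous w) (hx : Continuous x) :
    Continuous fun t => br (u t) (v t) (w t) (x t) := by
  simp only [br_eq]
  fun_prop

/-- The tuples of columns of totally positive matrices with four rows. -/
def positiveTuples (n : ℕ) : Set (Fin n → Fin 4 → ℝ) :=
  {z | ∀ i j k l, i < j → j < k → k < l → 0 < br (z i) (z j) (z k) (z l)}

theorem br_ne_zero_iff_linearIndependent (u v w x : Fin 4 → ℝ) :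
    br u v w x ≠ 0 ↔ LinearIndependent ℝ ![u, v, w, x] := by
  rw [br, pairing_plucker, ← isUnit_iff_ne_zero, ← Matrix.isUnit_iff_isUnit_det,
    ← Matrix.linearIndependent_rows_iff_isUnit]
  rfl

/-- The matrices with positive determinant: given three independent columns, the last column ranges
over an open half-space. -/
theorem isPreconnected_positiveTuples_four : IsPreconnected (positiveTuples 4) := by
  have hcont : Continuous fun p : (Fin 3 → Fin 4 → ℝ) × (Fin 4 → ℝ) =>
      (Fin.snoc p.1 p.2 : Fin 4 → Fin 4 → ℝ) := continuous_snoc _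
  have hsnoc : ∀ (x : Fin 3 → Fin 4 → ℝ) (y : Fin 4 → ℝ),
      (Fin.snoc x y : Fin 4 → Fin 4 → ℝ) = ![x 0, x 1, x 2, y] := by
    intro x y
    ext i
    fin_cases i <;> rfl
  have hpre : IsPreconnected {p : (Fin 3 → Fin 4 → ℝ) × (Fin 4 → ℝ) |
      0 < br (p.1 0) (p.1 1) (p.1 2) p.2} := by
    refine isPreconnected_of_open_fibration (B := {z | LinearIndependent ℝ z}) ?_
      (isPreconnected_linearIndependent le_rfl) ?_ ?_ ?_
    · exact isOpen_lt continuous_const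
        (continuous_br (by fun_prop) (by fun_prop) (by fun_prop) (by fun_prop))
    · rintro ⟨x, y⟩ hp
      have h1 := (br_ne_zero_iff_linearIndependent _ _ _ _).mp (ne_of_gt hp)
      rw [← hsnoc, linearIndependent_finSnoc] at h1
      exact h1.1
    · intro x hx
      have h2 : Submodule.span ℝ (Set.range x) ≠ ⊤ := by
        intro h
        have h1 : Module.finrank ℝ (Submodule.span ℝ (Set.range x)) ≤ 3 := by
          simpa using! finrank_range_le_card (R := ℝ) x
        rw [h, finrank_top, Module.finrank_fin_fun] at h1
        omega
      obtain ⟨y, hy⟩ := SetLike.exists_not_mem_of_ne_top _ h2 rfl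
      have h3 : br (x 0) (x 1) (x 2) y ≠ 0 := by
        rw [br_ne_zero_iff_linearIndependent, ← hsnoc]
        exact linearIndependent_finSnoc.mpr ⟨hx, hy⟩
      rcases lt_or_gt_of_ne h3 with h | h
      · refine ⟨-y, ?_⟩
        have := (isLinearMap_br (x 0) (x 1) (x 2)).map_neg y
        simp only [Set.mem_ofPred_eq, this]
        linarith
      · exact ⟨y, h⟩
    · intro x _
      exact (convex_halfSpace_gt (isLinearMap_br (x 0) (x 1) (x 2)) 0).isPreconnected
  convert hpre.image _ hcont.continuousOn using 1
  ext z
  constructor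
  · intro hz
    refine ⟨(Fin.init z, z (Fin.last 3)), ?_, Fin.snoc_init_self z⟩
    exact hz 0 1 2 3 (by decide) (by decide) (by decide)
  · rintro ⟨p, hp, rfl⟩
    intro i j k l hij hjk hkl
    obtain rfl : i = 0 := by omega
    obtain rfl : j = 1 := by omega
    obtain rfl : k = 2 := by omega
    obtain rfl : l = 3 := by omega
    exact hp

/-- A sum `a + ε b` is positive for small `ε > 0` if its lowest nonvanishing term is positive. -/
theorem eventually_pos_add_mul {a b : ℝ} (h : 0 < a ∨ (0 ≤ a ∧ 0 < b)) :
    ∀ᶠ ε in nhdsWithin (0 : ℝ) (Set.Ioi 0), 0 < a + ε * b := by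
  rcases h with h | ⟨ha, hb⟩
  · have : Continuous fun ε : ℝ => a + ε * b := by fun_prop
    exact nhdsWithin_le_nhds (this.continuousAt.eventually (lt_mem_nhds (by simpa using h)))
  · filter_upwards [self_mem_nhdsWithin] with ε hε
    have := mul_pos (Set.mem_Ioi.mp hε) hb
    linarith

/-- A totally positive `4 × n` matrix with `n ≥ 4` can be extended by a further column: take
`z_n + ε (-z_1 + δ (z_2 - z_{n-1}))` with `ε` and `δ` small. -/
theorem exists_extension_positiveTuples {n : ℕ} (hn : 4 ≤ n) (z : Fin n → Fin 4 → ℝ)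
    (hz : z ∈ positiveTuples n) :
    ∃ y, ∀ i j k : Fin n, i < j → j < k → 0 < br (z i) (z j) (z k) y := by
  set a : Fin n := ⟨0, by omega⟩ with ha
  set b : Fin n := ⟨1, by omega⟩ with hb
  set c : Fin n := ⟨n - 2, by omega⟩ with hc
  set e : Fin n := ⟨n - 1, by omega⟩ with he
  have ex (u v w : Fin 4 → ℝ) (ε : ℝ) (x y : Fin 4 → ℝ) :
      br u v w (x + ε • y) = br u v w x + ε * br u v w y := by
    rw [(isLinearMap_br u v w).map_add, (isLinearMap_br u v w).map_smul, smul_eq_mul]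
  obtain ⟨w, hw⟩ : ∃ w, ∀ i j : Fin n, i < j → j < e → 0 < br (z i) (z j) (z e) w := by
    have : ∀ᶠ δ in nhdsWithin (0 : ℝ) (Set.Ioi 0), ∀ i j : Fin n, i < j → j < e →
        0 < br (z i) (z j) (z e) (-z a + δ • (z b - z c)) := by
      simp only [Filter.eventually_all]
      intro i j hij hje
      rw [show (fun δ : ℝ => 0 < br (z i) (z j) (z e) (-z a + δ • (z b - z c))) =
        fun δ : ℝ => 0 < br (z i) (z j) (z e) (-z a) + δ * br (z i) (z j) (z e) (z b - z c) from
        funext fun δ => by rw [ex]]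
      refine eventually_pos_add_mul ?_
      have hr : br (z i) (z j) (z e) (-z a) = br (z a) (z i) (z j) (z e) := by
        simp only [br_eq, Pi.neg_apply]; ring
      rw [hr]
      rcases (show a ≤ i by simp [ha, Fin.le_def]).lt_or_eq with hai | hai
      · exact Or.inl (hz _ _ _ _ hai hij hje)
      · right
        subst hai
        refine ⟨le_of_eq (by simp only [br_eq]; ring), ?_⟩
        have h1 : br (z a) (z j) (z e) (z b - z c) =
            br (z a) (z b) (z j) (z e) + br (z a) (z j) (z c) (z e) := by
          simp only [br_eq, Pi.sub_apply]; ring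
        have hbj : b ≤ j := by simp [ha, hb, Fin.lt_def, Fin.le_def] at hij ⊢; omega
        have hjc : j ≤ c := by simp [hc, he, Fin.lt_def, Fin.le_def] at hje ⊢; omega
        have hab : a < b := by simp [ha, hb, Fin.lt_def]
        have hce : c < e := by simp [hc, he, Fin.lt_def]; omega
        have hbc : b < c := by simp [hb, hc, Fin.lt_def]; omega
        rw [h1]
        rcases hbj.lt_or_eq with h | h
        · have p1 := hz a b j e hab h hje
          rcases hjc.lt_or_eq with h' | h'
          · have p2 := hz a j c e hij h' hce
            linarith
          · have p2 : br (z a) (z j) (z c) (z e) = 0 := by rw [h']; simp only [br_eq]; ring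
            linarith
        · have p1 : br (z a) (z b) (z j) (z e) = 0 := by rw [h]; simp only [br_eq]; ring
          have p2 := hz a j c e hij (h ▸ hbc) hce
          linarith
    obtain ⟨δ, hδ⟩ := this.exists
    exact ⟨_, hδ⟩
  have : ∀ᶠ ε in nhdsWithin (0 : ℝ) (Set.Ioi 0), ∀ i j k : Fin n, i < j → j < k →
      0 < br (z i) (z j) (z k) (z e + ε • w) := by
    simp only [Filter.eventually_all]
    intro i j k hij hjk
    rw [show (fun ε : ℝ => 0 < br (z i) (z j) (z k) (z e + ε • w)) =
      fun ε : ℝ => 0 < br (z i) (z j) (z k) (z e) + ε * br (z i) (z j) (z k) w from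
      funext fun ε => by rw [ex]]
    refine eventually_pos_add_mul ?_
    rcases (show k ≤ e by simp [he, Fin.le_def]; omega).lt_or_eq with hke | hke
    · exact Or.inl (hz _ _ _ _ hij hjk hke)
    · subst hke
      exact Or.inr ⟨le_of_eq (by simp only [br_eq]; ring), hw i j hij hjk⟩
  obtain ⟨ε, hε⟩ := this.exists
  exact ⟨_, hε⟩

/-- Induction on the number of columns: the possible values of a further column form an
intersection of half-spaces, hence a convex set, and this set is not empty. -/
theorem isPreconnected_positiveTuples (n : ℕ) : IsPreconnected (positiveTuples n) := by
  rcases Nat.lt_or_ge n 4 with hn | hn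
  · have : positiveTuples n = Set.univ := by
      refine Set.eq_univ_of_forall fun z i j k l hij hjk hkl => ?_
      omega
    rw [this]
    exact isPreconnected_univ
  · induction n, hn using Nat.le_induction with
    | base => exact isPreconnected_positiveTuples_four
    | succ n hn ih =>
      have hcont : Continuous fun p : (Fin n → Fin 4 → ℝ) × (Fin 4 → ℝ) =>
          (Fin.snoc p.1 p.2 : Fin (n + 1) → Fin 4 → ℝ) := continuous_snoc _
      have hmem : ∀ (x : Fin n → Fin 4 → ℝ) (y : Fin 4 → ℝ),
          (Fin.snoc x y : Fin (n + 1) → Fin 4 → ℝ) ∈ positiveTuples (n + 1) ↔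
            x ∈ positiveTuples n ∧ ∀ i j k : Fin n, i < j → j < k → 0 < br (x i) (x j) (x k) y := by
        intro x y
        constructor
        · intro h
          refine ⟨fun i j k l hij hjk hkl => ?_, fun i j k hij hjk => ?_⟩
          · simpa using h i.castSucc j.castSucc k.castSucc l.castSucc (by simpa) (by simpa)
              (by simpa)
          · simpa using h i.castSucc j.castSucc k.castSucc (Fin.last n) (by simpa) (by simpa)
              (Fin.castSucc_lt_last k)
        · rintro ⟨h1, h2⟩ i j k l hij hjk hkl
          obtain ⟨k, rfl⟩ := Fin.exists_castSucc_eq.mpr (ne_of_lt (hkl.trans_le (Fin.le_last l)))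
          obtain ⟨j, rfl⟩ := Fin.exists_castSucc_eq.mpr (ne_of_lt (hjk.trans_le (Fin.le_last _)))
          obtain ⟨i, rfl⟩ := Fin.exists_castSucc_eq.mpr (ne_of_lt (hij.trans_le (Fin.le_last _)))
          induction l using Fin.lastCases with
          | last => simpa using h2 i j k (by simpa using hij) (by simpa using hjk)
          | cast l =>
            simpa using h1 i j k l (by simpa using hij) (by simpa using hjk) (by simpa using hkl)
      have hopen : IsOpen (positiveTuples (n + 1)) := by
        simp only [positiveTuples, Set.ofPred_forall]
        refine isOpen_iInter_of_finite fun i => isOpen_iInter_of_finite fun j =>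
          isOpen_iInter_of_finite fun k => isOpen_iInter_of_finite fun l =>
          isOpen_iInter_of_finite fun _ => isOpen_iInter_of_finite fun _ =>
          isOpen_iInter_of_finite fun _ => ?_
        exact isOpen_lt continuous_const
          (continuous_br (by fun_prop) (by fun_prop) (by fun_prop) (by fun_prop))
      have hpre : IsPreconnected {p : (Fin n → Fin 4 → ℝ) × (Fin 4 → ℝ) |
          (Fin.snoc p.1 p.2 : Fin (n + 1) → Fin 4 → ℝ) ∈ positiveTuples (n + 1)} := by
        refine isPreconnected_of_open_fibration (hopen.preimage hcont) ih ?_ ?_ ?_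
        · intro p hp
          exact ((hmem _ _).mp hp).1
        · intro x hx
          obtain ⟨y, hy⟩ := exists_extension_positiveTuples hn x hx
          exact ⟨y, (hmem _ _).mpr ⟨hx, hy⟩⟩
        · intro x hx
          refine Convex.isPreconnected ?_
          have : {y | (x, y) ∈ {p : (Fin n → Fin 4 → ℝ) × (Fin 4 → ℝ) |
              (Fin.snoc p.1 p.2 : Fin (n + 1) → Fin 4 → ℝ) ∈ positiveTuples (n + 1)}} =
              ⋂ (i : Fin n) (j : Fin n) (k : Fin n) (_ : i < j) (_ : j < k),
                {y | 0 < br (x i) (x j) (x k) y} := by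
            ext y
            simp [hmem, hx]
          rw [this]
          exact convex_iInter fun i => convex_iInter fun j => convex_iInter fun k =>
            convex_iInter fun _ => convex_iInter fun _ =>
              convex_halfSpace_gt (isLinearMap_br (x i) (x j) (x k)) 0
      convert hpre.image _ hcont.continuousOn using 1
      ext z
      constructor
      · intro hz
        exact ⟨(Fin.init z, z (Fin.last n)), by simpa using hz, by simp⟩
      · rintro ⟨p, hp, rfl⟩
        exact hp

/-! ### Admissible positions and the sign of a polynomial on positive data -/

theorem val_finRotate {n : ℕ} (i : Fin n) :
    (finRotate n i).val = if i.val + 1 = n then 0 else i.val + 1 := by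
  cases n with
  | zero => exact i.elim0
  | succ n =>
    rw [coe_finRotate]
    simp [Fin.ext_iff]

namespace LandauDiagram

variable {ℓ d : ℕ} (D : LandauDiagram ℓ d)

open Classical in
/-- The distance of the first columns of the `j`-th and the next external line in the tightest
admissible positions. -/
def gap (j : ℕ) : ℕ :=
  if ∃ i k : Fin d, i.val = j ∧ (i.val + 1 = k.val ∨ (i.val + 1 = d ∧ k.val = 0)) ∧ D.H.Adj i k
  then 1 else 2

/-- The first column of the `j`-th external line in the tightest admissible positions. -/
def tightPos (j : ℕ) : ℕ := ∑ i ∈ Finset.range j, D.gap i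

theorem gap_pos (j : ℕ) : 0 < D.gap j := by
  unfold gap; split_ifs <;> norm_num

theorem gap_le_two (j : ℕ) : D.gap j ≤ 2 := by
  unfold gap; split_ifs <;> norm_num

theorem tightPos_succ (j : ℕ) : D.tightPos (j + 1) = D.tightPos j + D.gap j :=
  Finset.sum_range_succ _ _

theorem tightPos_strictMono : StrictMono D.tightPos :=
  strictMono_nat_of_lt_succ fun j => by
    rw [tightPos_succ]
    have := D.gap_pos j
    omega

/-- The tightest admissible positions, as columns of a matrix with `tightPos d` columns. -/
def tightColumn (j : Fin d) : Fin (D.tightPos d) :=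
  ⟨D.tightPos j, D.tightPos_strictMono j.isLt⟩

theorem val_tightColumn (j : Fin d) : (D.tightColumn j).val = D.tightPos j := rfl

theorem gap_eq_one_iff (j : ℕ) : D.gap j = 1 ↔ ∃ i k : Fin d, i.val = j ∧
    (i.val + 1 = k.val ∨ (i.val + 1 = d ∧ k.val = 0)) ∧ D.H.Adj i k := by
  unfold gap
  split_ifs with h
  · exact iff_of_true rfl h
  · exact iff_of_false (by norm_num) h

/-- The tightest positions are admissible: every gap is at most two, so they need at most `2 d`
columns. -/
theorem isPositioned_tightColumn : D.IsPositioned D.tightColumn where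
  le_two_mul := by
    calc D.tightPos d ≤ ∑ _i ∈ Finset.range d, 2 := Finset.sum_le_sum fun i _ => D.gap_le_two i
      _ = 2 * d := by simp [mul_comm]
  strictMono i j hij := D.tightPos_strictMono hij
  first j hj := by rw [val_tightColumn, hj]; rfl
  adj_iff i j hij := by
    rw [val_tightColumn, val_tightColumn, ← hij, tightPos_succ, Nat.add_left_cancel_iff,
      gap_eq_one_iff]
    constructor
    · intro h
      exact ⟨i, j, rfl, Or.inl hij, h⟩
    · rintro ⟨i', k, h1, h2 | h2, h3⟩
      · rwa [Fin.ext h1, show k = j from Fin.ext (by omega)] at h3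
      · omega
  adj_last_iff i j hi hj := by
    have h := congrArg D.tightPos hi
    rw [tightPos_succ] at h
    rw [val_tightColumn, ← h, Nat.add_left_cancel_iff, eq_comm, gap_eq_one_iff]
    constructor
    · intro h
      exact ⟨i, j, rfl, Or.inr ⟨hi, hj⟩, h⟩
    · rintro ⟨i', k, h1, h2 | h2, h3⟩
      · omega
      · rwa [Fin.ext h1, show k = j from Fin.ext (by omega)] at h3

variable {D}

/-- Deleting the columns that are not used, the positions become the tightest ones. -/
theorem IsPositioned.exists_tight {n : ℕ} {p : Fin d → Fin n} (hp : D.IsPositioned p) (hd : 0 < d)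
    (Z : Matrix (Fin 4) (Fin n) ℝ) (hZ : TotallyPositive Z) :
    ∃ Z' : Matrix (Fin 4) (Fin (D.tightPos d)) ℝ, TotallyPositive Z' ∧
      consecutiveLines Z p = consecutiveLines Z' D.tightColumn := by
  classical
  let q : ℕ → ℕ := fun j => if h : j < d then (p ⟨j, h⟩).val else n
  have hq : ∀ (j : ℕ) (h : j < d), q j = (p ⟨j, h⟩).val := fun j h => dif_pos h
  have hqd : q d = n := dif_neg (lt_irrefl d)
  have hq0 : q 0 = 0 := by rw [hq 0 hd]; exact hp.first ⟨0, hd⟩ rfl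
  have hqlt : ∀ j < d, q j < q (j + 1) := by
    intro j hj
    rw [hq j hj]
    by_cases h : j + 1 < d
    · rw [hq _ h]
      exact hp.strictMono (by simp [Fin.lt_def])
    · rw [show j + 1 = d by omega, hqd]
      exact (p ⟨j, hj⟩).isLt
  have hgap : ∀ j < d, D.gap j = 1 ↔ q (j + 1) = q j + 1 := by
    intro j hj
    rw [gap_eq_one_iff, hq j hj]
    by_cases h : j + 1 < d
    · rw [hq _ h, ← hp.adj_iff ⟨j, hj⟩ ⟨j + 1, h⟩ rfl]
      constructor
      · rintro ⟨i, k, rfl, h2 | h2, h3⟩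
        · rwa [show (⟨i.val + 1, h⟩ : Fin d) = k from Fin.ext h2]
        · omega
      · intro h2
        exact ⟨_, _, rfl, Or.inl rfl, h2⟩
    · have hjd : j + 1 = d := by omega
      rw [hjd, hqd, eq_comm (a := n), ← hp.adj_last_iff ⟨j, hj⟩ ⟨0, hd⟩ hjd rfl]
      constructor
      · rintro ⟨i, k, rfl, h2 | h2, h3⟩
        · omega
        · rwa [show (⟨0, hd⟩ : Fin d) = k from Fin.ext h2.2.symm]
      · intro h2
        exact ⟨_, _, rfl, Or.inr ⟨hjd, rfl⟩, h2⟩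
  have hle : ∀ j < d, q j + D.gap j ≤ q (j + 1) := by
    intro j hj
    have h1 := hqlt j hj
    have h2 := hgap j hj
    have h3 := D.gap_le_two j
    have h4 := D.gap_pos j
    by_cases h : D.gap j = 1
    · omega
    · have : q (j + 1) ≠ q j + 1 := fun h' => h (h2.mpr h')
      omega
  have hmono : ∀ i j, i ≤ j → j ≤ d → q i ≤ q j := by
    intro i j hij
    induction j, hij using Nat.le_induction with
    | base => intro _; exact le_rfl
    | succ j _ ih => intro h; exact (ih (by omega)).trans (hqlt j (by omega)).le
  -- the index of the external line to which a column of the tight matrix belongs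
  let J : ℕ → ℕ := fun t => Nat.findGreatest (fun j => D.tightPos j ≤ t) d
  have hJle : ∀ t, D.tightPos (J t) ≤ t := fun t =>
    Nat.findGreatest_spec (P := fun j => D.tightPos j ≤ t) (Nat.zero_le d)
      (by simp [tightPos])
  have hJlt : ∀ t, t < D.tightPos d → J t < d := by
    intro t ht
    refine lt_of_le_of_ne (Nat.findGreatest_le d) fun h => ?_
    have := hJle t
    rw [h] at this
    omega
  have hJsucc : ∀ t, t < D.tightPos d → t < D.tightPos (J t) + D.gap (J t) := by
    intro t ht
    rw [← tightPos_succ]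
    by_contra h
    exact Nat.findGreatest_is_greatest (P := fun j => D.tightPos j ≤ t) (n := d)
      (Nat.lt_succ_self (J t)) (hJlt t ht) (not_lt.mp h)
  have hJmono : ∀ s t, s ≤ t → J s ≤ J t := fun s t hst =>
    Nat.findGreatest_mono (fun j hj => le_trans hj hst) le_rfl
  have hJeq : ∀ j t, j ≤ d → D.tightPos j ≤ t → t < D.tightPos (j + 1) → J t = j := by
    intro j t hj h1 h2
    refine le_antisymm ?_ (Nat.le_findGreatest hj h1)
    by_contra h
    have h3 := D.tightPos_strictMono.monotone (show j + 1 ≤ J t by omega)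
    have := hJle t
    omega
  let c : ℕ → ℕ := fun t => q (J t) + (t - D.tightPos (J t))
  have hclt : ∀ t, t < D.tightPos d → c t < q (J t + 1) := by
    intro t ht
    have h1 := hle (J t) (hJlt t ht)
    have h2 := hJsucc t ht
    have h3 := hJle t
    simp only [c]
    omega
  have hcn : ∀ t, t < D.tightPos d → c t < n := fun t ht =>
    hqd ▸ (hclt t ht).trans_le (hmono _ _ (hJlt t ht) le_rfl)
  have hcmono : ∀ s t, s < t → t < D.tightPos d → c s < c t := by
    intro s t hst ht
    rcases (hJmono s t hst.le).lt_or_eq with h | h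
    · have h1 := hclt s (hst.trans ht)
      have h2 := hmono (J s + 1) (J t) h (hJlt t ht).le
      simp only [c] at h1 ⊢
      omega
    · have h1 := hJle s
      simp only [c, ← h]
      omega
  let ι : Fin (D.tightPos d) → Fin n := fun t => ⟨c t, hcn t t.isLt⟩
  have hcol : ∀ j : Fin d, ι (D.tightColumn j) = p j := by
    intro j
    have h1 : J (D.tightPos j) = j := hJeq j _ j.isLt.le le_rfl
      (D.tightPos_strictMono (Nat.lt_succ_self _))
    ext
    simp only [ι, c, tightColumn, h1, hq j j.isLt]
    simp
  have hnext : ∀ j : Fin d, ι (finRotate _ (D.tightColumn j)) = finRotate n (p j) := by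
    intro j
    have hJ0 : c 0 = 0 := by
      have : J 0 = 0 := hJeq 0 0 (Nat.zero_le d) (by simp [tightPos])
        (by rw [tightPos_succ]; have := D.gap_pos 0; omega)
      simp [c, this, hq0]
    have hlt := D.tightPos_strictMono.monotone (show j.val + 1 ≤ d from j.isLt)
    have hs := D.tightPos_succ j
    have hpj := hq j j.isLt
    have hgp := hgap j j.isLt
    have hqj := hqlt j j.isLt
    have hg2 := D.gap_le_two j
    have hg1 := D.gap_pos j
    have hqn := hmono (j.val + 1) d j.isLt le_rfl
    ext
    simp only [ι]
    rw [val_finRotate, val_finRotate]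
    simp only [Fin.eta] at hpj
    rw [val_tightColumn]
    by_cases hg : D.gap j = 1
    · by_cases h : j.val + 1 = d
      · have e1 : D.tightPos j + 1 = D.tightPos d := by
          have := congrArg D.tightPos h
          omega
        have e2 : (p j).val + 1 = n := by rw [← hpj, ← hgp.mp hg, h, hqd]
        rw [if_pos e1, if_pos e2, hJ0]
      · have hjd : j.val + 1 < d := by omega
        have e1 : D.tightPos (j.val + 1) < D.tightPos d := D.tightPos_strictMono hjd
        have e2 := hqlt _ hjd
        have e3 := hmono (j.val + 1 + 1) d hjd le_rfl
        have h1 : J (D.tightPos (j.val + 1)) = j.val + 1 := hJeq _ _ hjd.le le_rfl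
          (D.tightPos_strictMono (Nat.lt_succ_self _))
        rw [if_neg (by omega), if_neg (by have := hgp.mp hg; omega), ← hpj, ← hgp.mp hg,
          show D.tightPos j + 1 = D.tightPos (j.val + 1) by omega]
        simp [c, h1]
    · have hne : q (j.val + 1) ≠ q j.val + 1 := fun h' => hg (hgp.mpr h')
      have h1 : J (D.tightPos j + 1) = j := hJeq _ _ j.isLt.le (by omega) (by omega)
      rw [if_neg (by omega), if_neg (by omega)]
      simp only [c, h1, hpj]
      omega
  refine ⟨Z.submatrix id ι, ?_, ?_⟩
  · intro e he
    exact hZ (ι ∘ e) fun s t hst => hcmono _ _ (he hst) (e t).isLt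
  · funext j
    simp only [consecutiveLines, Matrix.submatrix_apply, id_eq, hcol, hnext]

/-- A polynomial without zeros on the positive data of a diagram has constant sign there. -/
theorem isCopositive_or_neg_of_ne_zero (D : LandauDiagram ℓ d)
    (f : MvPolynomial (Fin d × Fin 6) ℝ)
    (hf : ∀ M, D.IsPositive M → eval (fun jk : Fin d × Fin 6 => M jk.1 jk.2) f ≠ 0) :
    D.IsCopositive f ∨ D.IsCopositive (-f) := by
  have heval : ∀ (g : MvPolynomial (Fin d × Fin 6) ℝ) (n : ℕ) (p : Fin d → Fin n)
      (Z : Matrix (Fin 4) (Fin n) ℝ), eval (fun rc : Fin 4 × Fin n => Z rc.1 rc.2)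
        (twistorPolynomial g p) =
      eval (fun jk : Fin d × Fin 6 => consecutiveLines Z p jk.1 jk.2) g := by
    intro g n p Z
    rw [twistorPolynomial, map_aeval]
    have h1 : (eval fun rc : Fin 4 × Fin n => Z rc.1 rc.2).comp
        (algebraMap ℝ (MvPolynomial (Fin 4 × Fin n) ℝ)) = RingHom.id ℝ := by
      ext x
      simp
    rw [h1]
    have h2 : (fun jk : Fin d × Fin 6 => eval (fun rc : Fin 4 × Fin n => Z rc.1 rc.2)
        (consecutiveLines (Matrix.mvPolynomialX (Fin 4) (Fin n) ℝ) p jk.1 jk.2)) =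
        fun jk => consecutiveLines Z p jk.1 jk.2 := by
      funext ⟨j, k⟩
      fin_cases k <;> simp [consecutiveLines, plucker, Matrix.mvPolynomialX]
    rw [h2]
    rfl
  -- the values on any two positive tuples have the same sign
  have hsign : ∀ M M', D.IsPositive M → D.IsPositive M' →
      0 < eval (fun jk : Fin d × Fin 6 => M jk.1 jk.2) f →
      0 < eval (fun jk : Fin d × Fin 6 => M' jk.1 jk.2) f := by
    rcases Nat.eq_zero_or_pos d with rfl | hd
    · intro M M' _ _ h
      rwa [Subsingleton.elim M' M]
    rintro M M' ⟨n, p, Z, hp, hZ, rfl⟩ ⟨n', p', Z', hp', hZ', rfl⟩ hM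
    obtain ⟨Y, hY, hYZ⟩ := hp.exists_tight hd Z hZ
    obtain ⟨Y', hY', hYZ'⟩ := hp'.exists_tight hd Z' hZ'
    have hTP : ∀ z ∈ positiveTuples (D.tightPos d), D.IsPositive
        (consecutiveLines (fun r i => z i r) D.tightColumn) := fun z hz =>
      ⟨_, _, _, D.isPositioned_tightColumn, (totallyPositive_iff_br _).mpr hz, rfl⟩
    let g : (Fin (D.tightPos d) → Fin 4 → ℝ) → ℝ := fun z =>
      eval (fun jk : Fin d × Fin 6 =>
        consecutiveLines (fun r i => z i r) D.tightColumn jk.1 jk.2) f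
    have hg : Continuous g := by
      refine (MvPolynomial.continuous_eval f).comp (continuous_pi fun ⟨j, k⟩ => ?_)
      fin_cases k <;> simp [consecutiveLines, plucker] <;> fun_prop
    have hconn := (isPreconnected_positiveTuples (D.tightPos d)).image g hg.continuousOn
    rw [hYZ] at hM
    rw [hYZ']
    by_contra hcon
    have h0 : (0 : ℝ) ∈ g '' positiveTuples (D.tightPos d) :=
      hconn.ordConnected.out
        (Set.mem_image_of_mem g (x := fun i r => Y' r i) ((totallyPositive_iff_br _).mp hY'))
        (Set.mem_image_of_mem g (x := fun i r => Y r i) ((totallyPositive_iff_br _).mp hY))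
        ⟨not_lt.mp hcon, hM.le⟩
    obtain ⟨z, hz, hz0⟩ := h0
    exact hf _ (hTP z hz) hz0
  by_cases h : ∃ M, D.IsPositive M ∧ 0 < eval (fun jk : Fin d × Fin 6 => M jk.1 jk.2) f
  · obtain ⟨M, hM, hM0⟩ := h
    left
    intro n p hp Z hZ
    rw [heval]
    exact hsign M _ hM ⟨n, p, Z, hp, hZ, rfl⟩ hM0
  · right
    intro n p hp Z hZ
    rw [heval, map_neg, neg_pos]
    have hpos : D.IsPositive (consecutiveLines Z p) := ⟨n, p, Z, hp, hZ, rfl⟩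
    exact lt_of_le_of_ne (not_lt.mp fun h' => h ⟨_, hpos, h'⟩) (hf _ hpos)

/-- An LS discriminant has no zeros on positive data if no fiber over positive data is degenerate,
and then it has constant sign there. -/
theorem copositive_of_encard_fiber {P : Ideal (CoordRing ℓ)} (hP : 2 ≤ lsDegree P D.attach)
    (h : ∀ M, D.IsPositive M →
      (fiber P D.attach (fun j k => (M j k : ℂ))).encard = lsDegree P D.attach) :
    (∃ Δ, IsLSDiscriminant P D.attach Δ) ∧
    ∀ Δ, IsLSDiscriminant P D.attach Δ →
      ∀ f, f ∣ Δ → D.IsCopositive f ∨ D.IsCopositive (-f) := by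
  refine ⟨exists_isLSDiscriminant P _ (by omega), fun Δ hΔ f hf =>
    isCopositive_or_neg_of_ne_zero D f fun M hM h0 => ?_⟩
  refine hΔ.aeval_ne_zero hf (fun j k => (M j k : ℂ)) (fun hc => hc (h M hM)) ?_
  have h1 := congrArg (algebraMap ℝ ℂ) h0
  rw [map_zero] at h1
  rw [← h1]
  exact aeval_algebraMap_apply ℂ (fun jk : Fin d × Fin 6 => M jk.1 jk.2) f

theorem RealityHolds.discriminantsCopositive (h : D.RealityHolds) : D.DiscriminantsCopositive :=
  fun P hP h2 => copositive_of_encard_fiber h2 fun M hM => (h P hP M hM).1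

end LandauDiagram

/-! ### Quadratic relations between brackets -/

section Bracket

variable {R : Type*} [CommRing R]

/-- The three-term Plücker relation in the quotient by two vectors `u`, `v`. -/
theorem br_mul_br_sub (a b u v z z' : Fin 4 → R) :
    br a u v z * br b u v z' - br b u v z * br a u v z' = br a b u v * br u v z z' := by
  simp only [br_eq]; ring

/-- Two expressions for the condition that three lines, spanned by the first, second and third
pair of points, are concurrent after projection from `p`. -/
theorem br_concurrent_eq_left (p x₁ x₂ x₃ x₄ x₅ x₆ : Fin 4 → R) :
    br p x₁ x₃ x₄ * br p x₂ x₅ x₆ - br p x₂ x₃ x₄ * br p x₁ x₅ x₆ =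
      br p x₁ x₂ x₄ * br p x₃ x₅ x₆ - br p x₁ x₂ x₃ * br p x₄ x₅ x₆ := by
  simp only [br_eq]; ring

theorem br_concurrent_eq_right (p x₁ x₂ x₃ x₄ x₅ x₆ : Fin 4 → R) :
    br p x₁ x₃ x₄ * br p x₂ x₅ x₆ - br p x₂ x₃ x₄ * br p x₁ x₅ x₆ =
      br p x₁ x₂ x₅ * br p x₃ x₄ x₆ - br p x₁ x₂ x₆ * br p x₃ x₄ x₅ := by
  simp only [br_eq]; ring

/-- The left hand side is the coefficient of `s` in the determinant of the pencil of bilinear forms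
`⟨· · a₃ b₃⟩ + s ⟨· · a₄ b₄⟩` on the lines `a₁ b₁` and `a₂ b₂`. Hence the discriminant of this
pencil is the Gram determinant of the four lines `aᵢ bᵢ`. -/
theorem br_gram_aux (a₁ b₁ a₂ b₂ a₃ b₃ a₄ b₄ : Fin 4 → R) :
    br a₁ a₂ a₃ b₃ * br b₁ b₂ a₄ b₄ + br b₁ b₂ a₃ b₃ * br a₁ a₂ a₄ b₄
      - br a₁ b₂ a₃ b₃ * br b₁ a₂ a₄ b₄ - br b₁ a₂ a₃ b₃ * br a₁ b₂ a₄ b₄ =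
    br a₁ b₁ a₃ b₃ * br a₂ b₂ a₄ b₄ + br a₁ b₁ a₄ b₄ * br a₂ b₂ a₃ b₃
      - br a₁ b₁ a₂ b₂ * br a₃ b₃ a₄ b₄ := by
  simp only [br_eq]; ring

end Bracket

/-! ### Comparing ratios of brackets -/

section Step

variable {R : Type*} [CommRing R] (a b u v z z' : Fin 4 → R)

/-- Replacing one entry `z` by `z'`, possibly at another place, changes the ratio `⟨a …⟩ / ⟨b …⟩` of
two brackets by an amount whose sign is given by a three-term relation. The names of this lemma and
of the following ones refer to the places of `z` and `z'` among the last three entries. -/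
theorem br_step_first_first :
    br a z u v * br b z' u v - br b z u v * br a z' u v = br a b u v * br z z' u v := by
  simp only [br_eq]; ring

theorem br_step_first_mid :
    br a z u v * br b u z' v - br b z u v * br a u z' v = br a b u v * br z u z' v := by
  simp only [br_eq]; ring

theorem br_step_first_last :
    br a z u v * br b u v z' - br b z u v * br a u v z' = br a b u v * br z u v z' := by
  simp only [br_eq]; ring

theorem br_step_mid_mid :
    br a u z v * br b u z' v - br b u z v * br a u z' v = br a b u v * br u z z' v := by
  simp only [br_eq]; ring

theorem br_step_mid_last :
    br a u z v * br b u v z' - br b u z v * br a u v z' = br a b u v * br u z v z' := by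
  simp only [br_eq]; ring

theorem br_step_last_last :
    br a u v z * br b u v z' - br b u v z * br a u v z' = br a b u v * br u v z z' :=
  br_mul_br_sub a b u v z z'

end Step

section Ratio

variable {p q p' q' c s : ℝ}

/-- If `p / q ≥ p' / q'` and `s ≥ p / q` then `s ≥ p' / q'`. -/
theorem ratio_nonpos (h : p * q' - q * p' = c) (hc : 0 ≤ c) (hq : 0 < q) (hq' : 0 < q')
    (hp : p - s * q ≤ 0) : p' - s * q' ≤ 0 := by
  by_contra hcon
  nlinarith [mul_pos hq (not_le.mp hcon), mul_nonneg hq'.le (neg_nonneg.mpr hp)]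

/-- The ratio `p / q` is at least `p' / q'` if `0 ≤ c`; so `p / q < s` implies `p' / q' < s`. -/
theorem ratio_neg_of_neg (h : p * q' - q * p' = c) (hc : 0 ≤ c) (hq : 0 < q) (hq' : 0 < q')
    (hp : p - s * q < 0) : p' - s * q' < 0 := by
  by_contra hcon
  nlinarith [mul_nonneg hq.le (not_lt.mp hcon), mul_pos hq' (neg_pos.mpr hp)]

theorem ratio_neg (h : p * q' - q * p' = c) (hc : 0 < c) (hq : 0 < q) (hq' : 0 < q')
    (hp : p - s * q ≤ 0) : p' - s * q' < 0 := by
  by_contra hcon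
  nlinarith [mul_nonneg hq.le (not_lt.mp hcon), mul_nonneg hq'.le (neg_nonneg.mpr hp)]

theorem ratio_nonneg (h : p * q' - q * p' = c) (hc : 0 ≤ c) (hq : 0 < q) (hq' : 0 < q')
    (hp : 0 ≤ p' - s * q') : 0 ≤ p - s * q := by
  by_contra hcon
  nlinarith [mul_pos hq' (neg_pos.mpr (not_le.mp hcon)), mul_nonneg hq.le hp]

theorem ratio_pos (h : p * q' - q * p' = c) (hc : 0 < c) (hq : 0 < q) (hq' : 0 < q')
    (hp : 0 ≤ p' - s * q') : 0 < p - s * q := by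
  by_contra hcon
  nlinarith [mul_nonneg hq'.le (neg_nonneg.mpr (not_lt.mp hcon)), mul_nonneg hq.le hp]

end Ratio

/-- The sign of the concurrency condition for three lines `x₁ x₂`, `x₃ x₄`, `x₅ x₆` seen from a
point `p`, when the points are in convex position: the lines are not concurrent. The quotient
`⟨p x₁ x y⟩ / ⟨p x₂ x y⟩` decreases from `x₃ x₄` via `x₃ x₅` and `x₃ x₆` to `x₅ x₆`. -/
theorem br_concurrent_pos {p x₁ x₂ x₃ x₄ x₅ x₆ : Fin 4 → ℝ}
    (h123 : 0 < br p x₁ x₂ x₃) (h126 : 0 < br p x₁ x₂ x₆)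
    (h234 : 0 < br p x₂ x₃ x₄) (h235 : 0 < br p x₂ x₃ x₅) (h236 : 0 < br p x₂ x₃ x₆)
    (h256 : 0 < br p x₂ x₅ x₆) (h345 : 0 < br p x₃ x₄ x₅) (h356 : 0 < br p x₃ x₅ x₆) :
    0 < br p x₁ x₃ x₄ * br p x₂ x₅ x₆ - br p x₂ x₃ x₄ * br p x₁ x₅ x₆ := by
  have swp : ∀ u v w x : Fin 4 → ℝ, br u v w x = - br v u w x := by
    intro u v w x; simp only [br_eq]; ring
  have key : ∀ u z z', br p x₁ u z * br p x₂ u z' - br p x₂ u z * br p x₁ u z' =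
      br p x₁ x₂ u * br p u z z' := by
    intro u z z'
    have := br_mul_br_sub x₁ x₂ p u z z'
    rw [show br x₁ x₂ p u = br p x₁ x₂ u by simp only [br_eq]; ring] at this
    simp only [swp x₁ p, swp x₂ p] at this
    linarith
  have s1 := key x₃ x₄ x₅
  have s2 := key x₃ x₅ x₆
  have s3 : br p x₁ x₃ x₆ * br p x₂ x₅ x₆ - br p x₂ x₃ x₆ * br p x₁ x₅ x₆ =
      br p x₁ x₂ x₆ * br p x₃ x₅ x₆ := by
    simp only [br_eq]; ring
  have i1 := mul_pos h123 h345
  have i2 := mul_pos h123 h356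
  have i3 := mul_pos h126 h356
  set t := br p x₁ x₃ x₄ / br p x₂ x₃ x₄ with ht
  have e0 : br p x₁ x₃ x₄ = t * br p x₂ x₃ x₄ := by rw [ht]; field_simp
  have n1 : br p x₁ x₃ x₅ - t * br p x₂ x₃ x₅ ≤ 0 :=
    ratio_nonpos s1 i1.le h234 h235 (by linarith)
  have n2 := ratio_nonpos s2 i2.le h235 h236 n1
  have n3 := ratio_neg s3 i3 h236 h256 n2
  rw [e0]
  nlinarith [mul_pos h234 (neg_pos.mpr n3)]

/-- Points `w 0, w 1, …, w (n-1)` spanning lines `w 0 w 1`, `w 2 w 3`, … such that all brackets in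
increasing order are nonnegative, and zero at most for two of these lines. -/
structure PosSeq {n : ℕ} (w : Fin n → Fin 4 → ℝ) : Prop where
  nonneg : ∀ i j k l, i < j → j < k → k < l → 0 ≤ br (w i) (w j) (w k) (w l)
  pos : ∀ i j k l, i < j → j < k → k < l →
    ¬((i.val % 2 = 0 ∧ j.val = i.val + 1) ∧ (k.val % 2 = 0 ∧ l.val = k.val + 1)) →
    0 < br (w i) (w j) (w k) (w l)

namespace PosSeq

variable {n : ℕ} {w : Fin n → Fin 4 → ℝ}

theorem lt (h : PosSeq w) (i j k l : Fin n) (hd : (i < j ∧ j < k ∧ k < l) ∧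
    ¬((i.val % 2 = 0 ∧ j.val = i.val + 1) ∧ (k.val % 2 = 0 ∧ l.val = k.val + 1)) := by decide) :
    0 < br (w i) (w j) (w k) (w l) :=
  h.pos i j k l hd.1.1 hd.1.2.1 hd.1.2.2 hd.2

theorem le (h : PosSeq w) (i j k l : Fin n) (hd : i < j ∧ j < k ∧ k < l := by decide) :
    0 ≤ br (w i) (w j) (w k) (w l) :=
  h.nonneg i j k l hd.1 hd.2.1 hd.2.2

end PosSeq

/-- For four lines in positive position the Gram determinant of the Plücker form is positive, i.e.
the lines have two distinct real common transversals. -/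
theorem gram_pos {w : Fin 8 → Fin 4 → ℝ} (h : PosSeq w) :
    0 < (br (w 0) (w 1) (w 4) (w 5) * br (w 2) (w 3) (w 6) (w 7)
        + br (w 0) (w 1) (w 6) (w 7) * br (w 2) (w 3) (w 4) (w 5)
        - br (w 0) (w 1) (w 2) (w 3) * br (w 4) (w 5) (w 6) (w 7)) ^ 2
      - 4 * (br (w 0) (w 1) (w 4) (w 5) * br (w 2) (w 3) (w 4) (w 5))
        * (br (w 0) (w 1) (w 6) (w 7) * br (w 2) (w 3) (w 6) (w 7)) := by
  rw [← br_gram_aux]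
  have c1 := br_concurrent_pos (p := w 0) (h.lt 0 2 3 4) (h.lt 0 2 3 7) (h.lt 0 3 4 5)
    (h.lt 0 3 4 6) (h.lt 0 3 4 7) (h.lt 0 3 6 7) (h.lt 0 4 5 6) (h.lt 0 4 6 7)
  have rot : ∀ u v w x : Fin 4 → ℝ, br u v w (-x) = br x u v w := by
    intro u v w x; simp only [br_eq, Pi.neg_apply]; ring
  have rot2 : ∀ u v w x : Fin 4 → ℝ, br u v (-w) (-x) = br w x u v := by
    intro u v w x; simp only [br_eq, Pi.neg_apply]; ring
  have c2 := br_concurrent_pos (p := w 3) (x₁ := w 4) (x₂ := w 5) (x₃ := w 6) (x₄ := w 7)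
    (x₅ := -w 0) (x₆ := -w 1) (h.lt 3 4 5 6) (by rw [rot]; exact h.lt 1 3 4 5) (h.lt 3 5 6 7)
    (by rw [rot]; exact h.lt 0 3 5 6) (by rw [rot]; exact h.lt 1 3 5 6)
    (by rw [rot2]; exact h.lt 0 1 3 5) (by rw [rot]; exact h.lt 0 3 6 7)
    (by rw [rot2]; exact h.lt 0 1 3 6)
  rw [br_concurrent_eq_right, rot, rot, rot, rot] at c2
  have d3 : br (w 0) (w 2) (w 4) (w 5) * br (w 1) (w 3) (w 4) (w 5)
      - br (w 0) (w 3) (w 4) (w 5) * br (w 1) (w 2) (w 4) (w 5) =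
      br (w 0) (w 1) (w 4) (w 5) * br (w 2) (w 3) (w 4) (w 5) := by
    have := br_step_first_first (w 0) (w 1) (w 4) (w 5) (w 2) (w 3)
    linarith
  have d4 : br (w 0) (w 2) (w 6) (w 7) * br (w 1) (w 3) (w 6) (w 7)
      - br (w 0) (w 3) (w 6) (w 7) * br (w 1) (w 2) (w 6) (w 7) =
      br (w 0) (w 1) (w 6) (w 7) * br (w 2) (w 3) (w 6) (w 7) := by
    have := br_step_first_first (w 0) (w 1) (w 6) (w 7) (w 2) (w 3)
    linarith
  have p3 : 0 ≤ br (w 0) (w 1) (w 4) (w 5) * br (w 2) (w 3) (w 4) (w 5) :=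
    mul_nonneg (h.le 0 1 4 5) (h.le 2 3 4 5)
  have p4 : 0 ≤ br (w 0) (w 1) (w 6) (w 7) * br (w 2) (w 3) (w 6) (w 7) :=
    mul_nonneg (h.le 0 1 6 7) (h.le 2 3 6 7)
  rw [← d3, ← d4] at *
  have q12 := h.lt 0 3 6 7
  have q12' := h.lt 0 3 4 5
  generalize br (w 0) (w 2) (w 4) (w 5) = A11 at *
  generalize br (w 0) (w 3) (w 4) (w 5) = A12 at *
  generalize br (w 1) (w 2) (w 4) (w 5) = A21 at *
  generalize br (w 1) (w 3) (w 4) (w 5) = A22 at *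
  generalize br (w 0) (w 2) (w 6) (w 7) = B11 at *
  generalize br (w 0) (w 3) (w 6) (w 7) = B12 at *
  generalize br (w 1) (w 2) (w 6) (w 7) = B21 at *
  generalize br (w 1) (w 3) (w 6) (w 7) = B22 at *
  -- the determinant of the pencil is negative at the parameter `A12 / B12`
  have f : (A11 * A22 - A12 * A21) * B12 ^ 2
      - (A11 * B22 + A22 * B11 - A12 * B21 - A21 * B12) * (A12 * B12)
      + (B11 * B22 - B12 * B21) * A12 ^ 2 < 0 := by
    have : (A11 * B12 - A12 * B11) * (A12 * B22 - A22 * B12) > 0 :=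
      mul_pos (by linarith) (by linarith)
    nlinarith
  set dA := A11 * A22 - A12 * A21
  set dB := B11 * B22 - B12 * B21
  have e1 : 0 < A12 * B12 := mul_pos q12' q12
  have e2 : 0 ≤ dA * B12 ^ 2 := by positivity
  have e3 : 0 ≤ dB * A12 ^ 2 := by positivity
  have e4 : 0 < ((A11 * B22 + A22 * B11 - A12 * B21 - A21 * B12) ^ 2 - 4 * dA * dB)
      * (A12 * B12) ^ 2 := by
    nlinarith [sq_nonneg (dA * B12 ^ 2 - dB * A12 ^ 2)]
  have e5 := (pos_iff_pos_of_mul_pos e4).2 (by positivity)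
  convert e5 using 2

/-! ### Transversals of four real lines in positive position -/

/-- The bracket `⟨(a - s b) x y z⟩`, a linear function of the parameter `s` of a point on the line
`a b`. -/
def pencil (a b : Fin 4 → ℝ) (s : ℝ) (x y z : Fin 4 → ℝ) : ℝ := br a x y z - s * br b x y z

theorem pencil_eq (a b : Fin 4 → ℝ) (s : ℝ) (x y z : Fin 4 → ℝ) :
    pencil a b s x y z = br (a - s • b) x y z := by
  simp only [pencil, br_eq, Pi.sub_apply, Pi.smul_apply, smul_eq_mul]; ring

theorem pencil_div_eq_zero (a b : Fin 4 → ℝ) {x y z : Fin 4 → ℝ} (h : 0 < br b x y z) :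
    pencil a b (br a x y z / br b x y z) x y z = 0 := by
  rw [pencil, div_mul_cancel₀ _ h.ne', sub_self]

theorem pencil_nonpos_iff (a b : Fin 4 → ℝ) {s : ℝ} {x y z : Fin 4 → ℝ} (h : 0 < br b x y z) :
    pencil a b s x y z ≤ 0 ↔ br a x y z / br b x y z ≤ s := by
  rw [pencil, div_le_iff₀ h, sub_nonpos]

theorem pencil_pos_iff (a b : Fin 4 → ℝ) {s : ℝ} {x y z : Fin 4 → ℝ} (h : 0 < br b x y z) :
    0 < pencil a b s x y z ↔ s < br a x y z / br b x y z := by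
  rw [pencil, lt_div_iff₀ h, sub_pos]

theorem pencil_neg_iff (a b : Fin 4 → ℝ) {s : ℝ} {x y z : Fin 4 → ℝ} (h : 0 < br b x y z) :
    pencil a b s x y z < 0 ↔ br a x y z / br b x y z < s := by
  rw [pencil, div_lt_iff₀ h, sub_neg]

/-- The parameters `(s, s₄)` of the points `w 0 - s w 1` and `w 6 - s₄ w 7` at which a common
transversal of the four lines `w 0 w 1`, …, `w 6 w 7` meets the first and the last line. The
inequalities locate the smaller, respectively the larger of the two possible values of `s`. -/
structure IsTransversal (w : Fin 8 → Fin 4 → ℝ) (s s₄ : ℝ) : Prop where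
  meets₂ : pencil (w 0) (w 1) s (w 2) (w 3) (w 6) = s₄ * pencil (w 0) (w 1) s (w 2) (w 3) (w 7)
  meets₃ : pencil (w 0) (w 1) s (w 4) (w 5) (w 6) = s₄ * pencil (w 0) (w 1) s (w 4) (w 5) (w 7)
  location : (pencil (w 0) (w 1) s (w 4) (w 6) (w 7) ≤ 0 ∧
      0 < pencil (w 0) (w 1) s (w 2) (w 6) (w 7)) ∨ pencil (w 0) (w 1) s (w 2) (w 4) (w 5) ≤ 0

/-- A quadratic polynomial with positive leading coefficient has a root to the right of any point
at which it is not positive. -/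
theorem exists_root_ge {e₀ e₁ e₂ t : ℝ} (h₂ : 0 < e₂) (ht : e₂ * t ^ 2 + e₁ * t + e₀ ≤ 0) :
    ∃ s, t ≤ s ∧ e₂ * s ^ 2 + e₁ * s + e₀ = 0 := by
  have hd : (2 * e₂ * t + e₁) ^ 2 ≤ e₁ ^ 2 - 4 * e₂ * e₀ := by nlinarith
  have h0 := (sq_nonneg _).trans hd
  have h1 := (le_abs_self _).trans (Real.abs_le_sqrt hd)
  have h3 := Real.sq_sqrt h0
  refine ⟨(-e₁ + √(e₁ ^ 2 - 4 * e₂ * e₀)) / (2 * e₂), ?_, ?_⟩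
  · rw [le_div_iff₀ (by positivity)]; linarith
  · generalize √(e₁ ^ 2 - 4 * e₂ * e₀) = r at *
    field_simp
    nlinarith

/-- A quadratic polynomial with positive leading coefficient is negative between two points at
which it is not positive. -/
theorem quadratic_neg_of_between {e₀ e₁ e₂ t t' s : ℝ} (h₂ : 0 < e₂)
    (ht : e₂ * t ^ 2 + e₁ * t + e₀ ≤ 0) (ht' : e₂ * t' ^ 2 + e₁ * t' + e₀ ≤ 0)
    (h : t < s) (h' : s < t') : e₂ * s ^ 2 + e₁ * s + e₀ < 0 := by
  by_contra hcon
  have a := mul_pos (mul_pos h₂ (sub_pos.2 (h.trans h'))) (mul_pos (sub_pos.2 h) (sub_pos.2 h'))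
  nlinarith [mul_nonneg (sub_pos.2 (h.trans h')).le (not_lt.1 hcon),
    mul_nonneg (sub_pos.2 h').le (neg_nonneg.2 ht), mul_nonneg (sub_pos.2 h).le (neg_nonneg.2 ht')]

/-- Four lines in positive position, the first two of which do not meet the last, have two distinct
real common transversals. -/
theorem exists_two_isTransversal {w : Fin 8 → Fin 4 → ℝ} (h : PosSeq w)
    (h13 : 0 < br (w 0) (w 1) (w 4) (w 5)) (h14 : 0 < br (w 0) (w 1) (w 6) (w 7))
    (h24 : 0 < br (w 2) (w 3) (w 6) (w 7)) :
    ∃ s s₄ s' s₄', s < s' ∧ IsTransversal w s s₄ ∧ IsTransversal w s' s₄' := by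
  set F := fun (s : ℝ) (i j k : Fin 8) => pencil (w 0) (w 1) s (w i) (w j) (w k) with hF
  set q : ℝ → ℝ := fun s => F s 2 4 5 * F s 3 6 7 - F s 3 4 5 * F s 2 6 7 with hq
  have ql : ∀ s, q s = F s 2 3 5 * F s 4 6 7 - F s 2 3 4 * F s 5 6 7 := fun s => by
    simp only [hq, hF, pencil_eq]; exact br_concurrent_eq_left ..
  have qr : ∀ s, q s = F s 2 3 6 * F s 4 5 7 - F s 2 3 7 * F s 4 5 6 := fun s => by
    simp only [hq, hF, pencil_eq]; exact br_concurrent_eq_right ..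
  have h267 := h.lt 1 2 6 7
  have h467 := h.lt 1 4 6 7
  have h245 := h.lt 1 2 4 5
  -- the values of the quadratic polynomial `q` at three special parameters
  have q0 : 0 ≤ q (br (w 0) (w 4) (w 6) (w 7) / br (w 1) (w 4) (w 6) (w 7)) := by
    have e := pencil_div_eq_zero (w 0) (w 1) h467
    rw [ql]
    generalize br (w 0) (w 4) (w 6) (w 7) / br (w 1) (w 4) (w 6) (w 7) = s at *
    have f1 : F s 5 6 7 ≤ 0 := ratio_nonpos (br_step_first_first (w 0) (w 1) (w 6) (w 7) _ _)
      (mul_nonneg (h.le 0 1 6 7) (h.le 4 5 6 7)) h467 (h.lt 1 5 6 7) e.le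
    have f2 : 0 ≤ F s 3 4 6 := ratio_nonneg (br_step_first_last (w 0) (w 1) (w 4) (w 6) _ _)
      (mul_nonneg (h.le 0 1 4 6) (h.le 3 4 6 7)) (h.lt 1 3 4 6) h467 e.ge
    have f3 : 0 ≤ F s 2 3 4 := ratio_nonneg (br_step_first_last (w 0) (w 1) (w 3) (w 4) _ _)
      (mul_nonneg (h.le 0 1 3 4) (h.le 2 3 4 6)) (h.lt 1 2 3 4) (h.lt 1 3 4 6) f2
    have : F s 4 6 7 = 0 := e
    rw [this]
    nlinarith [mul_nonneg f3 (neg_nonneg.2 f1)]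
  have q1 : q (br (w 0) (w 2) (w 6) (w 7) / br (w 1) (w 2) (w 6) (w 7)) < 0 := by
    have e := pencil_div_eq_zero (w 0) (w 1) h267
    simp only [hq]
    generalize br (w 0) (w 2) (w 6) (w 7) / br (w 1) (w 2) (w 6) (w 7) = s at *
    have f1 : F s 3 6 7 < 0 := ratio_neg (br_step_first_first (w 0) (w 1) (w 6) (w 7) _ _)
      (mul_pos h14 h24) h267 (h.lt 1 3 6 7) e.le
    have f2 : 0 < F s 2 4 7 := ratio_pos (br_step_mid_mid (w 0) (w 1) (w 2) (w 7) _ _)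
      (mul_pos (h.lt 0 1 2 7) (h.lt 2 4 6 7)) (h.lt 1 2 4 7) h267 e.ge
    have f3 : 0 < F s 2 4 5 := ratio_pos (br_step_last_last (w 0) (w 1) (w 2) (w 4) _ _)
      (mul_pos (h.lt 0 1 2 4) (h.lt 2 4 5 7)) h245 (h.lt 1 2 4 7) f2.le
    have : F s 2 6 7 = 0 := e
    rw [this]
    nlinarith [mul_pos f3 (neg_pos.2 f1)]
  have q2 : q (br (w 0) (w 2) (w 4) (w 5) / br (w 1) (w 2) (w 4) (w 5)) ≤ 0 := by
    have e := pencil_div_eq_zero (w 0) (w 1) h245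
    simp only [hq]
    generalize br (w 0) (w 2) (w 4) (w 5) / br (w 1) (w 2) (w 4) (w 5) = s at *
    have f1 : F s 3 4 5 ≤ 0 := ratio_nonpos (br_step_first_first (w 0) (w 1) (w 4) (w 5) _ _)
      (mul_nonneg h13.le (h.le 2 3 4 5)) h245 (h.lt 1 3 4 5) e.le
    have f2 : F s 2 4 7 ≤ 0 := ratio_nonpos (br_step_last_last (w 0) (w 1) (w 2) (w 4) _ _)
      (mul_pos (h.lt 0 1 2 4) (h.lt 2 4 5 7)).le h245 (h.lt 1 2 4 7) e.le
    have f3 : F s 2 6 7 ≤ 0 := ratio_nonpos (br_step_mid_mid (w 0) (w 1) (w 2) (w 7) _ _)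
      (mul_pos (h.lt 0 1 2 7) (h.lt 2 4 6 7)).le (h.lt 1 2 4 7) h267 f2
    have : F s 2 4 5 = 0 := e
    rw [this]
    nlinarith [mul_nonneg (neg_nonneg.2 f1) (neg_nonneg.2 f3)]
  have le01 : br (w 0) (w 4) (w 6) (w 7) / br (w 1) (w 4) (w 6) (w 7) ≤
      br (w 0) (w 2) (w 6) (w 7) / br (w 1) (w 2) (w 6) (w 7) :=
    (pencil_nonpos_iff (w 0) (w 1) h467).1 (ratio_nonpos
      (br_step_first_first (w 0) (w 1) (w 6) (w 7) _ _) (mul_nonneg h14.le (h.le 2 4 6 7)) h267 h467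
      (pencil_div_eq_zero (w 0) (w 1) h267).le)
  have le12 : br (w 0) (w 2) (w 6) (w 7) / br (w 1) (w 2) (w 6) (w 7) ≤
      br (w 0) (w 2) (w 4) (w 5) / br (w 1) (w 2) (w 4) (w 5) := by
    have e := pencil_div_eq_zero (w 0) (w 1) h245
    refine (pencil_nonpos_iff (w 0) (w 1) h267).1 ?_
    have f2 := ratio_nonpos (br_step_last_last (w 0) (w 1) (w 2) (w 4) _ _)
      (mul_pos (h.lt 0 1 2 4) (h.lt 2 4 5 7)).le h245 (h.lt 1 2 4 7) e.le
    exact ratio_nonpos (br_step_mid_mid (w 0) (w 1) (w 2) (w 7) _ _)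
      (mul_pos (h.lt 0 1 2 7) (h.lt 2 4 6 7)).le (h.lt 1 2 4 7) h267 f2
  have hcont : Continuous q := by
    simp only [hq, hF, pencil]; fun_prop
  -- the smaller root, by the intermediate value theorem
  obtain ⟨s, ⟨hs0, hs1⟩, hs⟩ := intermediate_value_Icc' le01 hcont.continuousOn ⟨q1.le, q0⟩
  have hs1' : s < br (w 0) (w 2) (w 6) (w 7) / br (w 1) (w 2) (w 6) (w 7) :=
    lt_of_le_of_ne hs1 (by rintro rfl; exact q1.ne hs)
  -- the larger root, as the leading coefficient is positive
  have hlead := br_concurrent_pos (p := w 1) (h.lt 1 2 3 4) (h.lt 1 2 3 7) (h.lt 1 3 4 5)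
    (h.lt 1 3 4 6) (h.lt 1 3 4 7) (h.lt 1 3 6 7) (h.lt 1 4 5 6) (h.lt 1 4 6 7)
  obtain ⟨e₁, e₀, he⟩ : ∃ e₁ e₀, ∀ x, q x = (br (w 1) (w 2) (w 4) (w 5) * br (w 1) (w 3) (w 6) (w 7)
      - br (w 1) (w 3) (w 4) (w 5) * br (w 1) (w 2) (w 6) (w 7)) * x ^ 2 + e₁ * x + e₀ :=
    ⟨-(br (w 0) (w 2) (w 4) (w 5) * br (w 1) (w 3) (w 6) (w 7)
      + br (w 1) (w 2) (w 4) (w 5) * br (w 0) (w 3) (w 6) (w 7)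
      - br (w 0) (w 3) (w 4) (w 5) * br (w 1) (w 2) (w 6) (w 7)
      - br (w 1) (w 3) (w 4) (w 5) * br (w 0) (w 2) (w 6) (w 7)),
      br (w 0) (w 2) (w 4) (w 5) * br (w 0) (w 3) (w 6) (w 7)
      - br (w 0) (w 3) (w 4) (w 5) * br (w 0) (w 2) (w 6) (w 7),
      fun x => by simp only [hq, hF, pencil]; ring⟩
  rw [he] at q2
  obtain ⟨s', hs2, hs'⟩ := exists_root_ge hlead q2
  rw [← he] at hs'
  have f267 : 0 < F s 2 6 7 := (pencil_pos_iff (w 0) (w 1) h267).2 hs1'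
  have f237 : 0 < F s 2 3 7 := ratio_pos (br_step_mid_mid (w 0) (w 1) (w 2) (w 7) _ _)
    (mul_pos (h.lt 0 1 2 7) h24) (h.lt 1 2 3 7) h267 f267.le
  have g245 : F s' 2 4 5 ≤ 0 := (pencil_nonpos_iff (w 0) (w 1) h245).2 hs2
  have g456 : F s' 4 5 6 < 0 := ratio_neg (br_step_first_last (w 0) (w 1) (w 4) (w 5) _ _)
    (mul_pos h13 (h.lt 2 4 5 6)) h245 (h.lt 1 4 5 6) g245
  have g457 : F s' 4 5 7 < 0 := ratio_neg_of_neg (br_step_last_last (w 0) (w 1) (w 4) (w 5) _ _)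
    (mul_nonneg h13.le (h.le 4 5 6 7)) (h.lt 1 4 5 6) (h.lt 1 4 5 7) g456
  rw [qr] at hs hs'
  refine ⟨s, F s 2 3 6 / F s 2 3 7, s', F s' 4 5 6 / F s' 4 5 7,
    hs1'.trans_le (le12.trans hs2), ⟨?_, ?_, Or.inl ⟨(pencil_nonpos_iff _ _ h467).2 hs0, f267⟩⟩,
    ⟨?_, ?_, Or.inr g245⟩⟩
  · exact (div_mul_cancel₀ _ f237.ne').symm
  · change F s 4 5 6 = F s 2 3 6 / F s 2 3 7 * F s 4 5 7
    field_simp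
    linarith
  · change F s' 2 3 6 = F s' 4 5 6 / F s' 4 5 7 * F s' 2 3 7
    have := g457.ne
    field_simp
    linarith
  · exact (div_mul_cancel₀ _ g457.ne).symm

/-- The pairs of lines `w 0 w 1`, …, `w 6 w 7`, and a pair of points `w 8`, `w 9`, in positive
position: the points at which a common transversal of the four lines meets the first and the last
line are again in positive position with the other two points. -/
theorem IsTransversal.pos {w : Fin 10 → Fin 4 → ℝ} (h : PosSeq w)
    (h13 : 0 < br (w 0) (w 1) (w 4) (w 5)) (h14 : 0 < br (w 0) (w 1) (w 6) (w 7))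
    (h24 : 0 < br (w 2) (w 3) (w 6) (w 7)) {s s₄ : ℝ}
    (ht : IsTransversal (fun i => w (Fin.castLE (by norm_num) i)) s s₄) :
    pencil (w 0) (w 1) s (w 6) (w 8) (w 9) < 0 ∧ pencil (w 0) (w 1) s (w 7) (w 8) (w 9) < 0 ∧
      0 < br (s • w 1 - w 0) (w 6 - s₄ • w 7) (w 8) (w 9) := by
  set F := fun (i j k : Fin 10) => pencil (w 0) (w 1) s (w i) (w j) (w k) with hF
  have m2 : F 2 3 6 = s₄ * F 2 3 7 := ht.meets₂
  have m3 : F 4 5 6 = s₄ * F 4 5 7 := ht.meets₃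
  have hor : (F 4 6 7 ≤ 0 ∧ 0 < F 2 6 7) ∨ F 2 4 5 ≤ 0 := ht.location
  have hor' : (F 4 6 7 ≤ 0 ∧ 0 < F 2 6 7) ∨ (F 4 6 7 < 0 ∧ F 4 5 6 < 0 ∧ F 4 5 7 < 0) := by
    refine hor.imp_right fun g245 => ?_
    have g456 : F 4 5 6 < 0 := ratio_neg (br_step_first_last (w 0) (w 1) (w 4) (w 5) _ _)
      (mul_pos h13 (h.lt 2 4 5 6)) (h.lt 1 2 4 5) (h.lt 1 4 5 6) g245
    have g457 : F 4 5 7 < 0 := ratio_neg_of_neg (br_step_last_last (w 0) (w 1) (w 4) (w 5) _ _)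
      (mul_nonneg h13.le (h.le 4 5 6 7)) (h.lt 1 4 5 6) (h.lt 1 4 5 7) g456
    refine ⟨?_, g456, g457⟩
    exact ratio_neg_of_neg (br_step_mid_mid (w 0) (w 1) (w 4) (w 7) _ _)
      (mul_nonneg (h.le 0 1 4 7) (h.le 4 5 6 7)) (h.lt 1 4 5 7) (h.lt 1 4 6 7) g457
  have f467 : F 4 6 7 ≤ 0 := hor'.elim (·.1) (·.1.le)
  have f678 : F 6 7 8 < 0 := ratio_neg (br_step_first_last (w 0) (w 1) (w 6) (w 7) _ _)
    (mul_pos h14 (h.lt 4 6 7 8)) (h.lt 1 4 6 7) (h.lt 1 6 7 8) f467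
  have f679 : F 6 7 9 < 0 := ratio_neg (br_step_first_last (w 0) (w 1) (w 6) (w 7) _ _)
    (mul_pos h14 (h.lt 4 6 7 9)) (h.lt 1 4 6 7) (h.lt 1 6 7 9) f467
  have f689 : F 6 8 9 < 0 := ratio_neg_of_neg (br_step_mid_last (w 0) (w 1) (w 6) (w 8) _ _)
    (mul_nonneg (h.le 0 1 6 8) (h.le 6 7 8 9)) (h.lt 1 6 7 8) (h.lt 1 6 8 9) f678
  have f789 : F 7 8 9 < 0 := ratio_neg_of_neg (br_step_first_first (w 0) (w 1) (w 8) (w 9) _ _)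
    (mul_nonneg (h.le 0 1 8 9) (h.le 6 7 8 9)) (h.lt 1 6 8 9) (h.lt 1 7 8 9) f689
  refine ⟨f689, f789, ?_⟩
  have hb : br (s • w 1 - w 0) (w 6 - s₄ • w 7) (w 8) (w 9) = s₄ * F 7 8 9 - F 6 8 9 := by
    simp only [hF, pencil, br_eq, Pi.sub_apply, Pi.smul_apply, smul_eq_mul]; ring
  rw [hb]
  rcases hor' with ⟨-, f267⟩ | ⟨f467, f456, f457⟩
  · -- the smaller root: a convexity argument
    have f237 : 0 < F 2 3 7 := ratio_pos (br_step_mid_mid (w 0) (w 1) (w 2) (w 7) _ _)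
      (mul_pos (h.lt 0 1 2 7) h24) (h.lt 1 2 3 7) (h.lt 1 2 6 7) f267.le
    set G := fun (x : ℝ) (i j k : Fin 10) => pencil (w 0) (w 1) x (w i) (w j) (w k) with hG
    set E : ℝ → ℝ := fun x => G x 2 3 7 * G x 6 8 9 - G x 2 3 6 * G x 7 8 9 with hE
    have Eo : ∀ x, E x = G x 2 6 7 * G x 3 8 9 - G x 3 6 7 * G x 2 8 9 := fun x => by
      simp only [hE, hG, pencil_eq]; exact (br_concurrent_eq_left ..).symm
    have Er : ∀ x, E x = G x 2 3 8 * G x 6 7 9 - G x 2 3 9 * G x 6 7 8 := fun x => by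
      rw [Eo]; simp only [hG, pencil_eq]; exact br_concurrent_eq_right ..
    have hlead := br_concurrent_pos (p := w 1) (h.lt 1 2 3 6) (h.lt 1 2 3 9) (h.lt 1 3 6 7)
      (h.lt 1 3 6 8) (h.lt 1 3 6 9) (h.lt 1 3 8 9) (h.lt 1 6 7 8) (h.lt 1 6 8 9)
    obtain ⟨e₁, e₀, he⟩ : ∃ e₁ e₀, ∀ x, E x =
        (br (w 1) (w 2) (w 6) (w 7) * br (w 1) (w 3) (w 8) (w 9)
        - br (w 1) (w 3) (w 6) (w 7) * br (w 1) (w 2) (w 8) (w 9)) * x ^ 2 + e₁ * x + e₀ :=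
      ⟨-(br (w 0) (w 2) (w 6) (w 7) * br (w 1) (w 3) (w 8) (w 9)
        + br (w 1) (w 2) (w 6) (w 7) * br (w 0) (w 3) (w 8) (w 9)
        - br (w 0) (w 3) (w 6) (w 7) * br (w 1) (w 2) (w 8) (w 9)
        - br (w 1) (w 3) (w 6) (w 7) * br (w 0) (w 2) (w 8) (w 9)),
        br (w 0) (w 2) (w 6) (w 7) * br (w 0) (w 3) (w 8) (w 9)
        - br (w 0) (w 3) (w 6) (w 7) * br (w 0) (w 2) (w 8) (w 9),
        fun x => by rw [Eo]; simp only [hG, pencil]; ring⟩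
    have E1 : E (br (w 0) (w 6) (w 7) (w 8) / br (w 1) (w 6) (w 7) (w 8)) ≤ 0 := by
      have e := pencil_div_eq_zero (w 0) (w 1) (h.lt 1 6 7 8)
      rw [Er]
      generalize br (w 0) (w 6) (w 7) (w 8) / br (w 1) (w 6) (w 7) (w 8) = x at *
      have g1 : G x 6 7 9 ≤ 0 := ratio_nonpos (br_step_last_last (w 0) (w 1) (w 6) (w 7) _ _)
        (mul_nonneg h14.le (h.le 6 7 8 9)) (h.lt 1 6 7 8) (h.lt 1 6 7 9) e.le
      have g2 : 0 ≤ G x 3 7 8 := ratio_nonneg (br_step_first_first (w 0) (w 1) (w 7) (w 8) _ _)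
        (mul_pos (h.lt 0 1 7 8) (h.lt 3 6 7 8)).le (h.lt 1 3 7 8) (h.lt 1 6 7 8) (by
          rw [show br (w 0) (w 6) (w 7) (w 8) - x * br (w 1) (w 6) (w 7) (w 8) = 0 from e])
      have g3 : 0 ≤ G x 2 3 8 := ratio_nonneg (br_step_first_mid (w 0) (w 1) (w 3) (w 8) _ _)
        (mul_pos (h.lt 0 1 3 8) (h.lt 2 3 7 8)).le (h.lt 1 2 3 8) (h.lt 1 3 7 8) g2
      have : G x 6 7 8 = 0 := e
      rw [this]
      nlinarith [mul_nonneg g3 (neg_nonneg.2 g1)]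
    have E2 : E (br (w 0) (w 2) (w 6) (w 7) / br (w 1) (w 2) (w 6) (w 7)) ≤ 0 := by
      have e := pencil_div_eq_zero (w 0) (w 1) (h.lt 1 2 6 7)
      rw [Eo]
      generalize br (w 0) (w 2) (w 6) (w 7) / br (w 1) (w 2) (w 6) (w 7) = x at *
      have g1 : G x 3 6 7 ≤ 0 := ratio_nonpos (br_step_first_first (w 0) (w 1) (w 6) (w 7) _ _)
        (mul_pos h14 h24).le (h.lt 1 2 6 7) (h.lt 1 3 6 7) e.le
      have g2 : G x 2 7 9 ≤ 0 := ratio_nonpos (br_step_mid_last (w 0) (w 1) (w 2) (w 7) _ _)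
        (mul_pos (h.lt 0 1 2 7) (h.lt 2 6 7 9)).le (h.lt 1 2 6 7) (h.lt 1 2 7 9) e.le
      have g3 : G x 2 8 9 ≤ 0 := ratio_nonpos (br_step_mid_mid (w 0) (w 1) (w 2) (w 9) _ _)
        (mul_pos (h.lt 0 1 2 9) (h.lt 2 7 8 9)).le (h.lt 1 2 7 9) (h.lt 1 2 8 9) g2
      have : G x 2 6 7 = 0 := e
      rw [this]
      nlinarith [mul_nonneg (neg_nonneg.2 g1) (neg_nonneg.2 g3)]
    rw [he] at E1 E2
    have hEs := quadratic_neg_of_between hlead E1 E2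
      ((pencil_neg_iff _ _ (h.lt 1 6 7 8)).1 f678) ((pencil_pos_iff _ _ (h.lt 1 2 6 7)).1 f267)
    rw [← he] at hEs
    have hEs' : F 2 3 7 * F 6 8 9 - F 2 3 6 * F 7 8 9 < 0 := hEs
    rw [m2] at hEs'
    refine (pos_iff_pos_of_mul_pos ?_).1 f237
    linarith
  · -- the larger root: the sign of the concurrency condition seen from the point on the first line
    have f459 : F 4 5 9 < 0 := ratio_neg (br_step_last_last (w 0) (w 1) (w 4) (w 5) _ _)
      (mul_pos h13 (h.lt 4 5 6 9)) (h.lt 1 4 5 6) (h.lt 1 4 5 9) f456.le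
    have f567 : F 5 6 7 < 0 := ratio_neg_of_neg (br_step_first_first (w 0) (w 1) (w 6) (w 7) _ _)
      (mul_nonneg h14.le (h.le 4 5 6 7)) (h.lt 1 4 6 7) (h.lt 1 5 6 7) f467
    have f568 : F 5 6 8 < 0 := ratio_neg (br_step_last_last (w 0) (w 1) (w 5) (w 6) _ _)
      (mul_pos (h.lt 0 1 5 6) (h.lt 5 6 7 8)) (h.lt 1 5 6 7) (h.lt 1 5 6 8) f567.le
    have f569 : F 5 6 9 < 0 := ratio_neg (br_step_last_last (w 0) (w 1) (w 5) (w 6) _ _)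
      (mul_pos (h.lt 0 1 5 6) (h.lt 5 6 8 9)) (h.lt 1 5 6 8) (h.lt 1 5 6 9) f568.le
    have f589 : F 5 8 9 < 0 := ratio_neg (br_step_mid_mid (w 0) (w 1) (w 5) (w 9) _ _)
      (mul_pos (h.lt 0 1 5 9) (h.lt 5 6 8 9)) (h.lt 1 5 6 9) (h.lt 1 5 8 9) f569.le
    have hp : ∀ i j k, br (s • w 1 - w 0) (w i) (w j) (w k) = -F i j k := fun i j k => by
      simp only [hF, pencil, br_eq, Pi.sub_apply, Pi.smul_apply, smul_eq_mul]; ring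
    have key := br_concurrent_pos (p := s • w 1 - w 0) (x₁ := w 4) (x₂ := w 5) (x₃ := w 6)
      (x₄ := w 7) (x₅ := w 8) (x₆ := w 9) (by rw [hp]; linarith) (by rw [hp]; linarith)
      (by rw [hp]; linarith) (by rw [hp]; linarith) (by rw [hp]; linarith)
      (by rw [hp]; linarith) (by rw [hp]; linarith) (by rw [hp]; linarith)
    rw [br_concurrent_eq_left] at key
    simp only [hp] at key
    rw [m3] at key
    refine (pos_iff_pos_of_mul_pos ?_).1 (neg_pos.2 f457)
    linarith

/-- The points at which a transversal meets the first and the last line, in terms of the two points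
spanning the transversal, and two further points. -/
theorem br_relation_of_span (p a b y y' y'' : Fin 4 → ℝ) :
    br a y y' y'' * br p b y y' - br b y y' y'' * br p a y y' = br p y y' y'' * br a b y y' := by
  simp only [br_eq]; ring

/-- Two transversals that meet the first line in different points are not proportional, unless the
first and the last line meet. -/
theorem br_sub_smul_sub_smul (a b c d : Fin 4 → ℝ) (s s' t : ℝ) :
    br (s • b - a) (c - t • d) (s' • b - a) d = (s' - s) * br a b c d := by
  simp only [br_eq, Pi.sub_apply, Pi.smul_apply, smul_eq_mul]; ring

/-! ### Lines in positive position -/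

/-- The points of a list of lines, each given by two points: the points of the `i`-th line have
the numbers `2 i` and `2 i + 1`. -/
def pt (l : List ((Fin 4 → ℝ) × (Fin 4 → ℝ))) (i : ℕ) : Fin 4 → ℝ :=
  if i % 2 = 0 then (l.getD (i / 2) 0).1 else (l.getD (i / 2) 0).2

section Pt

variable (x : (Fin 4 → ℝ) × (Fin 4 → ℝ)) (l l' : List ((Fin 4 → ℝ) × (Fin 4 → ℝ))) (i : ℕ)

theorem pt_cons_add_two : pt (x :: l) (i + 2) = pt l i := by
  simp [pt, Nat.add_mod_right]

theorem pt_append_left {i : ℕ} (h : i < 2 * l.length) : pt (l ++ l') i = pt l i := by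
  unfold pt
  rw [List.getD_append _ _ _ _ (by omega)]

theorem pt_append_right : pt (l ++ l') (2 * l.length + i) = pt l' i := by
  unfold pt
  rw [List.getD_append_right _ _ _ _ (by omega), Nat.mul_add_mod,
    show (2 * l.length + i) / 2 - l.length = i / 2 by omega]

theorem pt_map_neg : pt (l.map (-·)) i = -pt l i := by
  have : (l.map (-·)).getD (i / 2) 0 = -l.getD (i / 2) 0 := by
    rw [List.getD_eq_getElem?_getD, List.getD_eq_getElem?_getD, List.getElem?_map]
    cases l[i / 2]? <;> simp
  unfold pt
  rw [this]
  split_ifs <;> rfl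

end Pt

/-- The points with the numbers `i < j < k < m` are those of two lines that are cyclically adjacent
among `n` lines. -/
def AdjacentLines (n i j k m : ℕ) : Prop :=
  i % 2 = 0 ∧ j = i + 1 ∧ k % 2 = 0 ∧ m = k + 1 ∧ (k = i + 2 ∨ (i = 0 ∧ m + 1 = 2 * n))

/-- The lines of a list, each given by two points, are in positive position: all brackets of their
points in increasing order are positive, except that cyclically adjacent lines may meet. -/
def PositivePosition (l : List ((Fin 4 → ℝ) × (Fin 4 → ℝ))) : Prop :=
  ∀ i j k m, i < j → j < k → k < m → m < 2 * l.length →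
    0 ≤ br (pt l i) (pt l j) (pt l k) (pt l m) ∧
      (¬AdjacentLines l.length i j k m → 0 < br (pt l i) (pt l j) (pt l k) (pt l m))

namespace PositivePosition

variable {l l' : List ((Fin 4 → ℝ) × (Fin 4 → ℝ))} {x : (Fin 4 → ℝ) × (Fin 4 → ℝ)}

theorem map_neg (h : PositivePosition l) : PositivePosition (l.map (-·)) := by
  have hbr : ∀ u v w x : Fin 4 → ℝ, br (-u) (-v) (-w) (-x) = br u v w x := by
    intro u v w x; simp only [br_eq, Pi.neg_apply]; ring
  intro i j k m
  simp only [pt_map_neg, hbr, List.length_map]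
  exact h i j k m

/-- Positive position is cyclically symmetric if the line that is moved to the end is negated, as a
cyclic permutation of the four entries changes the sign of a bracket. -/
theorem rotate_one (h : PositivePosition (x :: l)) : PositivePosition (l ++ [-x]) := by
  have h1 : ∀ u v w x : Fin 4 → ℝ, br u v w (-x) = br x u v w := by
    intro u v w x; simp only [br_eq, Pi.neg_apply]; ring
  have h2 : ∀ u v w x : Fin 4 → ℝ, br u v (-w) (-x) = br w x u v := by
    intro u v w x; simp only [br_eq, Pi.neg_apply]; ring
  have hl : ∀ i, i < 2 * l.length → pt (l ++ [-x]) i = pt (x :: l) (i + 2) := fun i hi => by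
    rw [pt_append_left _ _ hi, pt_cons_add_two]
  have hr : ∀ i, i < 2 → pt (l ++ [-x]) (2 * l.length + i) = -pt (x :: l) i := fun i hi => by
    rw [pt_append_right]
    interval_cases i <;> rfl
  intro i j k m hij hjk hkm hm
  simp only [List.length_append, List.length_cons, List.length_nil] at hm
  rcases lt_or_ge m (2 * l.length) with hm' | hm'
  · rw [hl i (by omega), hl j (by omega), hl k (by omega), hl m hm']
    refine (h (i + 2) (j + 2) (k + 2) (m + 2) (by omega) (by omega) (by omega)
      (by simp; omega)).imp_right fun h' hn => h' fun hn' => hn ?_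
    simp only [AdjacentLines, List.length_append, List.length_cons, List.length_nil] at *
    omega
  obtain ⟨m, rfl⟩ := Nat.exists_eq_add_of_le hm'
  rcases lt_or_ge k (2 * l.length) with hk' | hk'
  · rw [hl i (by omega), hl j (by omega), hl k (by omega), hr m (by omega), h1]
    refine (h m (i + 2) (j + 2) (k + 2) (by omega) (by omega) (by omega)
      (by simp; omega)).imp_right fun h' hn => h' fun hn' => hn ?_
    simp only [AdjacentLines, List.length_append, List.length_cons, List.length_nil] at *
    omega
  obtain ⟨k, rfl⟩ := Nat.exists_eq_add_of_le hk'
  obtain ⟨rfl, rfl⟩ : k = 0 ∧ m = 1 := by omega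
  rw [hl i (by omega), hl j (by omega), hr 0 (by omega), hr 1 (by omega), h2]
  refine (h 0 1 (i + 2) (j + 2) (by omega) (by omega) (by omega)
    (by simp; omega)).imp_right fun h' hn => h' fun hn' => hn ?_
  simp only [AdjacentLines, List.length_append, List.length_cons, List.length_nil, true_and] at *
  omega

theorem rotate (h : PositivePosition (l ++ l')) : PositivePosition (l' ++ l.map (-·)) := by
  induction l generalizing l' with
  | nil => simpa using h
  | cons x l ih =>
    have := ih (l' := l' ++ [-x]) (by rw [← List.append_assoc]; exact h.rotate_one)
    simpa using this

theorem rotate' (h : PositivePosition (l ++ l')) : PositivePosition (l'.map (-·) ++ l) := by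
  simpa [Function.comp_def] using h.rotate.map_neg

variable {x₁ x₂ x₃ x₄ : (Fin 4 → ℝ) × (Fin 4 → ℝ)}

theorem posSeq {n : ℕ} (h : PositivePosition l) (hn : n ≤ 2 * l.length) :
    PosSeq fun i : Fin n => pt l i := by
  refine ⟨fun i j k m hi hj hk => (h i j k m hi hj hk (by omega)).1, fun i j k m hi hj hk hne =>
    (h i j k m hi hj hk (by omega)).2 fun hne' => hne ?_⟩
  exact ⟨⟨hne'.1, hne'.2.1⟩, hne'.2.2.1, hne'.2.2.2.1⟩

/-- A common transversal of the first four lines takes their place. -/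
theorem isTransversal_cons (h : PositivePosition (x₁ :: x₂ :: x₃ :: x₄ :: l)) (hl : l ≠ [])
    {s s₄ : ℝ} (ht : IsTransversal (fun i => pt (x₁ :: x₂ :: x₃ :: x₄ :: l) i) s s₄) :
    PositivePosition ((s • x₁.2 - x₁.1, x₄.1 - s₄ • x₄.2) :: l) := by
  set W := pt (x₁ :: x₂ :: x₃ :: x₄ :: l) with hW
  have hlen : 0 < l.length := List.length_pos_of_ne_nil hl
  have hsh : ∀ e : (Fin 4 → ℝ) × (Fin 4 → ℝ), ∀ i, pt (e :: l) (i + 2) = W (i + 8) := by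
    intro e i
    rw [pt_cons_add_two, hW, show i + 8 = i + 2 + 2 + 2 + 2 by ring]
    simp only [pt_cons_add_two]
  have hpos : ∀ i j k m, i < j → j < k → k < m → m < 2 * l.length + 8 →
      ¬AdjacentLines (l.length + 4) i j k m → 0 < br (W i) (W j) (W k) (W m) :=
    fun i j k m hi hj hk hm => (h i j k m hi hj hk (by simp; omega)).2
  have hnn : ∀ i j k m, i < j → j < k → k < m → m < 2 * l.length + 8 →
      0 ≤ br (W i) (W j) (W k) (W m) :=
    fun i j k m hi hj hk hm => (h i j k m hi hj hk (by simp; omega)).1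
  -- the transversal and any two points that come after the four lines
  have key : ∀ y y', 8 ≤ y → y < y' → y' < 2 * l.length + 8 →
      pencil (W 0) (W 1) s (W 6) (W y) (W y') < 0 ∧
      pencil (W 0) (W 1) s (W 7) (W y) (W y') < 0 ∧
      0 < br (s • W 1 - W 0) (W 6 - s₄ • W 7) (W y) (W y') := by
    intro y y' hy hyy hy'
    let f : Fin 10 → ℕ := fun i => if i.val < 8 then i.val else if i.val = 8 then y else y'
    have hf : ∀ i j : Fin 10, i < j → f i < f j := by
      intro i j hij
      have := Fin.lt_def.1 hij
      simp only [f]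
      split_ifs <;> omega
    have hfb : ∀ i, f i < 2 * l.length + 8 := by
      intro i
      simp only [f]
      split_ifs <;> omega
    have hpair : ∀ i j : Fin 10, f i % 2 = 0 → f j = f i + 1 → i.val % 2 = 0 ∧ j.val = i.val + 1 := by
      intro i j
      simp only [f]
      split_ifs <;> omega
    have hseq : PosSeq fun i => W (f i) := by
      refine ⟨fun i j k m hi hj hk => hnn _ _ _ _ (hf _ _ hi) (hf _ _ hj) (hf _ _ hk) (hfb _),
        fun i j k m hi hj hk hne => hpos _ _ _ _ (hf _ _ hi) (hf _ _ hj) (hf _ _ hk) (hfb _)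
          fun hne' => hne ⟨hpair _ _ hne'.1 hne'.2.1, hpair _ _ hne'.2.2.1 hne'.2.2.2.1⟩⟩
    refine IsTransversal.pos hseq ?_ ?_ ?_ (s := s) (s₄ := s₄) ?_
    · exact hpos 0 1 4 5 (by omega) (by omega) (by omega) (by omega) (by simp [AdjacentLines]; omega)
    · exact hpos 0 1 6 7 (by omega) (by omega) (by omega) (by omega) (by simp [AdjacentLines]; omega)
    · exact hpos 2 3 6 7 (by omega) (by omega) (by omega) (by omega) (by simp [AdjacentLines])
    · convert ht using 2 with i
      simp [f]
  set p := s • W 1 - W 0 with hp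
  set q := W 6 - s₄ • W 7 with hq
  have hpF : ∀ u v w : Fin 4 → ℝ, br p u v w = -pencil (W 0) (W 1) s u v w := by
    intro u v w
    simp only [hp, pencil, br_eq, Pi.sub_apply, Pi.smul_apply, smul_eq_mul]; ring
  have p_pos : ∀ y y' y'', 8 ≤ y → y < y' → y' < y'' → y'' < 2 * l.length + 8 →
      0 < br p (W y) (W y') (W y'') := by
    intro y y' y'' hy hyy hyy' hy''
    rw [hpF, neg_pos]
    refine ratio_neg_of_neg (br_step_first_last (W 0) (W 1) (W y) (W y') _ _)
      (mul_nonneg (hnn 0 1 y y' ?_ ?_ ?_ ?_) (hnn 7 y y' y'' ?_ ?_ ?_ ?_))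
      (hpos 1 7 y y' ?_ ?_ ?_ ?_ ?_) (hpos 1 y y' y'' ?_ ?_ ?_ ?_ ?_)
      (key y y' hy hyy (by omega)).2.1 <;> first | omega | (simp only [AdjacentLines]; omega)
  have q_pos : ∀ y y' y'', 8 ≤ y → y < y' → y' < y'' → y'' < 2 * l.length + 8 →
      0 < br q (W y) (W y') (W y'') := by
    intro y y' y'' hy hyy hyy' hy''
    obtain ⟨k1, k2, k3⟩ := key y y' hy hyy (by omega)
    have r := br_relation_of_span p (W 6) (W 7) (W y) (W y') (W y'')
    have r1 := mul_nonneg (p_pos y y' y'' hy hyy hyy' hy'').le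
      (hnn 6 7 y y' (by omega) (by omega) (by omega) (by omega))
    have r2 := hpos 7 y y' y'' (by omega) (by omega) (by omega) (by omega)
      (by simp only [AdjacentLines]; omega)
    have e1 : br q (W y) (W y') (W y'') = br (W 6) (W y) (W y') (W y'')
        - s₄ * br (W 7) (W y) (W y') (W y'') := by
      simp only [hq, br_eq, Pi.sub_apply, Pi.smul_apply, smul_eq_mul]; ring
    have e2 : br p q (W y) (W y') = br p (W 6) (W y) (W y') - s₄ * br p (W 7) (W y) (W y') := by
      simp only [hq, br_eq, Pi.sub_apply, Pi.smul_apply, smul_eq_mul]; ring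
    have k2' : 0 < br p (W 7) (W y) (W y') := by rw [hpF]; linarith
    rw [e2] at k3
    rw [e1]
    refine (pos_iff_pos_of_mul_pos ?_).1 k2'
    nlinarith [mul_pos r2 k3]
  intro i j k m hij hjk hkm hm
  simp only [List.length_cons] at hm
  change _ ∧ (¬AdjacentLines (l.length + 1) i j k m → _)
  obtain ⟨k, rfl⟩ : ∃ k', k = k' + 2 := ⟨k - 2, by omega⟩
  obtain ⟨m, rfl⟩ : ∃ m', m = m' + 2 := ⟨m - 2, by omega⟩
  simp only [hsh _ k, hsh _ m]
  rcases Nat.lt_or_ge j 2 with hj | hj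
  · obtain ⟨rfl, rfl⟩ : i = 0 ∧ j = 1 := by omega
    have := (key (k + 8) (m + 8) (by omega) (by omega) (by omega)).2.2
    exact ⟨this.le, fun _ => this⟩
  obtain ⟨j, rfl⟩ : ∃ j', j = j' + 2 := ⟨j - 2, by omega⟩
  simp only [hsh _ j]
  rcases Nat.lt_or_ge i 2 with hi | hi
  · interval_cases i
    · have := p_pos (j + 8) (k + 8) (m + 8) (by omega) (by omega) (by omega) (by omega)
      exact ⟨this.le, fun _ => this⟩
    · have := q_pos (j + 8) (k + 8) (m + 8) (by omega) (by omega) (by omega) (by omega)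
      exact ⟨this.le, fun _ => this⟩
  obtain ⟨i, rfl⟩ : ∃ i', i = i' + 2 := ⟨i - 2, by omega⟩
  simp only [hsh _ i]
  refine ⟨hnn _ _ _ _ (by omega) (by omega) (by omega) (by omega), fun hn =>
    hpos _ _ _ _ (by omega) (by omega) (by omega) (by omega) fun hn' => hn ?_⟩
  simp only [AdjacentLines] at *
  omega

end PositivePosition

/-! ### Complex lines and their transversals -/

section Pairing

variable {R : Type*} [CommRing R]

theorem pairing_comm (A X : Fin 6 → R) : pairing A X = pairing X A := by
  simp only [pairing]; ring

theorem pairing_add (A X Y : Fin 6 → R) : pairing A (X + Y) = pairing A X + pairing A Y := by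
  simp only [pairing, Pi.add_apply]; ring

theorem pairing_smul (c : R) (A X : Fin 6 → R) : pairing A (c • X) = c * pairing A X := by
  simp only [pairing, Pi.smul_apply, smul_eq_mul]; ring

theorem smul_pairing (c : R) (A X : Fin 6 → R) : pairing (c • A) X = c * pairing A X := by
  simp only [pairing, Pi.smul_apply, smul_eq_mul]; ring

theorem pairing_plucker_self (v w : Fin 4 → R) : pairing (plucker v w) (plucker v w) = 0 := by
  simp [pairing, plucker]; ring

/-- The Gram determinant of the Plücker form on four lines. -/
def gram (X : Fin 4 → Fin 6 → R) : R :=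
  (pairing (X 0) (X 2) * pairing (X 1) (X 3) + pairing (X 0) (X 3) * pairing (X 1) (X 2)
    - pairing (X 0) (X 1) * pairing (X 2) (X 3)) ^ 2
    - 4 * (pairing (X 0) (X 2) * pairing (X 1) (X 2))
      * (pairing (X 0) (X 3) * pairing (X 1) (X 3))

theorem det_pairing_eq_gram {X : Fin 4 → Fin 6 → R} (h : ∀ i, pairing (X i) (X i) = 0) :
    (Matrix.of fun i j => pairing (X i) (X j)).det = gram X := by
  have c := fun i j => pairing_comm (X i) (X j)
  simp [Matrix.det_succ_row_zero, Fin.sum_univ_succ, Fin.succAbove, h, gram, c 1 0, c 2 0, c 3 0,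
    c 2 1, c 3 1, c 3 2]
  ring

end Pairing

section Field

variable {K : Type*} [Field K]

/-- The points of the quadric `⟨X X⟩ = 0` are the Plücker vectors of lines. -/
theorem exists_eq_plucker {X : Fin 6 → K} (h : pairing X X = 0) (h2 : (2 : K) ≠ 0) :
    ∃ v w, X = plucker v w := by
  have h' : X 0 * X 5 - X 1 * X 4 + X 2 * X 3 = 0 := by
    have : 2 * (X 0 * X 5 - X 1 * X 4 + X 2 * X 3) = 0 := by
      rw [← h, pairing]; ring
    exact (mul_eq_zero.1 this).resolve_left h2
  by_cases h0 : X 0 = 0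
  · by_cases h1 : X 1 = 0
    · by_cases h2 : X 2 = 0
      · by_cases h3 : X 3 = 0
        · by_cases h4 : X 4 = 0
          · refine ⟨![0, 0, 1, 0], ![0, 0, 0, X 5], ?_⟩
            ext i; fin_cases i <;> simp [plucker, *]
          · refine ⟨![0, 1, X 5 / X 4, 0], ![0, 0, 0, X 4], ?_⟩
            ext i; fin_cases i <;> simp [plucker, *]
        · refine ⟨![0, 1, 0, -X 5 / X 3], ![0, 0, X 3, X 4], ?_⟩
          ext i; fin_cases i <;> simp [plucker, *]
      · have h3 : X 3 = 0 := by simpa [h0, h1, h2] using h'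
        refine ⟨![1, X 4 / X 2, X 5 / X 2, 0], ![0, 0, 0, X 2], ?_⟩
        ext i; fin_cases i <;> simp [plucker, *]
    · refine ⟨![1, X 3 / X 1, 0, -X 5 / X 1], ![0, 0, X 1, X 2], ?_⟩
      ext i; fin_cases i <;> simp [plucker, *]
      field_simp
      rw [h0] at h'
      linear_combination -h'
  · refine ⟨![1, 0, -X 3 / X 0, -X 4 / X 0], ![0, X 0, X 1, X 2], ?_⟩
    ext i; fin_cases i <;> simp [plucker] <;> field_simp
    linear_combination h'

/-- A line that meets the line `v w` is spanned by a point of `v w` and another point. -/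
theorem exists_eq_plucker_of_meets {v w : Fin 4 → K} {Y : Fin 6 → K} (hX : plucker v w ≠ 0)
    (hY0 : Y ≠ 0) (hY : pairing Y Y = 0) (h : pairing (plucker v w) Y = 0) (h2 : (2 : K) ≠ 0) :
    ∃ (s t : K) (c : Fin 4 → K), Y = plucker (s • v + t • w) c := by
  obtain ⟨v', w', rfl⟩ := exists_eq_plucker hY h2
  rw [pairing_plucker] at h
  obtain ⟨c, hc0, hc⟩ := Matrix.exists_vecMul_eq_zero_iff.2 h
  have hc' : c 0 • v + c 1 • w = -(c 2 • v' + c 3 • w') := by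
    ext i
    have := congrFun hc i
    simp [Matrix.vecMul, dotProduct, Fin.sum_univ_succ] at this
    simp
    linear_combination this
  have key : ∀ a b : Fin 4 → K, ∀ x y : K, plucker a b ≠ 0 → x • a + y • b = 0 → x = 0 ∧ y = 0 := by
    intro a b x y hab hxy
    have e1 : x • plucker a b = 0 := by
      have : plucker (x • a + y • b) b = x • plucker a b := by
        ext i; fin_cases i <;> simp [plucker] <;> ring
      rw [← this, hxy]; ext i; fin_cases i <;> simp [plucker]
    have e2 : y • plucker a b = 0 := by
      have : plucker a (x • a + y • b) = y • plucker a b := by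
        ext i; fin_cases i <;> simp [plucker] <;> ring
      rw [← this, hxy]; ext i; fin_cases i <;> simp [plucker]
    exact ⟨(smul_eq_zero.1 e1).resolve_right hab, (smul_eq_zero.1 e2).resolve_right hab⟩
  have hne : c 2 ≠ 0 ∨ c 3 ≠ 0 := by
    by_contra! hcon
    rw [hcon.1, hcon.2] at hc'
    have := key v w (c 0) (c 1) hX (by rw [hc']; simp)
    refine hc0 (funext fun i => ?_)
    fin_cases i
    exacts [this.1, this.2, hcon.1, hcon.2]
  rcases hne with h3 | h3
  · refine ⟨c 0, c 1, -(c 2)⁻¹ • w', ?_⟩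
    rw [hc']
    ext i; fin_cases i <;> simp [plucker] <;> field_simp <;> ring
  · refine ⟨c 0, c 1, (c 3)⁻¹ • v', ?_⟩
    rw [hc']
    ext i; fin_cases i <;> simp [plucker] <;> field_simp <;> ring

end Field

/-- Four lines with nonzero Gram determinant have exactly two common transversals. This holds for
arbitrary vectors in `ℂ⁶` in place of the Plücker vectors of the four lines. -/
theorem exists_two_transversals {X : Fin 4 → Fin 6 → ℂ}
    (hX : (Matrix.of fun i j => pairing (X i) (X j)).det ≠ 0) : ∃ u u' : Fin 6 → ℂ, pairing u u = 0 ∧ pairing u' u' = 0 ∧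
      pairing u u' ≠ 0 ∧ (∀ i, pairing (X i) u = 0) ∧ (∀ i, pairing (X i) u' = 0) ∧
      ∀ L, pairing L L = 0 → (∀ i, pairing (X i) L = 0) → ∃ c : ℂ, L = c • u ∨ L = c • u' := by
  let B : (Fin 6 → ℂ) →ₗ[ℂ] (Fin 6 → ℂ) →ₗ[ℂ] ℂ := LinearMap.mk₂ ℂ pairing
    (fun a b c => by rw [pairing_comm, pairing_add, pairing_comm c, pairing_comm c])
    (fun c a b => smul_pairing c a b) pairing_add (fun c a b => pairing_smul c a b)
  have hB : ∀ a b, B a b = pairing a b := fun _ _ => rfl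
  let M : Matrix (Fin 4) (Fin 4) ℂ := Matrix.of fun i j => pairing (X i) (X j)
  have hM : IsUnit M.det := isUnit_iff_ne_zero.2 hX
  let T : (Fin 6 → ℂ) →ₗ[ℂ] (Fin 4 → ℂ) := LinearMap.pi fun i => B (X i)
  have hcomb : ∀ c : Fin 4 → ℂ, T (∑ j, c j • X j) = M.mulVec c := by
    intro c
    ext i
    change B (X i) (∑ j, c j • X j) = _
    rw [map_sum]
    simp [Matrix.mulVec, dotProduct, M, hB, pairing_smul, mul_comm]
  have hdecomp : ∀ L, ∃ c : Fin 4 → ℂ, L - ∑ j, c j • X j ∈ LinearMap.ker T := by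
    intro L
    refine ⟨M⁻¹.mulVec (T L), ?_⟩
    rw [LinearMap.mem_ker, map_sub, hcomb, Matrix.mulVec_mulVec, Matrix.mul_nonsing_inv _ hM,
      Matrix.one_mulVec, sub_self]
  have hsurj : Function.Surjective T := fun y => ⟨∑ j, (M⁻¹.mulVec y) j • X j, by
    rw [hcomb, Matrix.mulVec_mulVec, Matrix.mul_nonsing_inv _ hM, Matrix.one_mulVec]⟩
  have hrank : Module.finrank ℂ (LinearMap.ker T) = 2 := by
    have := LinearMap.finrank_range_add_finrank_ker T
    rw [LinearMap.range_eq_top.2 hsurj, finrank_top] at this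
    simp at this
    omega
  have hker : ∀ L, L ∈ LinearMap.ker T ↔ ∀ i, pairing (X i) L = 0 := by
    intro L
    rw [LinearMap.mem_ker]
    exact ⟨fun h i => congrFun h i, fun h => funext h⟩
  let b := Module.finBasisOfFinrankEq ℂ (LinearMap.ker T) hrank
  have hbspan : ∀ L ∈ LinearMap.ker T, ∃ x y : ℂ, L = x • (b 0 : Fin 6 → ℂ) + y • (b 1 : Fin 6 → ℂ) := by
    intro L hL
    have := congrArg Subtype.val (b.sum_repr ⟨L, hL⟩)
    rw [Fin.sum_univ_two] at this
    exact ⟨_, _, this.symm⟩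
  have hnd : ∀ L ∈ LinearMap.ker T, pairing L (b 0) = 0 → pairing L (b 1) = 0 → L = 0 := by
    intro L hL h0 h1
    have hall : ∀ Y, pairing L Y = 0 := by
      intro Y
      obtain ⟨c, hc⟩ := hdecomp Y
      obtain ⟨x, y, hxy⟩ := hbspan _ hc
      rw [sub_eq_iff_eq_add] at hxy
      have e : B L (∑ j, c j • X j) = 0 := by
        simp only [map_sum, map_smul]
        refine Finset.sum_eq_zero fun j _ => ?_
        rw [hB, pairing_comm, (hker L).1 hL j, smul_zero]
      rw [hxy, pairing_add, pairing_add, pairing_smul, pairing_smul, h0, h1, ← hB, e]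
      simp
    have h' := fun i => hall (Pi.single i 1)
    ext i
    have e0 := h' 0; have e1 := h' 1; have e2 := h' 2; have e3 := h' 3; have e4 := h' 4
    have e5 := h' 5
    simp [pairing] at e0 e1 e2 e3 e4 e5
    fin_cases i <;> simp [*]
  obtain ⟨e₁, he₁⟩ : ∃ e, e = (b 0 : Fin 6 → ℂ) := ⟨_, rfl⟩
  obtain ⟨e₂, he₂⟩ : ∃ e, e = (b 1 : Fin 6 → ℂ) := ⟨_, rfl⟩
  have hk₁ : e₁ ∈ LinearMap.ker T := he₁ ▸ (b 0).2
  have hk₂ : e₂ ∈ LinearMap.ker T := he₂ ▸ (b 1).2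
  have hind : ∀ x y : ℂ, x • e₁ + y • e₂ = 0 → x = 0 ∧ y = 0 := by
    intro x y hxy
    have : x • b 0 + y • b 1 = 0 := Subtype.ext (by
      rw [he₁, he₂] at hxy; exact hxy)
    have := Fintype.linearIndependent_iff.1 b.linearIndependent ![x, y] (by
      rw [Fin.sum_univ_two]; exact this)
    exact ⟨this 0, this 1⟩
  rw [← he₁, ← he₂] at hbspan hnd
  obtain ⟨α, hα⟩ : ∃ α, α = pairing e₁ e₁ := ⟨_, rfl⟩
  obtain ⟨β, hβ⟩ : ∃ β, β = pairing e₁ e₂ := ⟨_, rfl⟩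
  obtain ⟨γ, hγ⟩ : ∃ γ, γ = pairing e₂ e₂ := ⟨_, rfl⟩
  have hpair : ∀ x y x' y' : ℂ, pairing (x • e₁ + y • e₂) (x' • e₁ + y' • e₂) =
      α * x * x' + β * (x * y' + x' * y) + γ * y * y' := by
    intro x y x' y'
    rw [hα, hβ, hγ]
    simp only [pairing, Pi.add_apply, Pi.smul_apply, smul_eq_mul]; ring
  have hdisc : β ^ 2 - α * γ ≠ 0 := by
    intro hz
    have hp0 : ∀ x y, pairing (x • e₁ + y • e₂) e₁ = α * x + β * y := fun x y => by
      have := hpair x y 1 0; simp at this; rw [this]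
    have hp1 : ∀ x y, pairing (x • e₁ + y • e₂) e₂ = β * x + γ * y := fun x y => by
      have := hpair x y 0 1; simp at this; rw [this]
    have hz' : ∀ x y : ℂ, α * x + β * y = 0 → β * x + γ * y = 0 → x = 0 ∧ y = 0 := by
      intro x y h1 h2
      refine hind x y (hnd _ (add_mem (Submodule.smul_mem _ _ hk₁) (Submodule.smul_mem _ _ hk₂)) ?_ ?_)
      · rw [hp0, h1]
      · rw [hp1, h2]
    have a1 := hz' (-β) α (by ring) (by linear_combination -hz)
    have a2 := hz' γ (-β) (by linear_combination -hz) (by ring)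
    have a3 := hz' 1 0 (by rw [a1.2]; ring)
      (by rw [neg_eq_zero.1 a1.1]; ring)
    exact one_ne_zero a3.1
  -- two isotropic vectors in the plane of all `L` with `⟨X i, L⟩ = 0`
  obtain ⟨x, y, x', y', i1, i2, i3⟩ : ∃ x y x' y' : ℂ, α * x * x + β * (x * y + x * y) + γ * y * y = 0 ∧
      α * x' * x' + β * (x' * y' + x' * y') + γ * y' * y' = 0 ∧
      α * x * x' + β * (x * y' + x' * y) + γ * y * y' ≠ 0 := by
    by_cases h0 : α = 0
    · have hβ0 : β ≠ 0 := by rintro rfl; simp [h0] at hdisc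
      refine ⟨1, 0, γ, -2 * β, by simp [h0], by rw [h0]; ring, ?_⟩
      rw [h0]
      simpa using hβ0
    · obtain ⟨r, hr⟩ := IsAlgClosed.exists_pow_nat_eq (β ^ 2 - α * γ) (n := 2) (by norm_num)
      refine ⟨-β + r, α, -β - r, α, by linear_combination α * hr, by linear_combination α * hr, ?_⟩
      have : α * (-β + r) * (-β - r) + β * ((-β + r) * α + (-β - r) * α) + γ * α * α =
          -2 * α * (β ^ 2 - α * γ) := by linear_combination -α * hr
      rw [this]
      exact mul_ne_zero (mul_ne_zero (by norm_num) h0) hdisc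
  have hmem : ∀ x y : ℂ, ∀ i, pairing (X i) (x • e₁ + y • e₂) = 0 := fun x y =>
    (hker _).1 (add_mem (Submodule.smul_mem _ _ hk₁) (Submodule.smul_mem _ _ hk₂))
  refine ⟨x • e₁ + y • e₂, x' • e₁ + y' • e₂, by rw [hpair, i1], by rw [hpair, i2],
    by rwa [hpair], hmem x y, hmem x' y', fun L hL hLX => ?_⟩
  obtain ⟨z, z', rfl⟩ := hbspan L ((hker L).2 hLX)
  rw [hpair] at hL
  have hD : x * y' - x' * y ≠ 0 := by
    intro hz
    refine i3 ?_
    have h1 : (α * x * x' + β * (x * y' + x' * y) + γ * y * y') * x = 0 := by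
      linear_combination x' * i1 + (β * x + γ * y) * hz
    have h2 : (α * x * x' + β * (x * y' + x' * y) + γ * y * y') * y = 0 := by
      linear_combination y' * i1 - (β * y + α * x) * hz
    by_contra hne
    have hx := (mul_eq_zero.1 h1).resolve_left hne
    have hy := (mul_eq_zero.1 h2).resolve_left hne
    exact hne (by rw [hx, hy]; ring)
  -- coordinates of `L` with respect to the two isotropic vectors
  obtain ⟨c, hc⟩ : ∃ c, c = (z * y' - x' * z') / (x * y' - x' * y) := ⟨_, rfl⟩
  obtain ⟨c', hc'⟩ : ∃ c', c' = (x * z' - z * y) / (x * y' - x' * y) := ⟨_, rfl⟩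
  have hcD : c * (x * y' - x' * y) = z * y' - x' * z' := by rw [hc, div_mul_cancel₀ _ hD]
  have hcD' : c' * (x * y' - x' * y) = x * z' - z * y := by rw [hc', div_mul_cancel₀ _ hD]
  have hz : z = c * x + c' * x' := mul_right_cancel₀ hD (by
    linear_combination -x * hcD - x' * hcD')
  have hz' : z' = c * y + c' * y' := mul_right_cancel₀ hD (by
    linear_combination -y * hcD - y' * hcD')
  have hcc : c * c' * (α * x * x' + β * (x * y' + x' * y) + γ * y * y') = 0 := by
    rw [hz, hz'] at hL
    linear_combination (hL - c ^ 2 * i1 - c' ^ 2 * i2) / 2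
  rcases mul_eq_zero.1 ((mul_eq_zero.1 hcc).resolve_right i3) with h0 | h0
  · refine ⟨c', Or.inr ?_⟩
    rw [hz, hz', h0]
    module
  · refine ⟨c, Or.inl ?_⟩
    rw [hz, hz', h0]
    module

/-! ### Successive transversals of lines in positive position -/

/-- A real vector, seen as a complex vector. -/
def toComplex (w : Fin 6 → ℝ) : Fin 6 → ℂ := fun k => (w k : ℂ)

theorem pairing_toComplex (A X : Fin 6 → ℝ) :
    pairing (toComplex A) (toComplex X) = ((pairing A X : ℝ) : ℂ) := by
  simp [pairing, toComplex]

theorem toComplex_smul (c : ℝ) (A : Fin 6 → ℝ) : toComplex (c • A) = (c : ℂ) • toComplex A := by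
  ext i; simp [toComplex]

namespace PositivePosition

variable {l : List ((Fin 4 → ℝ) × (Fin 4 → ℝ))} {x₁ x₂ x₃ x₄ : (Fin 4 → ℝ) × (Fin 4 → ℝ)}

theorem gram_ne_zero (h : PositivePosition (x₁ :: x₂ :: x₃ :: x₄ :: l)) :
    gram ![toComplex (plucker x₁.1 x₁.2), toComplex (plucker x₂.1 x₂.2),
      toComplex (plucker x₃.1 x₃.2), toComplex (plucker x₄.1 x₄.2)] ≠ 0 := by
  have h8 := gram_pos (h.posSeq (n := 8) (by simp; omega))
  have : gram ![toComplex (plucker x₁.1 x₁.2), toComplex (plucker x₂.1 x₂.2),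
      toComplex (plucker x₃.1 x₃.2), toComplex (plucker x₄.1 x₄.2)] =
      ((gram ![plucker x₁.1 x₁.2, plucker x₂.1 x₂.2, plucker x₃.1 x₃.2, plucker x₄.1 x₄.2] : ℝ)
        : ℂ) := by
    simp [gram, pairing_toComplex]
  rw [this]
  exact Complex.ofReal_ne_zero.2 h8.ne'

/-- Every complex common transversal of four successive lines in positive position is real, and
it is again in positive position with the other lines. -/
theorem exists_transversal (h : PositivePosition (x₁ :: x₂ :: x₃ :: x₄ :: l)) (hl : l ≠ [])
    {X : Fin 6 → ℂ} (hX0 : X ≠ 0) (hX : pairing X X = 0)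
    (h₁ : pairing (toComplex (plucker x₁.1 x₁.2)) X = 0)
    (h₂ : pairing (toComplex (plucker x₂.1 x₂.2)) X = 0)
    (h₃ : pairing (toComplex (plucker x₃.1 x₃.2)) X = 0)
    (h₄ : pairing (toComplex (plucker x₄.1 x₄.2)) X = 0) :
    ∃ (e : (Fin 4 → ℝ) × (Fin 4 → ℝ)) (c : ℂ), c ≠ 0 ∧ X = c • toComplex (plucker e.1 e.2) ∧
      PositivePosition (e :: l) := by
  have hlen : 0 < l.length := List.length_pos_of_ne_nil hl
  have hpos : ∀ i j k m, i < j → j < k → k < m → m < 8 → ¬AdjacentLines (l.length + 4) i j k m →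
      0 < br (pt (x₁ :: x₂ :: x₃ :: x₄ :: l) i) (pt (x₁ :: x₂ :: x₃ :: x₄ :: l) j)
        (pt (x₁ :: x₂ :: x₃ :: x₄ :: l) k) (pt (x₁ :: x₂ :: x₃ :: x₄ :: l) m) :=
    fun i j k m hi hj hk hm => (h i j k m hi hj hk (by simp; omega)).2
  have h14 : 0 < br x₁.1 x₁.2 x₄.1 x₄.2 :=
    hpos 0 1 6 7 (by omega) (by omega) (by omega) (by omega) (by simp [AdjacentLines]; omega)
  obtain ⟨s, t, s', t', hss, ht, ht'⟩ := exists_two_isTransversal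
    (h.posSeq (n := 8) (by simp; omega))
    (hpos 0 1 4 5 (by omega) (by omega) (by omega) (by omega) (by simp [AdjacentLines]; omega))
    h14 (hpos 2 3 6 7 (by omega) (by omega) (by omega) (by omega) (by simp [AdjacentLines]))
  have key : ∀ s t, IsTransversal (fun i : Fin 8 => pt (x₁ :: x₂ :: x₃ :: x₄ :: l) i) s t →
      PositivePosition ((s • x₁.2 - x₁.1, x₄.1 - t • x₄.2) :: l) ∧
      ∀ i, pairing (![toComplex (plucker x₁.1 x₁.2), toComplex (plucker x₂.1 x₂.2),
        toComplex (plucker x₃.1 x₃.2), toComplex (plucker x₄.1 x₄.2)] i)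
        (toComplex (plucker (s • x₁.2 - x₁.1) (x₄.1 - t • x₄.2))) = 0 := by
    intro s t ht
    refine ⟨h.isTransversal_cons hl ht, ?_⟩
    have m2 : pencil x₁.1 x₁.2 s x₂.1 x₂.2 x₄.1 = t * pencil x₁.1 x₁.2 s x₂.1 x₂.2 x₄.2 :=
      ht.meets₂
    have m3 : pencil x₁.1 x₁.2 s x₃.1 x₃.2 x₄.1 = t * pencil x₁.1 x₁.2 s x₃.1 x₃.2 x₄.2 :=
      ht.meets₃
    have e : ∀ a b : Fin 4 → ℝ, br a b (s • x₁.2 - x₁.1) (x₄.1 - t • x₄.2) =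
        t * pencil x₁.1 x₁.2 s a b x₄.2 - pencil x₁.1 x₁.2 s a b x₄.1 := by
      intro a b
      simp only [pencil, br_eq, Pi.sub_apply, Pi.smul_apply, smul_eq_mul]; ring
    have r1 : br x₁.1 x₁.2 (s • x₁.2 - x₁.1) (x₄.1 - t • x₄.2) = 0 := by
      simp only [br_eq, Pi.sub_apply, Pi.smul_apply, smul_eq_mul]; ring
    have r2 : br x₂.1 x₂.2 (s • x₁.2 - x₁.1) (x₄.1 - t • x₄.2) = 0 := by
      rw [e, m2, sub_self]
    have r3 : br x₃.1 x₃.2 (s • x₁.2 - x₁.1) (x₄.1 - t • x₄.2) = 0 := by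
      rw [e, m3, sub_self]
    have r4 : br x₄.1 x₄.2 (s • x₁.2 - x₁.1) (x₄.1 - t • x₄.2) = 0 := by
      simp only [br_eq, Pi.sub_apply, Pi.smul_apply, smul_eq_mul]; ring
    intro i
    fin_cases i
    · exact (pairing_toComplex _ _).trans (Complex.ofReal_eq_zero.2 r1)
    · exact (pairing_toComplex _ _).trans (Complex.ofReal_eq_zero.2 r2)
    · exact (pairing_toComplex _ _).trans (Complex.ofReal_eq_zero.2 r3)
    · exact (pairing_toComplex _ _).trans (Complex.ofReal_eq_zero.2 r4)
  obtain ⟨hP, hE⟩ := key s t ht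
  obtain ⟨hP', hE'⟩ := key s' t' ht'
  have hne0 : ∀ {s s' : ℝ} (t : ℝ), s' - s ≠ 0 →
      toComplex (plucker (s • x₁.2 - x₁.1) (x₄.1 - t • x₄.2)) ≠ 0 := by
    intro s s' t hs h0
    have e1 := br_sub_smul_sub_smul x₁.1 x₁.2 x₄.1 x₄.2 s s' t
    have := congrArg (fun L => pairing L (toComplex (plucker (s' • x₁.2 - x₁.1) x₄.2))) h0
    simp only [pairing_toComplex] at this
    change ((br _ _ _ _ : ℝ) : ℂ) = _ at this
    rw [e1, show pairing (0 : Fin 6 → ℂ) _ = 0 by simp [pairing], Complex.ofReal_eq_zero] at this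
    exact (mul_ne_zero hs h14.ne') this
  have hE0 := hne0 t (sub_pos.2 hss).ne'
  have hE0' := hne0 t' (sub_neg.2 hss).ne
  have hne : ∀ c : ℂ, toComplex (plucker (s • x₁.2 - x₁.1) (x₄.1 - t • x₄.2)) ≠
      c • toComplex (plucker (s' • x₁.2 - x₁.1) (x₄.1 - t' • x₄.2)) := by
    intro c hc
    have e1 := br_sub_smul_sub_smul x₁.1 x₁.2 x₄.1 x₄.2 s s' t
    have e2 : br (s' • x₁.2 - x₁.1) (x₄.1 - t' • x₄.2) (s' • x₁.2 - x₁.1) x₄.2 = 0 := by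
      rw [br_sub_smul_sub_smul, sub_self, zero_mul]
    have := congrArg (fun L => pairing L (toComplex (plucker (s' • x₁.2 - x₁.1) x₄.2))) hc
    simp only [smul_pairing, pairing_toComplex] at this
    change ((br _ _ _ _ : ℝ) : ℂ) = c * ((br _ _ _ _ : ℝ) : ℂ) at this
    rw [e1, e2, Complex.ofReal_zero, mul_zero, Complex.ofReal_eq_zero] at this
    exact (mul_pos (sub_pos.2 hss) h14).ne' this
  have hiso : ∀ a b : Fin 4 → ℝ, pairing (toComplex (plucker a b)) (toComplex (plucker a b)) = 0 :=
    fun a b => by rw [pairing_toComplex, pairing_plucker_self, Complex.ofReal_zero]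
  obtain ⟨u, u', -, -, -, -, -, huniq⟩ := exists_two_transversals
    (X := ![toComplex (plucker x₁.1 x₁.2), toComplex (plucker x₂.1 x₂.2),
      toComplex (plucker x₃.1 x₃.2), toComplex (plucker x₄.1 x₄.2)])
    (by rw [det_pairing_eq_gram (by intro i; fin_cases i <;> exact hiso _ _)]
        exact h.gram_ne_zero)
  have hprop : ∀ {Y Z v : Fin 6 → ℂ} {c c' : ℂ}, Y = c • v → Z = c' • v → Y ≠ 0 → Z ≠ 0 →
      ∃ a : ℂ, a ≠ 0 ∧ Y = a • Z := by
    rintro Y Z v c c' rfl rfl hY hZ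
    have hc : c ≠ 0 := by rintro rfl; simp at hY
    have hc' : c' ≠ 0 := by rintro rfl; simp at hZ
    exact ⟨c / c', div_ne_zero hc hc', by rw [smul_smul, div_mul_cancel₀ _ hc']⟩
  obtain ⟨c, hc⟩ := huniq _ (hiso _ _) hE
  obtain ⟨c', hc'⟩ := huniq _ (hiso _ _) hE'
  obtain ⟨c'', hc''⟩ := huniq X hX (by
    intro i; fin_cases i
    exacts [h₁, h₂, h₃, h₄])
  have hcase : (∃ a : ℂ, a ≠ 0 ∧ X = a • toComplex (plucker (s • x₁.2 - x₁.1) (x₄.1 - t • x₄.2))) ∨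
      ∃ a : ℂ, a ≠ 0 ∧ X = a • toComplex (plucker (s' • x₁.2 - x₁.1) (x₄.1 - t' • x₄.2)) := by
    rcases hc with hc | hc <;> rcases hc' with hc' | hc'
    · obtain ⟨a, -, ha⟩ := hprop hc hc' hE0 hE0'
      exact absurd ha (hne a)
    · exact hc''.imp (fun h => hprop h hc hX0 hE0) (fun h => hprop h hc' hX0 hE0')
    · exact hc''.symm.imp (fun h => hprop h hc hX0 hE0) (fun h => hprop h hc' hX0 hE0')
    · obtain ⟨a, -, ha⟩ := hprop hc hc' hE0 hE0'
      exact absurd ha (hne a)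
  rcases hcase with ⟨a, ha, h'⟩ | ⟨a, ha, h'⟩
  · exact ⟨_, a, ha, h', hP⟩
  · exact ⟨_, a, ha, h', hP'⟩

end PositivePosition

/-- A way to construct a line from some of `d` given lines, by repeatedly taking one of the common
transversals of four lines. -/
inductive Construction (d : ℕ) : Type
  | given (j : Fin d) : Construction d
  | transversal (t₁ t₂ t₃ t₄ : Construction d) : Construction d

namespace Construction

variable {d : ℕ}

/-- The given lines that are used in a construction, in their order. -/
def lines : Construction d → List (Fin d)
  | given j => [j]
  | transversal t₁ t₂ t₃ t₄ => t₁.lines ++ t₂.lines ++ t₃.lines ++ t₄.lines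

/-- `X` is one of the possible results of the construction from the lines `M`. -/
def Yields (M : Fin d → Fin 6 → ℂ) : Construction d → (Fin 6 → ℂ) → Prop
  | given j, X => X = M j
  | transversal t₁ t₂ t₃ t₄, X => X ≠ 0 ∧ pairing X X = 0 ∧ ∃ X₁ X₂ X₃ X₄,
      (t₁.Yields M X₁ ∧ t₂.Yields M X₂ ∧ t₃.Yields M X₃ ∧ t₄.Yields M X₄) ∧
      pairing X₁ X = 0 ∧ pairing X₂ X = 0 ∧ pairing X₃ X = 0 ∧ pairing X₄ X = 0

theorem lines_ne_nil (t : Construction d) : t.lines ≠ [] := by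
  induction t with
  | given j => simp [lines]
  | transversal t₁ t₂ t₃ t₄ h₁ h₂ h₃ h₄ => simp [lines, h₁]

variable {M : Fin d → Fin 6 → ℂ} {x : Fin d → (Fin 4 → ℝ) × (Fin 4 → ℝ)}

/-- Up to scalars, the four results of constructions from consecutive blocks of lines are real lines
in positive position. The blocks are replaced one after the other; the blocks that are not treated
yet are the remaining lines `r` of the hypothesis `H`, after a cyclic rotation. -/
theorem positivePosition_four {t₁ t₂ t₃ t₄ : Construction d}
    {r : List ((Fin 4 → ℝ) × (Fin 4 → ℝ))}
    (H : ∀ t ∈ [t₁, t₂, t₃, t₄], ∀ r, r ≠ [] → PositivePosition (t.lines.map x ++ r) → ∀ X,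
      t.Yields M X → ∃ (e : (Fin 4 → ℝ) × (Fin 4 → ℝ)) (c : ℂ), c ≠ 0 ∧
        X = c • toComplex (plucker e.1 e.2) ∧ PositivePosition (e :: r))
    (h : PositivePosition ((transversal t₁ t₂ t₃ t₄).lines.map x ++ r)) {X₁ X₂ X₃ X₄ : Fin 6 → ℂ}
    (h₁ : t₁.Yields M X₁) (h₂ : t₂.Yields M X₂) (h₃ : t₃.Yields M X₃) (h₄ : t₄.Yields M X₄) :
    ∃ (e₁ e₂ e₃ e₄ : (Fin 4 → ℝ) × (Fin 4 → ℝ)) (c₁ c₂ c₃ c₄ : ℂ),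
      (c₁ ≠ 0 ∧ c₂ ≠ 0 ∧ c₃ ≠ 0 ∧ c₄ ≠ 0) ∧
      X₁ = c₁ • toComplex (plucker e₁.1 e₁.2) ∧ X₂ = c₂ • toComplex (plucker e₂.1 e₂.2) ∧
      X₃ = c₃ • toComplex (plucker e₃.1 e₃.2) ∧ X₄ = c₄ • toComplex (plucker e₄.1 e₄.2) ∧
      PositivePosition (e₁ :: e₂ :: e₃ :: e₄ :: r) := by
  simp only [lines, List.map_append, List.append_assoc] at h
  obtain ⟨e₁, c₁, hc₁, hX₁, p₁⟩ := H t₁ (by simp) _ (by simp [lines_ne_nil]) h X₁ h₁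
  have p₁' := p₁.rotate_one
  simp only [List.append_assoc] at p₁'
  obtain ⟨e₂, c₂, hc₂, hX₂, p₂⟩ := H t₂ (by simp) _ (by simp) p₁' X₂ h₂
  have p₂' := p₂.rotate_one
  simp only [List.append_assoc] at p₂'
  obtain ⟨e₃, c₃, hc₃, hX₃, p₃⟩ := H t₃ (by simp) _ (by simp) p₂' X₃ h₃
  have p₃' := p₃.rotate_one
  simp only [List.append_assoc] at p₃'
  obtain ⟨e₄, c₄, hc₄, hX₄, p₄⟩ := H t₄ (by simp) _ (by simp) p₃' X₄ h₄
  have p₄' := p₄.rotate_one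
  simp only [List.append_assoc] at p₄'
  have p₅ := p₄'.rotate'
  refine ⟨e₁, e₂, e₃, e₄, c₁, c₂, c₃, c₄, ⟨hc₁, hc₂, hc₃, hc₄⟩, hX₁, hX₂, hX₃, hX₄, ?_⟩
  simpa using p₅

/-- All results of a construction from lines in positive position are real, and in positive
position with all lines that come after those used in the construction. -/
theorem exists_positivePosition (hM : ∀ j, ∃ c : ℂ, c ≠ 0 ∧
    M j = c • toComplex (plucker (x j).1 (x j).2)) (t : Construction d) :
    ∀ r, r ≠ [] → PositivePosition (t.lines.map x ++ r) → ∀ X, t.Yields M X →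
      ∃ (e : (Fin 4 → ℝ) × (Fin 4 → ℝ)) (c : ℂ), c ≠ 0 ∧
        X = c • toComplex (plucker e.1 e.2) ∧ PositivePosition (e :: r) := by
  induction t with
  | given j =>
    rintro r - h X rfl
    obtain ⟨c, hc, hj⟩ := hM j
    exact ⟨x j, c, hc, hj, h⟩
  | transversal t₁ t₂ t₃ t₄ ih₁ ih₂ ih₃ ih₄ =>
    rintro r hr h X ⟨hX0, hX, X₁, X₂, X₃, X₄, ⟨h₁, h₂, h₃, h₄⟩, k₁, k₂, k₃, k₄⟩
    obtain ⟨e₁, e₂, e₃, e₄, c₁, c₂, c₃, c₄, ⟨hc₁, hc₂, hc₃, hc₄⟩, rfl, rfl, rfl, rfl, p⟩ :=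
      positivePosition_four (fun t ht => by
        simp only [List.mem_cons, List.not_mem_nil, or_false] at ht
        rcases ht with rfl | rfl | rfl | rfl
        exacts [ih₁, ih₂, ih₃, ih₄]) h h₁ h₂ h₃ h₄
    simp only [smul_pairing, mul_eq_zero] at k₁ k₂ k₃ k₄
    exact p.exists_transversal hr hX0 hX (k₁.resolve_left hc₁) (k₂.resolve_left hc₂)
      (k₃.resolve_left hc₃) (k₄.resolve_left hc₄)

/-- In the last step of a construction the four lines have two distinct common transversals. For
this, no line has to remain after those used in the construction. -/
theorem gram_ne_zero (hM : ∀ j, ∃ c : ℂ, c ≠ 0 ∧ M j = c • toComplex (plucker (x j).1 (x j).2))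
    {t₁ t₂ t₃ t₄ : Construction d}
    (h : PositivePosition ((transversal t₁ t₂ t₃ t₄).lines.map x)) {X : Fin 4 → Fin 6 → ℂ}
    (h₁ : t₁.Yields M (X 0)) (h₂ : t₂.Yields M (X 1)) (h₃ : t₃.Yields M (X 2))
    (h₄ : t₄.Yields M (X 3)) : gram X ≠ 0 := by
  obtain ⟨e₁, e₂, e₃, e₄, c₁, c₂, c₃, c₄, ⟨hc₁, hc₂, hc₃, hc₄⟩, k₁, k₂, k₃, k₄, p⟩ :=
    positivePosition_four (r := []) (fun t _ => exists_positivePosition hM t) (by simpa using h)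
      h₁ h₂ h₃ h₄
  have hg := p.gram_ne_zero
  have : gram X = (c₁ * c₂ * c₃ * c₄) ^ 2 * gram ![toComplex (plucker e₁.1 e₁.2),
      toComplex (plucker e₂.1 e₂.2), toComplex (plucker e₃.1 e₃.2),
      toComplex (plucker e₄.1 e₄.2)] := by
    simp only [gram, k₁, k₂, k₃, k₄, smul_pairing, pairing_smul]
    simp
    ring
  rw [this]
  exact mul_ne_zero (pow_ne_zero _ (by simp [*])) hg

end Construction

/-! ### Branches of a tree -/

section Branch

/-- Induction along the edges of a connected graph. -/
theorem connected_induction {V : Type*} {G : SimpleGraph V} (hG : G.Connected) {c : V}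
    {p : V → Prop} (h0 : p c)
    (hs : ∀ x y, p x → G.Adj x y → p y) (x : V) : p x := by
  have hx := hG.preconnected c x
  rw [SimpleGraph.reachable_iff_reflTransGen] at hx
  induction hx with
  | refl => exact h0
  | tail _ hab ih => exact hs _ _ ih hab

variable {V : Type*} [Fintype V] {G : SimpleGraph V}

open Classical in
/-- The branch at `c` of a tree, seen from the neighbour `v` of `c`: the connected component of
`c` after removing the edge `c v`. -/
def branch (G : SimpleGraph V) (c v : V) : Finset V :=
  Finset.univ.filter fun x => (G.deleteEdges {s(c, v)}).Reachable c x

theorem mem_branch {c v x : V} : x ∈ branch G c v ↔ (G.deleteEdges {s(c, v)}).Reachable c x := by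
  simp [branch]

theorem self_mem_branch (c v : V) : c ∈ branch G c v := mem_branch.2 (.refl _)

theorem mem_branch_of_adj {c v x y : V} (hx : x ∈ branch G c v) (h : G.Adj x y)
    (hne : s(x, y) ≠ s(c, v)) : y ∈ branch G c v := by
  rw [mem_branch] at *
  exact hx.trans (SimpleGraph.Adj.reachable (by
    rw [SimpleGraph.deleteEdges_adj]; exact ⟨h, by simpa using hne⟩))

/-- Induction along the edges of a branch. -/
theorem branch_induction {c v : V} {p : V → Prop} (h0 : p c)
    (hs : ∀ x y, x ∈ branch G c v → p x → G.Adj x y → s(x, y) ≠ s(c, v) → p y) :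
    ∀ x ∈ branch G c v, p x := by
  intro x hx
  rw [mem_branch, SimpleGraph.reachable_iff_reflTransGen] at hx
  have : p x ∧ x ∈ branch G c v := by
    induction hx with
    | refl => exact ⟨h0, self_mem_branch c v⟩
    | tail _ hab ih =>
      rw [SimpleGraph.deleteEdges_adj] at hab
      have hne := fun h => hab.2 (Set.mem_singleton_iff.2 h)
      exact ⟨hs _ _ ih.2 ih.1 hab.1 hne, mem_branch_of_adj ih.2 hab.1 hne⟩
  exact this.1

variable (hG : G.IsTree)
include hG

theorem notMem_branch {c v : V} (h : G.Adj c v) : v ∉ branch G c v := by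
  have := SimpleGraph.isAcyclic_iff_forall_adj_isBridge.1 hG.isAcyclic h
  rw [SimpleGraph.isBridge_iff] at this
  rwa [mem_branch]

/-- The edge `c v` is the only edge that leaves the branch at `c` seen from `v`. -/
theorem eq_of_adj_of_notMem_branch {c v x y : V} (hcv : G.Adj c v) (hx : x ∈ branch G c v)
    (hy : y ∉ branch G c v) (h : G.Adj x y) : x = c ∧ y = v := by
  by_contra hne
  refine hy (mem_branch_of_adj hx h fun heq => ?_)
  rcases Sym2.eq_iff.1 heq with h' | ⟨rfl, rfl⟩
  · exact hne h'
  · exact notMem_branch hG hcv hx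

theorem mem_branch_swap_iff {c v x : V} (h : G.Adj c v) : x ∈ branch G v c ↔ x ∉ branch G c v := by
  constructor
  · refine branch_induction (p := fun x => x ∉ branch G c v) (notMem_branch hG h) ?_ x
    intro a b ha hna hab hne hb
    obtain ⟨rfl, rfl⟩ := eq_of_adj_of_notMem_branch hG h hb hna hab.symm
    exact hne rfl
  · intro hx
    have := connected_induction hG.connected (c := c)
      (p := fun x => x ∈ branch G c v ∨ x ∈ branch G v c) (Or.inl (self_mem_branch c v)) ?_ x
    · exact this.resolve_left hx
    · rintro a b (ha | ha) hab
      · by_cases hb : b ∈ branch G c v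
        · exact Or.inl hb
        · obtain ⟨rfl, rfl⟩ := eq_of_adj_of_notMem_branch hG h ha hb hab
          exact Or.inr (self_mem_branch _ _)
      · by_cases hb : b ∈ branch G v c
        · exact Or.inr hb
        · obtain ⟨rfl, rfl⟩ := eq_of_adj_of_notMem_branch hG h.symm ha hb hab
          exact Or.inl (self_mem_branch _ _)

theorem branch_subset_branch {c v c' : V} (hcv : G.Adj c v) (hc : G.Adj c' c) (hne : c' ≠ v) :
    branch G c' c ⊆ branch G c v := by
  refine branch_induction (p := fun x => x ∈ branch G c v) ?_ ?_
  · refine mem_branch_of_adj (self_mem_branch c v) hc.symm fun h => hne ?_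
    rcases Sym2.eq_iff.1 h with ⟨-, h⟩ | ⟨rfl, rfl⟩
    exacts [h, rfl]
  · intro x y hx hx' hxy _
    by_contra hy
    obtain ⟨rfl, rfl⟩ := eq_of_adj_of_notMem_branch hG hcv hx' hy hxy
    exact notMem_branch hG hc hx

theorem disjoint_branch {c c' c'' : V} (h' : G.Adj c' c) (h'' : G.Adj c'' c) (hne : c' ≠ c'') :
    Disjoint (branch G c' c) (branch G c'' c) := by
  rw [Finset.disjoint_left]
  intro x hx hx'
  exact (mem_branch_swap_iff hG h').1 (branch_subset_branch hG h'.symm h'' hne.symm hx') hx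

theorem exists_mem_branch {c x : V} (hx : x ≠ c) : ∃ c', G.Adj c' c ∧ x ∈ branch G c' c := by
  refine (connected_induction hG.connected (c := c)
    (p := fun x => x = c ∨ ∃ c', G.Adj c' c ∧ x ∈ branch G c' c) (Or.inl rfl) ?_ x).resolve_left hx
  rintro a b (rfl | ⟨c', hc', ha⟩) hab
  · exact Or.inr ⟨b, hab.symm, self_mem_branch _ _⟩
  · by_cases hb : b ∈ branch G c' c
    · exact Or.inr ⟨c', hc', hb⟩
    · exact Or.inl (eq_of_adj_of_notMem_branch hG hc' ha hb hab).2

open Classical in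
/-- A tree consists of a vertex and the branches at its neighbours. -/
theorem univ_eq_insert_biUnion [DecidableEq V] (c : V) :
    Finset.univ = insert c ((Finset.univ.filter fun c' => G.Adj c' c).biUnion
      fun c' => branch G c' c) := by
  ext x
  simp only [Finset.mem_univ, Finset.mem_insert, Finset.mem_biUnion, Finset.mem_filter, true_and,
    true_iff]
  by_cases hx : x = c
  · exact Or.inl hx
  · exact Or.inr (exists_mem_branch hG hx)

open Classical in
/-- A branch consists of its vertex and of the smaller branches at the other neighbours. -/
theorem branch_eq_insert_biUnion [DecidableEq V] {c v : V} (h : G.Adj c v) :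
    branch G c v = insert c ((Finset.univ.filter fun c' => G.Adj c' c ∧ c' ≠ v).biUnion
      fun c' => branch G c' c) := by
  ext x
  simp only [Finset.mem_insert, Finset.mem_biUnion, Finset.mem_filter, Finset.mem_univ, true_and]
  constructor
  · intro hx
    by_cases hxc : x = c
    · exact Or.inl hxc
    obtain ⟨c', hc', hx'⟩ := exists_mem_branch hG hxc
    refine Or.inr ⟨c', ⟨hc', ?_⟩, hx'⟩
    rintro rfl
    exact (mem_branch_swap_iff hG h).1 hx' hx
  · rintro (rfl | ⟨c', ⟨hc', hne⟩, hx⟩)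
    · exact self_mem_branch _ _
    · exact branch_subset_branch hG h hc' hne hx

theorem sum_insert_biUnion_branch [DecidableEq V] {c : V} {N : Finset V}
    (hN : ∀ c' ∈ N, G.Adj c' c) (f : V → ℤ) :
    ∑ x ∈ insert c (N.biUnion fun c' => branch G c' c), f x =
      f c + ∑ c' ∈ N, ∑ x ∈ branch G c' c, f x := by
  rw [Finset.sum_insert, Finset.sum_biUnion]
  · intro a ha b hb hab
    exact disjoint_branch hG (hN a ha) (hN b hb) hab
  · simp only [Finset.mem_biUnion, not_exists, not_and]
    exact fun c' hc' => notMem_branch hG (hN c' hc')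

theorem card_branch_lt {c v c' : V} (hcv : G.Adj c v) (hc : G.Adj c' c) (hne : c' ≠ v) :
    (branch G c' c).card < (branch G c v).card :=
  Finset.card_lt_card ⟨branch_subset_branch hG hcv hc hne, fun h =>
    notMem_branch hG hc (h (self_mem_branch c v))⟩

theorem sum_branch_add_sum_branch {c v : V} (h : G.Adj c v) (f : V → ℤ) :
    ∑ x ∈ branch G c v, f x + ∑ x ∈ branch G v c, f x = ∑ x, f x := by
  classical
  have : branch G v c = (branch G c v)ᶜ := by
    ext x; rw [mem_branch_swap_iff hG h, Finset.mem_compl]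
  rw [this, Finset.sum_add_sum_compl]

end Branch

/-! ### The incidence variety of a tree is irreducible -/

variable {ℓ d : ℕ} {G : SimpleGraph (Fin ℓ)}

/-- The vectors `x i` satisfy the equations of the incidence variety. -/
structure IsIncident (G : SimpleGraph (Fin ℓ)) (x : Fin ℓ → Fin 6 → ℂ) : Prop where
  self : ∀ i, pairing (x i) (x i) = 0
  adj : ∀ i j, G.Adj i j → pairing (x i) (x j) = 0

theorem map_pairing {R S : Type*} [CommRing R] [CommRing S] (f : R →+* S) (A X : Fin 6 → R) :
    f (pairing A X) = pairing (fun k => f (A k)) fun k => f (X k) := by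
  simp [pairing]

theorem map_plucker {R S : Type*} [CommRing R] [CommRing S] (f : R →+* S) (v w : Fin 4 → R)
    (k : Fin 6) : f (plucker v w k) = plucker (fun i => f (v i)) (fun i => f (w i)) k := by
  fin_cases k <;> simp [plucker]

/-- The part of a configuration of lines on the vertices in `S` is parametrized by polynomials. -/
def IsParametrized (G : SimpleGraph (Fin ℓ)) (S : Finset (Fin ℓ)) : Prop :=
  ∃ (σ : Type) (v w : Fin ℓ → Fin 4 → MvPolynomial σ ℂ),
    (∀ i ∈ S, ∀ j ∈ S, G.Adj i j → pairing (plucker (v i) (w i)) (plucker (v j) (w j)) = 0) ∧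
    ∀ x : Fin ℓ → Fin 6 → ℂ, (∀ i, x i ≠ 0) → IsIncident G x → ∃ t : σ → ℂ, ∀ i ∈ S,
      x i = plucker (fun k => eval t (v i k)) (fun k => eval t (w i k))

theorem IsParametrized.singleton (i : Fin ℓ) : IsParametrized G {i} := by
  refine ⟨Fin 4 ⊕ Fin 4, fun _ k => X (Sum.inl k), fun _ k => X (Sum.inr k), ?_, ?_⟩
  · intro a ha b hb hab
    rw [Finset.mem_singleton] at ha hb
    exact absurd (ha.trans hb.symm) hab.ne
  · intro x hx0 hx
    obtain ⟨v, w, h⟩ := exists_eq_plucker (hx.self i) two_ne_zero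
    refine ⟨Sum.elim v w, fun j hj => ?_⟩
    rw [Finset.mem_singleton.1 hj, h]
    simp

/-- A new line that has to meet just one of the lines so far is given by a point of that line and
a second point. -/
theorem IsParametrized.insert {S : Finset (Fin ℓ)} (h : IsParametrized G S) {p u : Fin ℓ}
    (hp : p ∈ S) (hu : u ∉ S) (hpu : G.Adj p u) (huniq : ∀ q ∈ S, G.Adj q u → q = p) :
    IsParametrized G (insert u S) := by
  obtain ⟨σ, v, w, h1, h2⟩ := h
  let ren : MvPolynomial σ ℂ →ₐ[ℂ] MvPolynomial (σ ⊕ Fin 6) ℂ := rename Sum.inl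
  let v' : Fin ℓ → Fin 4 → MvPolynomial (σ ⊕ Fin 6) ℂ := fun i k =>
    if i = u then X (Sum.inr 0) * ren (v p k) + X (Sum.inr 1) * ren (w p k) else ren (v i k)
  let w' : Fin ℓ → Fin 4 → MvPolynomial (σ ⊕ Fin 6) ℂ := fun i k =>
    if i = u then X (Sum.inr k.succ.succ) else ren (w i k)
  have hne : ∀ i ∈ S, i ≠ u := fun i hi h => hu (h ▸ hi)
  have hv : ∀ i ∈ S, v' i = fun k => ren (v i k) := fun i hi => by simp [v', hne i hi]
  have hw : ∀ i ∈ S, w' i = fun k => ren (w i k) := fun i hi => by simp [w', hne i hi]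
  have hu' : ∀ i ∈ S, G.Adj i u → pairing (plucker (v' i) (w' i)) (plucker (v' u) (w' u)) = 0 := by
    intro i hi hiu
    obtain rfl := huniq i hi hiu
    rw [hv i hi, hw i hi]
    simp only [v', w', if_true]
    simp [pairing, plucker]
    ring
  refine ⟨σ ⊕ Fin 6, v', w', ?_, ?_⟩
  · intro i hi j hj hij
    rcases Finset.mem_insert.1 hi with rfl | hi' <;> rcases Finset.mem_insert.1 hj with rfl | hj'
    · exact absurd rfl hij.ne
    · rw [pairing_comm]; exact hu' j hj' hij.symm
    · exact hu' i hi' hij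
    · rw [hv i hi', hv j hj', hw i hi', hw j hj']
      have := congrArg ren.toRingHom (h1 i hi' j hj' hij)
      rw [map_pairing, map_zero] at this
      simp only [map_plucker] at this
      exact this
  · intro x hx0 hx
    obtain ⟨t, ht⟩ := h2 x hx0 hx
    have hxp := ht p hp
    obtain ⟨a, b, c, hc⟩ := exists_eq_plucker_of_meets (hxp ▸ hx0 p) (hx0 u) (hx.self u)
      (hxp ▸ hx.adj p u hpu) two_ne_zero
    let t' : σ ⊕ Fin 6 → ℂ := Sum.elim t ![a, b, c 0, c 1, c 2, c 3]
    have hren : ∀ f, eval t' (ren f) = eval t f := fun f => by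
      simp only [ren, eval_rename]; rfl
    refine ⟨t', fun i hi => ?_⟩
    rcases Finset.mem_insert.1 hi with rfl | hi
    · rw [hc]
      congr 1
      · ext k; simp [v', hren, t']
      · ext k; fin_cases k <;> simp [w', t']
    · rw [hv i hi, hw i hi, ht i hi]
      simp only [hren]

/-- A tree is built by adding one leaf after the other. -/
theorem isParametrized_univ (hG : G.IsTree) : IsParametrized G Finset.univ := by
  classical
  let conn : Finset (Fin ℓ) → Prop := fun S => ∀ x ∈ S, ∀ y ∈ S,
    Relation.ReflTransGen (fun a b => G.Adj a b ∧ a ∈ S ∧ b ∈ S) x y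
  have key : ∀ n, ∀ S : Finset (Fin ℓ), Sᶜ.card = n → S.Nonempty → conn S → IsParametrized G S →
      IsParametrized G Finset.univ := by
    intro n
    induction n with
    | zero =>
      intro S hn _ _ hS
      rw [Finset.card_eq_zero, Finset.compl_eq_empty_iff] at hn
      exact hn ▸ hS
    | succ n ih =>
      intro S hn hne hS hpar
      obtain ⟨x, hx⟩ := hne
      obtain ⟨p, hp, u, hu, hpu⟩ : ∃ p ∈ S, ∃ u ∉ S, G.Adj p u := by
        by_contra! hcon
        have := connected_induction hG.connected (c := x) (p := fun y => y ∈ S) hx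
          (fun a b ha hab => by_contra fun hb => hcon a ha b hb hab)
        have : S = Finset.univ := Finset.eq_univ_iff_forall.2 this
        simp [this] at hn
      have huniq : ∀ q ∈ S, G.Adj q u → q = p := by
        intro q hq hqu
        have hmem : q ∈ branch G p u := by
          have hpq := hS p hp q hq
          clear hq hqu
          induction hpq with
          | refl => exact self_mem_branch _ _
          | tail _ hab ih =>
            refine mem_branch_of_adj ih hab.1 fun h => ?_
            rcases Sym2.eq_iff.1 h with ⟨-, rfl⟩ | ⟨rfl, -⟩
            exacts [hu hab.2.2, hu hab.2.1]
        exact (eq_of_adj_of_notMem_branch hG hpu hmem (notMem_branch hG hpu) hqu).1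
      refine ih (insert u S) ?_ ⟨u, Finset.mem_insert_self _ _⟩ ?_ (hpar.insert hp hu hpu huniq)
      · rw [Finset.compl_insert, Finset.card_erase_of_mem (by simpa using hu), hn]; rfl
      · have mono : ∀ a ∈ S, ∀ b ∈ S, Relation.ReflTransGen
            (fun a b => G.Adj a b ∧ a ∈ insert u S ∧ b ∈ insert u S) a b := fun a ha b hb =>
          Relation.ReflTransGen.mono (show (fun a b => G.Adj a b ∧ a ∈ S ∧ b ∈ S) ≤
            (fun a b => G.Adj a b ∧ a ∈ insert u S ∧ b ∈ insert u S) from fun a b h => ⟨h.1,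
            Finset.mem_insert_of_mem h.2.1, Finset.mem_insert_of_mem h.2.2⟩) _ _ (hS a ha b hb)
        have hpu' : G.Adj p u ∧ p ∈ insert u S ∧ u ∈ insert u S :=
          ⟨hpu, Finset.mem_insert_of_mem hp, Finset.mem_insert_self _ _⟩
        have hup' : G.Adj u p ∧ u ∈ insert u S ∧ p ∈ insert u S := ⟨hpu.symm, hpu'.2.2, hpu'.2.1⟩
        intro a ha b hb
        rcases Finset.mem_insert.1 ha with rfl | ha' <;> rcases Finset.mem_insert.1 hb with rfl | hb'
        · exact .refl
        · exact .head hup' (mono p hp b hb')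
        · exact .tail (mono a ha' p hp) hpu'
        · exact mono a ha' b hb'
  obtain ⟨r⟩ := hG.connected.nonempty
  refine key _ {r} rfl ⟨r, Finset.mem_singleton_self r⟩ ?_ (.singleton r)
  intro a ha b hb
  rw [Finset.mem_singleton.1 ha, Finset.mem_singleton.1 hb]

theorem isIncident_of_forall_eval {P : Ideal (CoordRing ℓ)} (hP : incidenceIdeal G ≤ P)
    {x : Fin ℓ → Fin 6 → ℂ}
    (hx : ∀ f ∈ P, eval (fun ik : Fin ℓ × Fin 6 => x ik.1 ik.2) f = 0) : IsIncident G x := by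
  have key : ∀ i j, eval (fun ik : Fin ℓ × Fin 6 => x ik.1 ik.2)
      (pairing (lineVar i) (lineVar j)) = pairing (x i) (x j) := by
    intro i j
    rw [map_pairing]
    simp [lineVar]
  refine ⟨fun i => ?_, fun i j hij => ?_⟩
  · rw [← key]
    exact hx _ (hP (Ideal.subset_span (Or.inl ⟨i, rfl⟩)))
  · rw [← key]
    exact hx _ (hP (Ideal.subset_span (Or.inr ⟨i, j, hij, rfl⟩)))

/-- The incidence variety of a tree has only one irreducible component: its nonzero points are the
image of an affine space. -/
theorem forall_eval_eq_zero_iff_isIncident (hG : G.IsTree) {P : Ideal (CoordRing ℓ)}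
    (hP : IsComponent G P) {x : Fin ℓ → Fin 6 → ℂ} (hx0 : ∀ i, x i ≠ 0) :
    (∀ f ∈ P, eval (fun ik : Fin ℓ × Fin 6 => x ik.1 ik.2) f = 0) ↔ IsIncident G x := by
  refine ⟨isIncident_of_forall_eval hP.1.1.2, fun hx f hf => ?_⟩
  obtain ⟨σ, v, w, h1, h2⟩ := isParametrized_univ hG
  let Φ : CoordRing ℓ →ₐ[ℂ] MvPolynomial σ ℂ :=
    aeval fun ik : Fin ℓ × Fin 6 => plucker (v ik.1) (w ik.1) ik.2
  have hΦ : ∀ (t : σ → ℂ) f, eval t (Φ f) = eval (fun ik : Fin ℓ × Fin 6 =>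
      plucker (fun k => eval t (v ik.1 k)) (fun k => eval t (w ik.1 k)) ik.2) f := by
    intro t f
    have : (eval t).comp Φ.toRingHom = eval (fun ik : Fin ℓ × Fin 6 =>
        plucker (fun k => eval t (v ik.1 k)) (fun k => eval t (w ik.1 k)) ik.2) := by
      refine MvPolynomial.ringHom_ext (fun c => by simp [Φ]) fun ik => ?_
      simp [Φ, map_plucker]
    exact congrArg (fun φ => φ f) this
  have hvan : ∀ f, Φ f = 0 → ∀ y : Fin ℓ → Fin 6 → ℂ, (∀ i, y i ≠ 0) → IsIncident G y →
      eval (fun ik : Fin ℓ × Fin 6 => y ik.1 ik.2) f = 0 := by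
    intro f hf y hy0 hy
    obtain ⟨t, ht⟩ := h2 y hy0 hy
    have := hΦ t f
    rw [hf, map_zero] at this
    rw [this]
    congr 2
    ext ik
    rw [ht ik.1 (Finset.mem_univ _)]
  have hprime : (RingHom.ker Φ.toRingHom).IsPrime := RingHom.ker_isPrime _
  have hΦpair : ∀ i j, Φ (pairing (lineVar i) (lineVar j)) =
      pairing (plucker (v i) (w i)) (plucker (v j) (w j)) := by
    intro i j
    have := map_pairing Φ.toRingHom (lineVar i) (lineVar j)
    refine this.trans ?_
    congr 1 <;> ext k : 1 <;> simp [Φ, lineVar]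
  have hI : incidenceIdeal G ≤ RingHom.ker Φ.toRingHom := by
    refine Ideal.span_le.2 ?_
    rintro f (⟨i, rfl⟩ | ⟨i, j, hij, rfl⟩)
    · exact (hΦpair i i).trans (pairing_plucker_self _ _)
    · exact (hΦpair i j).trans (h1 i (Finset.mem_univ _) j (Finset.mem_univ _) hij)
  have hPprime : P.IsPrime := hP.1.1.1
  have hle : RingHom.ker Φ.toRingHom ≤ P := by
    intro g hg
    obtain ⟨y, hy0, hy⟩ := hP.2
    have hex : ∀ i, ∃ k, y i k ≠ 0 := fun i => Function.ne_iff.1 (hy0 i)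
    choose k hk using hex
    -- a product of coordinates that does not vanish identically on the component
    let m : CoordRing ℓ := ∏ i, X (i, k i)
    have hm : m ∉ P := fun hm => by
      have := hy m hm
      simp only [m, map_prod, eval_X] at this
      exact Finset.prod_ne_zero_iff.2 (fun i _ => hk i) this
    refine (hPprime.mem_or_mem (?_ : g * m ∈ P)).resolve_right hm
    rw [← MvPolynomial.IsPrime.vanishingIdeal_zeroLocus (K := ℂ) P, mem_vanishingIdeal_iff]
    intro z hz
    rw [map_mul]
    by_cases hmz : aeval z m = 0
    · rw [hmz, mul_zero]
    have hzP : ∀ f ∈ P, eval (fun ik : Fin ℓ × Fin 6 => (fun i k => z (i, k)) ik.1 ik.2) f = 0 :=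
      fun f hf => mem_zeroLocus_iff.1 hz f hf
    have h0 : eval z g = 0 := hvan g hg (fun i k => z (i, k)) (fun i hi => hmz ?_)
      (isIncident_of_forall_eval hP.1.1.2 hzP)
    · rw [show aeval z g = eval z g from rfl, h0, zero_mul]
    · simp only [m, map_prod, aeval_X]
      exact Finset.prod_eq_zero (Finset.mem_univ i) (congrFun hi (k i))
  exact hvan f (hP.1.2 ⟨hprime, hI⟩ hle hf) x hx0 hx

/-- The fiber of the Landau map of a tree, described by equations. -/
theorem mem_fiber_iff (hG : G.IsTree) {P : Ideal (CoordRing ℓ)} (hP : IsComponent G P)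
    {a : Fin d → Fin ℓ} {M : Fin d → Fin 6 → ℂ} {L : Fin ℓ → ℙ ℂ (Fin 6 → ℂ)} :
    L ∈ fiber P a M ↔ IsIncident G (fun i => (L i).rep) ∧
      ∀ j, pairing (M j) (L (a j)).rep = 0 := by
  rw [← forall_eval_eq_zero_iff_isIncident hG hP fun i => (L i).rep_nonzero]
  rfl

/-! ### Special external lines -/

section Special

/-- A Plücker vector is determined by its brackets with all lines. -/
theorem eq_of_forall_pairing_plucker {K : Type*} [Field K] {P Q : Fin 6 → K}
    (h : ∀ y z, pairing (plucker y z) P = pairing (plucker y z) Q) : P = Q := by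
  have h01 := h (Pi.single 0 1) (Pi.single 1 1)
  have h02 := h (Pi.single 0 1) (Pi.single 2 1)
  have h03 := h (Pi.single 0 1) (Pi.single 3 1)
  have h12 := h (Pi.single 1 1) (Pi.single 2 1)
  have h13 := h (Pi.single 1 1) (Pi.single 3 1)
  have h23 := h (Pi.single 2 1) (Pi.single 3 1)
  simp [pairing, plucker] at h01 h02 h03 h12 h13 h23
  ext i; fin_cases i <;> simp [*]

/-- A linear change of coordinates multiplies the pairing of lines by its determinant. -/
theorem pairing_plucker_mulVec {K : Type*} [Field K] (g : Matrix (Fin 4) (Fin 4) K)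
    (u v w x : Fin 4 → K) :
    pairing (plucker (g.mulVec u) (g.mulVec v)) (plucker (g.mulVec w) (g.mulVec x)) =
      g.det * pairing (plucker u v) (plucker w x) := by
  rw [pairing_plucker, pairing_plucker, ← Matrix.det_transpose g, mul_comm, ← Matrix.det_mul]
  congr 1
  ext i j
  fin_cases i <;> simp [Matrix.mul_apply, Matrix.mulVec, dotProduct, mul_comm]

/-- For every line `A` there are four lines whose only common transversal is `A` (a tangential
position), and a fifth line that does not meet `A`. -/
theorem exists_lines_forcing {A : Fin 6 → ℂ} (hA0 : A ≠ 0) (hA : pairing A A = 0) :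
    ∃ T : Fin 5 → Fin 6 → ℂ, (∀ L, pairing L L = 0 → (∀ i : Fin 4, pairing (T i.castSucc) L = 0) →
      ∃ t : ℂ, L = t • A) ∧ pairing (T 4) A ≠ 0 ∧ (∀ i, T i ≠ 0) ∧ ∀ i, pairing (T i) (T i) = 0 := by
  obtain ⟨v, w, rfl⟩ := exists_eq_plucker hA two_ne_zero
  obtain ⟨x, y, hxy⟩ : ∃ x y, pairing (plucker x y) (plucker v w) ≠ 0 := by
    by_contra! hcon
    refine hA0 (eq_of_forall_pairing_plucker fun y z => ?_)
    rw [hcon]; simp [pairing]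
  let g : Matrix (Fin 4) (Fin 4) ℂ := (Matrix.of ![v, w, x, y]).transpose
  have hdet : g.det ≠ 0 := by
    rw [Matrix.det_transpose, ← pairing_plucker, pairing_comm]; exact hxy
  have hunit : IsUnit g.det := isUnit_iff_ne_zero.2 hdet
  have hinv : ∀ a, ∃ b, a = g.mulVec b := fun a =>
    ⟨g⁻¹.mulVec a, by rw [Matrix.mulVec_mulVec, Matrix.mul_nonsing_inv _ hunit, Matrix.one_mulVec]⟩
  have hv : v = g.mulVec ![1, 0, 0, 0] := by
    ext i; simp [g, Matrix.mulVec, dotProduct, Fin.sum_univ_succ]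
  have hw : w = g.mulVec ![0, 1, 0, 0] := by
    ext i; simp [g, Matrix.mulVec, dotProduct, Fin.sum_univ_succ]
  let c : Fin 5 → (Fin 4 → ℂ) × (Fin 4 → ℂ) := ![(![1, 0, 0, 0], ![0, 1, 0, 0]),
    (![1, 0, 0, 0], ![0, 0, 0, 1]), (![0, 1, 0, 0], ![0, 0, 1, 0]),
    (![1, -1, 0, 0], ![0, 0, 1, 1]), (![0, 0, 1, 0], ![0, 0, 0, 1])]
  refine ⟨fun i => plucker (g.mulVec (c i).1) (g.mulVec (c i).2), fun L hL h => ?_, ?_,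
    fun i hi => ?_, fun i => pairing_plucker_self _ _⟩
  · obtain ⟨a', b', rfl⟩ := exists_eq_plucker hL two_ne_zero
    obtain ⟨a, rfl⟩ := hinv a'
    obtain ⟨b, rfl⟩ := hinv b'
    simp only [pairing_plucker_mulVec, mul_eq_zero, hdet, false_or] at h
    have h0 := h 0
    have h1 := h 1
    have h2 := h 2
    have h3 := h 3
    have hq := pairing_plucker_self a b
    obtain ⟨p, hp⟩ : ∃ p, p = plucker a b := ⟨_, rfl⟩
    rw [← hp] at h0 h1 h2 h3 hq
    simp [c, pairing, plucker] at h0 h1 h2 h3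
    have e14 : p 1 = p 4 := by linear_combination h3 - h1 + h2
    have e1 : p 1 = 0 := by
      have : p 1 * p 1 = 0 := by
        rw [pairing] at hq
        rw [h0, h1, h2, e14] at hq
        rw [e14]
        linear_combination -hq / 2
      simpa using this
    refine ⟨p 0, eq_of_forall_pairing_plucker fun y z => ?_⟩
    obtain ⟨y, rfl⟩ := hinv y
    obtain ⟨z, rfl⟩ := hinv z
    rw [hv, hw, pairing_smul, pairing_plucker_mulVec, pairing_plucker_mulVec, ← hp]
    simp only [pairing, h0, h1, h2, ← e14, e1]
    simp [plucker]
    ring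
  · change pairing (plucker _ _) (plucker v w) ≠ 0
    rw [hv, hw, pairing_plucker_mulVec]
    refine mul_ne_zero hdet ?_
    simp [c, pairing, plucker]
  · have hz : ∀ y z, pairing (plucker (c i).1 (c i).2) (plucker y z) = 0 := fun y z => by
      have := pairing_plucker_mulVec g (c i).1 (c i).2 y z
      rw [show plucker (g.mulVec (c i).1) (g.mulVec (c i).2) = 0 from hi,
        show pairing (0 : Fin 6 → ℂ) _ = 0 by simp [pairing]] at this
      exact (mul_eq_zero.1 this.symm).resolve_left hdet
    have h12 := hz ![1, 0, 0, 0] ![0, 1, 0, 0]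
    have h13 := hz ![1, 0, 0, 0] ![0, 0, 1, 0]
    have h14 := hz ![1, 0, 0, 0] ![0, 0, 0, 1]
    have h23 := hz ![0, 1, 0, 0] ![0, 0, 1, 0]
    have h34 := hz ![0, 0, 1, 0] ![0, 0, 0, 1]
    fin_cases i <;> simp [c, pairing, plucker] at h12 h13 h14 h23 h34

end Special

theorem exists_injective_of_le_card {α : Type*} {I : Finset α} {k : ℕ} (h : k ≤ I.card) :
    ∃ f : Fin k → α, Function.Injective f ∧ ∀ i, f i ∈ I :=
  ⟨fun i => (I.equivFin.symm (Fin.castLE h i)).1, fun i j hij => by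
    simpa using Subtype.ext hij, fun i => (I.equivFin.symm (Fin.castLE h i)).2⟩

/-! ### Bounds for the number of external lines of a branch -/

variable {ℓ d : ℕ} {G : SimpleGraph (Fin ℓ)} {a : Fin d → Fin ℓ}

/-- The lines `L i` for the vertices `i` in `S` satisfy all conditions that involve only these
vertices and the external lines `M`. -/
structure SolvesOn (G : SimpleGraph (Fin ℓ)) (a : Fin d → Fin ℓ) (M : Fin d → Fin 6 → ℂ)
    (S : Finset (Fin ℓ)) (L : Fin ℓ → Fin 6 → ℂ) : Prop where
  ne_zero : ∀ i ∈ S, L i ≠ 0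
  self : ∀ i ∈ S, pairing (L i) (L i) = 0
  adj : ∀ i ∈ S, ∀ j ∈ S, G.Adj i j → pairing (L i) (L j) = 0
  external : ∀ j, a j ∈ S → pairing (M j) (L (a j)) = 0

theorem SolvesOn.mono {M M' : Fin d → Fin 6 → ℂ} {S S' : Finset (Fin ℓ)} {L : Fin ℓ → Fin 6 → ℂ}
    (h : SolvesOn G a M S L) (hS : S' ⊆ S) (hM : ∀ j, a j ∈ S' → M' j = M j) :
    SolvesOn G a M' S' L :=
  ⟨fun i hi => h.ne_zero i (hS hi), fun i hi => h.self i (hS hi),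
    fun i hi j hj => h.adj i (hS hi) j (hS hj),
    fun j hj => by rw [hM j hj]; exact h.external j (hS hj)⟩

/-- The number of external lines attached at the vertex `i`, minus three. -/
def excess (a : Fin d → Fin ℓ) (i : Fin ℓ) : ℤ :=
  ((Finset.univ.filter fun j => a j = i).card : ℤ) - 3

/-- The external lines attached to the vertices in `S` can force the line at `c` to be any given
line if there are sufficiently many of them; if there are even more, they can be chosen such that
no configuration of lines meets all of them. -/
def Forces (G : SimpleGraph (Fin ℓ)) (a : Fin d → Fin ℓ) (S : Finset (Fin ℓ)) (c : Fin ℓ) : Prop :=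
  (1 ≤ ∑ x ∈ S, excess a x → ∀ A : Fin 6 → ℂ, A ≠ 0 → pairing A A = 0 →
    ∃ M, ∀ L, SolvesOn G a M S L → ∃ t : ℂ, L c = t • A) ∧
  (2 ≤ ∑ x ∈ S, excess a x → ∃ M, ∀ L, ¬SolvesOn G a M S L)

/-- The induction step: the external lines at `c`, and the lines that are forced by the branches at
some neighbours of `c`, can be chosen independently. -/
theorem forces_insert_biUnion (hG : G.IsTree) {c : Fin ℓ} {N : Finset (Fin ℓ)}
    (hN : ∀ c' ∈ N, G.Adj c' c) (h : ∀ c' ∈ N, Forces G a (branch G c' c) c') :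
    Forces G a (insert c (N.biUnion fun c' => branch G c' c)) c := by
  set S := insert c (N.biUnion fun c' => branch G c' c) with hS
  have hsub : ∀ c' ∈ N, branch G c' c ⊆ S := fun c' hc' =>
    (Finset.subset_biUnion_of_mem (fun c' => branch G c' c) hc').trans (Finset.subset_insert _ _)
  by_cases hbig : ∃ c' ∈ N, 2 ≤ ∑ x ∈ branch G c' c, excess a x
  · obtain ⟨c', hc', h2⟩ := hbig
    obtain ⟨M, hM⟩ := (h c' hc').2 h2
    have hno : ∀ L, ¬SolvesOn G a M S L := fun L hL => hM L (hL.mono (hsub c' hc') fun _ _ => rfl)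
    exact ⟨fun _ A _ _ => ⟨M, fun L hL => absurd hL (hno L)⟩, fun _ => ⟨M, hno⟩⟩
  push Not at hbig
  -- the lines that `L c` has to meet
  let I : Finset (Fin d ⊕ Fin ℓ) := (Finset.univ.filter fun j => a j = c).disjSum
    (N.filter fun c' => 1 ≤ ∑ x ∈ branch G c' c, excess a x)
  have hI : ∑ x ∈ S, excess a x + 3 ≤ I.card := by
    rw [hS, sum_insert_biUnion_branch hG hN, Finset.card_disjSum, excess]
    have : ∑ c' ∈ N, ∑ x ∈ branch G c' c, excess a x ≤
        ∑ c' ∈ N, if 1 ≤ ∑ x ∈ branch G c' c, excess a x then 1 else 0 := by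
      refine Finset.sum_le_sum fun c' hc' => ?_
      have := hbig c' hc'
      split_ifs <;> omega
    rw [Finset.sum_boole] at this
    push_cast
    linarith
  -- arbitrary nonzero isotropic vectors can be prescribed for these lines
  have key : ∀ T : Fin d ⊕ Fin ℓ → Fin 6 → ℂ, (∀ i, T i ≠ 0) → (∀ i, pairing (T i) (T i) = 0) →
      ∃ M, ∀ L, SolvesOn G a M S L → L c ≠ 0 ∧ pairing (L c) (L c) = 0 ∧
        ∀ i ∈ I, pairing (T i) (L c) = 0 := by
    intro T hT0 hT
    have hex : ∀ c', ∃ M, c' ∈ N → 1 ≤ ∑ x ∈ branch G c' c, excess a x →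
        ∀ L, SolvesOn G a M (branch G c' c) L → ∃ t : ℂ, L c' = t • T (Sum.inr c') := by
      intro c'
      by_cases hc' : c' ∈ N ∧ 1 ≤ ∑ x ∈ branch G c' c, excess a x
      · obtain ⟨M, hM⟩ := (h c' hc'.1).1 hc'.2 (T (Sum.inr c')) (hT0 _) (hT _)
        exact ⟨M, fun _ _ => hM⟩
      · exact ⟨0, fun h1 h2 => absurd ⟨h1, h2⟩ hc'⟩
    choose Mf hMf using hex
    have hnb : ∀ x, ∃ c', ∀ c'' ∈ N, x ∈ branch G c'' c → c' = c'' := by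
      intro x
      by_cases hx : ∃ c' ∈ N, x ∈ branch G c' c
      · obtain ⟨c', hc', hx⟩ := hx
        refine ⟨c', fun c'' hc'' hx' => ?_⟩
        by_contra hne
        exact Finset.disjoint_left.1 (disjoint_branch hG (hN c' hc') (hN c'' hc'') hne) hx hx'
      · exact ⟨c, fun c'' hc'' hx' => absurd ⟨c'', hc'', hx'⟩ hx⟩
    choose nb hnb using hnb
    refine ⟨fun j => if a j = c then T (Sum.inl j) else Mf (nb (a j)) j, fun L hL => ?_⟩
    have hc : c ∈ S := Finset.mem_insert_self _ _
    refine ⟨hL.ne_zero c hc, hL.self c hc, fun i hi => ?_⟩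
    rcases i with j | c'
    · have hj : a j = c := by simpa [I] using hi
      have := hL.external j (hj ▸ hc)
      rwa [if_pos hj, hj] at this
    · obtain ⟨hc', h1⟩ : c' ∈ N ∧ 1 ≤ ∑ x ∈ branch G c' c, excess a x := by simpa [I] using hi
      have hself := hsub c' hc' (self_mem_branch c' c)
      obtain ⟨t, ht⟩ := hMf c' hc' h1 L (hL.mono (hsub c' hc') fun j hj => by
        rw [if_neg, hnb _ c' hc' hj]
        exact fun hjc => notMem_branch hG (hN c' hc') (hjc ▸ hj))
      have hmeet := hL.adj c' hself c hc (hN c' hc')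
      rw [ht, smul_pairing, mul_eq_zero] at hmeet
      refine hmeet.resolve_left ?_
      rintro rfl
      exact hL.ne_zero c' hself (by rw [ht, zero_smul])
  refine ⟨fun h1 A hA0 hA => ?_, fun h2 => ?_⟩
  · obtain ⟨t, ht, -, ht0, htt⟩ := exists_lines_forcing hA0 hA
    obtain ⟨f, hf, hfI⟩ := exists_injective_of_le_card (I := I) (k := 4) (by omega)
    obtain ⟨M, hM⟩ := key (Function.extend f (fun k => t k.castSucc) fun _ => A)
      (fun i => by
        by_cases hi : ∃ k, f k = i
        · obtain ⟨k, rfl⟩ := hi; rw [hf.extend_apply]; exact ht0 _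
        · rwa [Function.extend_apply' _ _ _ hi])
      (fun i => by
        by_cases hi : ∃ k, f k = i
        · obtain ⟨k, rfl⟩ := hi; rw [hf.extend_apply]; exact htt _
        · rwa [Function.extend_apply' _ _ _ hi])
    refine ⟨M, fun L hL => ht _ (hM L hL).2.1 fun k => ?_⟩
    have := (hM L hL).2.2 (f k) (hfI k)
    rwa [hf.extend_apply] at this
  · have hA0 : plucker ![(1 : ℂ), 0, 0, 0] ![0, 1, 0, 0] ≠ 0 := fun h0 => by
      have := congrFun h0 0
      simp [plucker] at this
    obtain ⟨t, ht, h4, ht0, htt⟩ := exists_lines_forcing hA0 (pairing_plucker_self _ _)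
    obtain ⟨f, hf, hfI⟩ := exists_injective_of_le_card (I := I) (k := 5) (by omega)
    obtain ⟨M, hM⟩ := key (Function.extend f t fun _ => t 0)
      (fun i => by
        by_cases hi : ∃ k, f k = i
        · obtain ⟨k, rfl⟩ := hi; rw [hf.extend_apply]; exact ht0 _
        · rw [Function.extend_apply' _ _ _ hi]; exact ht0 _)
      (fun i => by
        by_cases hi : ∃ k, f k = i
        · obtain ⟨k, rfl⟩ := hi; rw [hf.extend_apply]; exact htt _
        · rw [Function.extend_apply' _ _ _ hi]; exact htt _)
    refine ⟨M, fun L hL => ?_⟩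
    obtain ⟨hc0, hcc, hall⟩ := hM L hL
    have hall' : ∀ k, pairing (t k) (L c) = 0 := fun k => by
      have := hall (f k) (hfI k)
      rwa [hf.extend_apply] at this
    obtain ⟨r, hr⟩ := ht _ hcc fun k => hall' _
    have := hall' 4
    rw [hr, pairing_smul, mul_eq_zero] at this
    rcases this with h0 | h0
    · exact hc0 (by rw [hr, h0, zero_smul])
    · exact h4 h0

theorem forces_branch (hG : G.IsTree) {c v : Fin ℓ} (h : G.Adj c v) :
    Forces G a (branch G c v) c := by
  induction hn : (branch G c v).card using Nat.strong_induction_on generalizing c v with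
  | _ n ih =>
    rw [branch_eq_insert_biUnion hG h]
    refine forces_insert_biUnion hG (fun c' hc' => by simp at hc'; exact hc'.1) fun c' hc' => ?_
    simp only [Finset.mem_filter, Finset.mem_univ, true_and] at hc'
    exact ih _ (hn ▸ card_branch_lt hG h hc'.1 hc'.2) hc'.1 rfl

theorem forces_univ (hG : G.IsTree) (c : Fin ℓ) : Forces G a Finset.univ c := by
  rw [univ_eq_insert_biUnion hG c]
  refine forces_insert_biUnion hG (fun c' hc' => by simpa using hc') fun c' hc' => ?_
  exact forces_branch hG (by simpa using hc')

/-! ### Closedness of conditions on configurations -/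

/-- Configurations of vectors in `ℂ⁶` of norm one. -/
abbrev UnitConfig (ℓ : ℕ) : Type := Fin ℓ → Metric.sphere (0 : Fin 6 → ℂ) 1

/-- By compactness, a closed condition on external data and normalized configurations holds for
some configuration only on a closed set of external data. -/
theorem isClosed_exists_unitConfig {X : Type*} [TopologicalSpace X]
    {C : Set (X × UnitConfig ℓ)} (hC : IsClosed C) : IsClosed {M | ∃ L, (M, L) ∈ C} := by
  have := isClosedMap_fst_of_compactSpace (X := X) (Y := UnitConfig ℓ) C hC
  convert this using 1
  ext M
  simp

theorem continuous_pairing {X : Type*} [TopologicalSpace X] {f g : X → Fin 6 → ℂ}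
    (hf : Continuous f) (hg : Continuous g) : Continuous fun x => pairing (f x) (g x) := by
  simp only [pairing]
  fun_prop

/-- A nonempty open set of external data is not contained in a hypersurface. -/
theorem exists_eval_ne_zero_of_isOpen {F : MvPolynomial (Fin d × Fin 6) ℂ} (hF : F ≠ 0)
    {U : Set (Fin d → Fin 6 → ℂ)} (hU : IsOpen U) (hne : U.Nonempty) :
    ∃ M ∈ U, eval (fun jk : Fin d × Fin 6 => M jk.1 jk.2) F ≠ 0 := by
  obtain ⟨M, hM⟩ := hne
  by_contra! hcon
  let φ : (Fin d × Fin 6 → ℂ) → Fin d → Fin 6 → ℂ := fun x j k => x (j, k)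
  have hφ : Continuous φ := by fun_prop
  have hmem : φ⁻¹' U ∈ nhds fun jk : Fin d × Fin 6 => M jk.1 jk.2 :=
    (hU.preimage hφ).mem_nhds hM
  obtain ⟨ε, hε, hball⟩ := Metric.mem_nhds_iff.1 hmem
  refine hF (MvPolynomial.funext_set (fun jk => Metric.ball (M jk.1 jk.2) ε) ?_ ?_)
  · intro jk
    exact infinite_of_mem_nhds _ (Metric.ball_mem_nhds _ hε)
  · intro x hx
    rw [map_zero]
    refine hcon (φ x) (hball ?_)
    rw [ball_pi _ hε]
    exact hx

/-- A nonzero vector is proportional to a vector of norm one. -/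
theorem exists_smul_mem_sphere {x : Fin 6 → ℂ} (hx : x ≠ 0) :
    ∃ c : ℂ, c ≠ 0 ∧ c • x ∈ Metric.sphere (0 : Fin 6 → ℂ) 1 := by
  refine ⟨((‖x‖⁻¹ : ℝ) : ℂ), ?_, ?_⟩
  · simpa using hx
  · simp [norm_smul, hx]

/-- If the generic fiber is nonempty, then so is every fiber. -/
theorem exists_solvesOn_univ (hG : G.IsTree) {P : Ideal (CoordRing ℓ)} (hP : IsComponent G P)
    (h : lsDegree P a ≠ 0) (M : Fin d → Fin 6 → ℂ) : ∃ L, SolvesOn G a M Finset.univ L := by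
  let C : Set ((Fin d → Fin 6 → ℂ) × UnitConfig ℓ) := {ML |
    (∀ i, pairing (ML.2 i).1 (ML.2 i).1 = 0) ∧ (∀ i j, G.Adj i j →
      pairing (ML.2 i).1 (ML.2 j).1 = 0) ∧ ∀ j, pairing (ML.1 j) (ML.2 (a j)).1 = 0}
  have hC : IsClosed C := by
    simp only [C, Set.ofPred_and, Set.ofPred_forall]
    refine (isClosed_iInter fun i => isClosed_eq (continuous_pairing (by fun_prop) (by fun_prop))
      continuous_const).inter ((isClosed_iInter fun i => isClosed_iInter fun j =>
      isClosed_iInter fun _ => isClosed_eq (continuous_pairing (by fun_prop) (by fun_prop))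
      continuous_const).inter (isClosed_iInter fun j => isClosed_eq
      (continuous_pairing (by fun_prop) (by fun_prop)) continuous_const))
  have hmem : M ∈ {M | ∃ L, (M, L) ∈ C} := by
    by_contra hM
    obtain ⟨F, hF, hFn⟩ := exists_generic_fiber_encard P a h
    obtain ⟨M', hM', hFM⟩ := exists_eval_ne_zero_of_isOpen hF
      (isClosed_exists_unitConfig hC).isOpen_compl ⟨M, hM⟩
    have hne : (fiber P a M').Nonempty := by
      rw [← Set.encard_ne_zero, hFn M' hFM]
      exact_mod_cast h
    obtain ⟨L, hL⟩ := hne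
    rw [mem_fiber_iff hG hP] at hL
    have hex := fun i => exists_smul_mem_sphere (L i).rep_nonzero
    choose c hc0 hc using hex
    refine hM' ⟨fun i => ⟨c i • (L i).rep, hc i⟩, ?_, ?_, ?_⟩
    · intro i
      simp [smul_pairing, pairing_smul, hL.1.self i]
    · intro i j hij
      simp [smul_pairing, pairing_smul, hL.1.adj i j hij]
    · intro j
      simp [pairing_smul, hL.2 j]
  obtain ⟨L, h1, h2, h3⟩ := hmem
  refine ⟨fun i => (L i).1, fun i _ => ?_, fun i _ => h1 i, fun i _ j _ => h2 i j, fun j _ => h3 j⟩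
  intro h0
  have := (L i).2
  rw [h0] at this
  simp at this

/-- Otherwise some choice of external lines would leave no configuration of lines at all, although
every fiber is nonempty. -/
theorem sum_excess_branch_le_one (hG : G.IsTree) {P : Ideal (CoordRing ℓ)} (hP : IsComponent G P)
    (h : lsDegree P a ≠ 0) {c v : Fin ℓ} (hcv : G.Adj c v) :
    ∑ x ∈ branch G c v, excess a x ≤ 1 := by
  by_contra! hcon
  obtain ⟨M, hM⟩ := (forces_branch (a := a) hG hcv).2 (by omega)
  obtain ⟨L, hL⟩ := exists_solvesOn_univ hG hP h M
  exact hM L (hL.mono (Finset.subset_univ _) fun _ _ => rfl)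

theorem sum_excess_le_one (hG : G.IsTree) {P : Ideal (CoordRing ℓ)} (hP : IsComponent G P)
    (h : lsDegree P a ≠ 0) : ∑ x, excess a x ≤ 1 := by
  by_contra! hcon
  obtain ⟨c⟩ := hG.connected.nonempty
  obtain ⟨M, hM⟩ := (forces_univ (a := a) hG c).2 (by omega)
  obtain ⟨L, hL⟩ := exists_solvesOn_univ hG hP h M
  exact hM L hL

/-! ### The number of external lines -/

/-- All maximal ideals of a polynomial ring over `ℂ` have the same height, by translation. -/
theorem height_vanishingIdeal_singleton {σ : Type*} [Finite σ] (x : σ → ℂ) :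
    ((vanishingIdeal ℂ {x}).height : WithBot ℕ∞) = Nat.card σ := by
  have hdim : ringKrullDim (MvPolynomial σ ℂ) = (Nat.card σ : WithBot ℕ∞) := by
    rw [MvPolynomial.ringKrullDim_of_isNoetherianRing, ringKrullDim_eq_zero_of_field, zero_add]
  have : FiniteRingKrullDim (MvPolynomial σ ℂ) := by
    rw [finiteRingKrullDim_iff_ne_bot_and_top, hdim]
    exact ⟨WithBot.coe_ne_bot, fun h => by
      exact ENat.natCast_ne_top _ (WithBot.coe_injective (h : ((Nat.card σ : ℕ∞) : WithBot ℕ∞) = _))⟩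
  obtain ⟨m, hm, hmh⟩ := Ideal.exists_isMaximal_height (R := MvPolynomial σ ℂ)
  obtain ⟨y, rfl⟩ := isMaximal_iff_eq_vanishingIdeal_singleton.1 hm
  let τ : (σ → ℂ) → MvPolynomial σ ℂ →ₐ[ℂ] MvPolynomial σ ℂ := fun c => aeval fun i => X i + C (c i)
  have hτ : ∀ c, (τ c).comp (τ (-c)) = AlgHom.id ℂ _ := fun c => by
    ext i; simp [τ]
  have hτ' : ∀ c, (τ (-c)).comp (τ c) = AlgHom.id ℂ _ := fun c => by
    have := hτ (-c); rwa [neg_neg] at this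
  let e := AlgEquiv.ofAlgHom (τ (y - x)) (τ (-(y - x))) (hτ _) (hτ' _)
  have he : (vanishingIdeal ℂ {x}).comap e.toRingEquiv = vanishingIdeal ℂ {y} := by
    ext f
    rw [Ideal.mem_comap, mem_vanishingIdeal_singleton_iff, mem_vanishingIdeal_singleton_iff]
    have : (aeval x : MvPolynomial σ ℂ →ₐ[ℂ] ℂ).comp (τ (y - x)) = aeval y := by
      ext i; simp [τ]
    rw [← this]
    rfl
  rw [← hdim, ← hmh, ← he, RingEquiv.height_comap]

/-- A system of polynomial equations over `ℂ` with finitely many solutions, and at least one, has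
at least as many equations as unknowns. -/
theorem card_le_card_of_finite_zeros {σ : Type*} [Finite σ] (s : Finset (MvPolynomial σ ℂ))
    {x : σ → ℂ} (hx : ∀ f ∈ s, eval x f = 0) (hfin : {y | ∀ f ∈ s, eval y f = 0}.Finite) :
    Nat.card σ ≤ s.card := by
  have hle : Ideal.span (s : Set (MvPolynomial σ ℂ)) ≤ vanishingIdeal ℂ {x} :=
    Ideal.span_le.2 fun f hf => by
      rw [SetLike.mem_coe, mem_vanishingIdeal_singleton_iff]; exact hx f hf
  have hmax : (vanishingIdeal ℂ {x}).IsMaximal :=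
    isMaximal_iff_eq_vanishingIdeal_singleton.2 ⟨x, rfl⟩
  have hprime := hmax.isPrime
  obtain ⟨Q, hQ, hQx⟩ := Ideal.exists_minimalPrimes_le hle
  have hQprime : Q.IsPrime := hQ.1.1
  have hZ : (zeroLocus ℂ Q).Finite := hfin.subset fun y hy f hf =>
    mem_zeroLocus_iff.1 hy f (hQ.1.2 (Ideal.subset_span hf))
  have hQeq : Q = vanishingIdeal ℂ {x} := by
    refine le_antisymm hQx fun f hf => ?_
    -- multiply `f` with a polynomial that separates `x` from the other zeros of `Q`
    have hsep : ∀ y : σ → ℂ, y ≠ x → ∃ g : MvPolynomial σ ℂ, eval y g = 0 ∧ eval x g ≠ 0 := by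
      intro y hy
      obtain ⟨i, hi⟩ := Function.ne_iff.1 hy
      exact ⟨X i - C (y i), by simp, by simpa [sub_eq_zero] using hi.symm⟩
    choose! g hg hgx using hsep
    classical
    let m := ∏ y ∈ hZ.toFinset.erase x, g y
    have hm : m ∉ Q := fun hm => by
      have := hQx hm
      rw [mem_vanishingIdeal_singleton_iff] at this
      change eval x m = 0 at this
      rw [map_prod] at this
      exact Finset.prod_ne_zero_iff.2 (fun y hy => hgx y (Finset.ne_of_mem_erase hy)) this
    refine (hQprime.mem_or_mem (?_ : f * m ∈ Q)).resolve_right hm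
    rw [← MvPolynomial.IsPrime.vanishingIdeal_zeroLocus (K := ℂ) Q, mem_vanishingIdeal_iff]
    intro y hy
    change eval y (f * m) = 0
    rw [map_mul]
    by_cases hyx : y = x
    · rw [mem_vanishingIdeal_singleton_iff] at hf
      rw [hyx, show eval x f = 0 from hf, zero_mul]
    · rw [map_prod, Finset.prod_eq_zero (i := y) _ (hg y hyx), mul_zero]
      rw [Finset.mem_erase, hZ.mem_toFinset]
      exact ⟨hyx, hy⟩
  have hh := Ideal.height_le_card_of_mem_minimalPrimes_span_finset (hQeq ▸ hQ)
  have h1 := height_vanishingIdeal_singleton x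
  have h2 : ((vanishingIdeal ℂ {x}).height : WithBot ℕ∞) ≤ ((s.card : ℕ∞) : WithBot ℕ∞) :=
    WithBot.coe_le_coe.2 hh
  rw [h1] at h2
  exact_mod_cast h2

variable {ℓ d : ℕ} {G : SimpleGraph (Fin ℓ)} {a : Fin d → Fin ℓ}

/-- Since generic fibers are finite and not empty, there are at least `3 ℓ + 1` external lines. -/
theorem three_mul_add_one_le (hG : G.IsTree) {P : Ideal (CoordRing ℓ)} (hP : IsComponent G P)
    (h : lsDegree P a ≠ 0) : 3 * ℓ + 1 ≤ d := by
  classical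
  obtain ⟨F, hF, hFn⟩ := exists_generic_fiber_encard P a h
  obtain ⟨M, -, hM⟩ := exists_eval_ne_zero_of_isOpen hF isOpen_univ ⟨0, trivial⟩
  have hcard := hFn M hM
  have hfinite : (fiber P a M).Finite := Set.finite_of_encard_eq_coe hcard
  obtain ⟨L, hL⟩ : (fiber P a M).Nonempty := by
    rw [← Set.encard_ne_zero, hcard]; exact_mod_cast h
  have hL' := (mem_fiber_iff hG hP).1 hL
  have hk : ∀ i, ∃ k, (L i).rep k ≠ 0 := fun i => Function.ne_iff.1 (L i).rep_nonzero
  choose k hk using hk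
  -- the equations of the fiber, in an affine chart
  let s₁ : Finset (CoordRing ℓ) := Finset.univ.image fun i => pairing (lineVar i) (lineVar i)
  let s₂ : Finset (CoordRing ℓ) := G.edgeFinset.image fun e =>
    pairing (lineVar e.out.1) (lineVar e.out.2)
  let s₃ : Finset (CoordRing ℓ) := Finset.univ.image fun j =>
    pairing (fun k => C (M j k)) (lineVar (a j))
  let s₄ : Finset (CoordRing ℓ) := Finset.univ.image fun i => X (i, k i) - 1
  have hev : ∀ (y : Fin ℓ × Fin 6 → ℂ) i j, eval y (pairing (lineVar i) (lineVar j)) =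
      pairing (fun k => y (i, k)) fun k => y (j, k) := by
    intro y i j
    rw [map_pairing]; simp [lineVar]
  have hzero : ∀ y : Fin ℓ × Fin 6 → ℂ, (∀ f ∈ s₁ ∪ s₂ ∪ s₃ ∪ s₄, eval y f = 0) ↔
      IsIncident G (fun i k => y (i, k)) ∧ (∀ j, pairing (M j) (fun k => y (a j, k)) = 0) ∧
        ∀ i, y (i, k i) = 1 := by
    intro y
    have h3 : ∀ j, eval y (pairing (fun k => C (M j k)) (lineVar (a j))) =
        pairing (M j) fun k => y (a j, k) := fun j => by
      rw [map_pairing]; simp [lineVar]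
    have h2 : (∀ e ∈ G.edgeFinset, pairing (fun k => y (e.out.1, k)) (fun k => y (e.out.2, k)) = 0)
        ↔ ∀ i j, G.Adj i j → pairing (fun k => y (i, k)) (fun k => y (j, k)) = 0 := by
      constructor
      · intro he i j hij
        have := he s(i, j) (by simpa using hij)
        have hout : s((s(i, j)).out.1, (s(i, j)).out.2) = s(i, j) := Quot.out_eq _
        rcases Sym2.eq_iff.1 hout with ⟨h1, h2⟩ | ⟨h1, h2⟩
        · rwa [h1, h2] at this
        · rwa [h1, h2, pairing_comm] at this
      · intro he e hmem
        refine he _ _ ?_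
        have hout : s(e.out.1, e.out.2) = e := Quot.out_eq _
        rw [← SimpleGraph.mem_edgeSet, hout]
        simpa using hmem
    simp only [s₁, s₂, s₃, s₄, Finset.forall_mem_union, Finset.forall_mem_image, Finset.mem_univ,
      forall_true_left, hev, h3, map_sub, eval_X, map_one, sub_eq_zero, h2]
    exact ⟨fun h => ⟨⟨h.1.1.1, h.1.1.2⟩, h.1.2, h.2⟩,
      fun h => ⟨⟨⟨h.1.self, h.1.adj⟩, h.2.1⟩, h.2.2⟩⟩
  have hne : ∀ y ∈ {y : Fin ℓ × Fin 6 → ℂ | ∀ f ∈ s₁ ∪ s₂ ∪ s₃ ∪ s₄, eval y f = 0}, ∀ i,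
      (fun k => y (i, k)) ≠ 0 := by
    intro y hy i hi
    have := ((hzero y).1 hy).2.2 i
    rw [show y (i, k i) = 0 from congrFun hi (k i)] at this
    exact zero_ne_one this
  have hfin : {y : Fin ℓ × Fin 6 → ℂ | ∀ f ∈ s₁ ∪ s₂ ∪ s₃ ∪ s₄, eval y f = 0}.Finite := by
    let φ : (Fin ℓ × Fin 6 → ℂ) → Fin ℓ → ℙ ℂ (Fin 6 → ℂ) := fun y i =>
      if hy : (fun k => y (i, k)) ≠ 0 then Projectivization.mk ℂ _ hy else L i
    have hφ : ∀ y ∈ {y : Fin ℓ × Fin 6 → ℂ | ∀ f ∈ s₁ ∪ s₂ ∪ s₃ ∪ s₄, eval y f = 0}, ∀ i,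
        ∃ c : ℂ, c ≠ 0 ∧ (φ y i).rep = c • fun k => y (i, k) := by
      intro y hy i
      obtain ⟨c, hc⟩ := Projectivization.exists_smul_eq_mk_rep ℂ _ (hne y hy i)
      refine ⟨c, c.ne_zero, ?_⟩
      simp only [φ, dif_pos (hne y hy i)]
      exact hc.symm
    refine Set.Finite.of_finite_image (f := φ) (hfinite.subset ?_) ?_
    · rintro _ ⟨y, hy, rfl⟩
      rw [mem_fiber_iff hG hP]
      obtain ⟨h1, h2, h3⟩ := (hzero y).1 hy
      choose c hc0 hc using hφ y hy
      refine ⟨⟨fun i => ?_, fun i j hij => ?_⟩, fun j => ?_⟩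
      · rw [hc, smul_pairing, pairing_smul, h1.self i]; simp
      · rw [hc, hc, smul_pairing, pairing_smul, h1.adj i j hij]; simp
      · rw [hc, pairing_smul, h2 j]; simp
    · intro y hy z hz hyz
      obtain ⟨-, -, hy1⟩ := (hzero y).1 hy
      obtain ⟨-, -, hz1⟩ := (hzero z).1 hz
      ext ⟨i, k'⟩
      have := congrFun hyz i
      simp only [φ, dif_pos (hne y hy i), dif_pos (hne z hz i)] at this
      obtain ⟨c, hc⟩ := (Projectivization.mk_eq_mk_iff' ℂ _ _ _ _).1 this
      have hc1 := congrFun hc (k i)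
      simp only [Pi.smul_apply, smul_eq_mul, hy1 i, hz1 i, mul_one] at hc1
      have := congrFun hc k'
      simpa [hc1] using this.symm
  have hx := (hzero fun ik => ((L ik.1).rep (k ik.1))⁻¹ * (L ik.1).rep ik.2).2 ⟨⟨fun i => ?_,
    fun i j hij => ?_⟩, fun j => ?_, fun i => inv_mul_cancel₀ (hk i)⟩
  · have hle := card_le_card_of_finite_zeros _ hx hfin
    have hedge := hG.card_edgeFinset
    have c1 : s₁.card ≤ ℓ := Finset.card_image_le.trans (by simp)
    have c2 : s₂.card ≤ G.edgeFinset.card := Finset.card_image_le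
    have c3 : s₃.card ≤ d := Finset.card_image_le.trans (by simp)
    have c4 : s₄.card ≤ ℓ := Finset.card_image_le.trans (by simp)
    have u1 := Finset.card_union_le (s₁ ∪ s₂ ∪ s₃) s₄
    have u2 := Finset.card_union_le (s₁ ∪ s₂) s₃
    have u3 := Finset.card_union_le s₁ s₂
    simp only [Nat.card_eq_fintype_card, Fintype.card_prod, Fintype.card_fin] at hle hedge
    omega
  · have := hL'.1.self i
    change pairing (((L i).rep (k i))⁻¹ • (L i).rep) (((L i).rep (k i))⁻¹ • (L i).rep) = 0
    rw [smul_pairing, pairing_smul, this]; simp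
  · have := hL'.1.adj i j hij
    change pairing (((L i).rep (k i))⁻¹ • (L i).rep) (((L j).rep (k j))⁻¹ • (L j).rep) = 0
    rw [smul_pairing, pairing_smul, this]; simp
  · have := hL'.2 j
    change pairing (M j) (((L (a j)).rep (k (a j)))⁻¹ • (L (a j)).rep) = 0
    rw [pairing_smul, this]; simp

theorem sum_excess : ∑ x, excess a x = d - 3 * ℓ := by
  have : ∑ x : Fin ℓ, (Finset.univ.filter fun j => a j = x).card = d := by
    have := Finset.card_eq_sum_card_fiberwise (f := a) (s := Finset.univ) (t := Finset.univ)
      (fun _ _ => Finset.mem_coe.2 (Finset.mem_univ _))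
    rw [← this]; simp
  simp only [excess, Finset.sum_sub_distrib, Finset.sum_const, Finset.card_univ, Fintype.card_fin]
  have h2 : ((∑ x : Fin ℓ, (Finset.univ.filter fun j => a j = x).card : ℕ) : ℤ) = d := by
    rw [this]
  push_cast at h2
  rw [h2]
  simp
  ring

/-- The number of external lines is exactly `3 ℓ + 1`. -/
theorem sum_excess_eq_one (hG : G.IsTree) {P : Ideal (CoordRing ℓ)} (hP : IsComponent G P)
    (h : lsDegree P a ≠ 0) : ∑ x, excess a x = 1 := by
  refine le_antisymm (sum_excess_le_one hG hP h) ?_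
  rw [sum_excess]
  have := three_mul_add_one_le hG hP h
  omega

/-- The line at `c` is determined, up to finitely many choices, by the external lines in the branch
at `c` seen from its neighbour `v`: in this branch there are three external lines for each vertex
and one more. -/
def Determines (G : SimpleGraph (Fin ℓ)) (a : Fin d → Fin ℓ) (c v : Fin ℓ) : Prop :=
  G.Adj c v ∧ ∑ x ∈ branch G c v, excess a x = 1

section Orientation

variable (hG : G.IsTree) {P : Ideal (CoordRing ℓ)} (hP : IsComponent G P) (h : lsDegree P a ≠ 0)
include hG hP h

/-- The excess of a branch is at most one, and so is the excess of the opposite branch; as they sum to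
one, both are nonnegative. -/
theorem sum_excess_branch_eq (c v : Fin ℓ) [Decidable (Determines G a c v)] (hcv : G.Adj c v) :
    ∑ x ∈ branch G c v, excess a x = if Determines G a c v then 1 else 0 := by
  have h1 := sum_excess_branch_le_one hG hP h hcv
  have h2 := sum_excess_branch_le_one hG hP h hcv.symm
  have h3 := sum_branch_add_sum_branch hG hcv (excess a)
  rw [sum_excess_eq_one hG hP h] at h3
  by_cases hd : ∑ x ∈ branch G c v, excess a x = 1
  · rw [if_pos ⟨hcv, hd⟩, hd]
  · rw [if_neg fun h => hd h.2]; omega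

/-- Every edge of the tree is directed in exactly one way. -/
theorem determines_swap_iff {c v : Fin ℓ} (hcv : G.Adj c v) :
    Determines G a v c ↔ ¬Determines G a c v := by
  classical
  have h3 := sum_branch_add_sum_branch hG hcv (excess a)
  rw [sum_excess_eq_one hG hP h, sum_excess_branch_eq hG hP h c v hcv,
    sum_excess_branch_eq hG hP h v c hcv.symm] at h3
  by_cases h4 : Determines G a c v <;> by_cases h5 : Determines G a v c <;> simp [h4, h5] at h3 ⊢

end Orientation

/-- The external lines at `v` and the neighbours that determine `L v`. -/
def inputs (G : SimpleGraph (Fin ℓ)) (a : Fin d → Fin ℓ) (v : Fin ℓ) : Finset (Fin d ⊕ Fin ℓ) := by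
  classical
  exact (Finset.univ.filter fun j => a j = v).disjSum (Finset.univ.filter fun c => Determines G a c v)

theorem inl_mem_inputs {v : Fin ℓ} {j : Fin d} : Sum.inl j ∈ inputs G a v ↔ a j = v := by
  simp [inputs]

theorem inr_mem_inputs {v c : Fin ℓ} : Sum.inr c ∈ inputs G a v ↔ Determines G a c v := by
  simp [inputs]

/-- Every vertex has exactly four inputs. -/
theorem card_inputs (hG : G.IsTree) {P : Ideal (CoordRing ℓ)} (hP : IsComponent G P)
    (h : lsDegree P a ≠ 0) (v : Fin ℓ) : (inputs G a v).card = 4 := by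
  classical
  have h1 := sum_excess_eq_one hG hP h
  rw [univ_eq_insert_biUnion hG v,
    sum_insert_biUnion_branch hG (fun c hc => by simpa using hc)] at h1
  have h2 : ∑ c ∈ Finset.univ.filter (fun c => G.Adj c v), ∑ x ∈ branch G c v, excess a x =
      ((Finset.univ.filter fun c => Determines G a c v).card : ℤ) := by
    rw [Finset.sum_congr rfl fun c hc => sum_excess_branch_eq hG hP h c v (by simpa using hc),
      Finset.sum_boole, Finset.filter_filter]
    congr 2
    ext c
    simp only [Finset.mem_filter, Finset.mem_univ, true_and, and_iff_right_iff_imp]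
    exact fun hc => hc.1
  rw [h2, excess] at h1
  rw [inputs, Finset.card_disjSum]
  have : (((Finset.univ.filter fun j => a j = v).card + (Finset.univ.filter fun c =>
      Determines G a c v).card : ℕ) : ℤ) = 4 := by
    push_cast; linarith
  convert (by exact_mod_cast this : (Finset.univ.filter fun j => a j = v).card +
    (Finset.univ.filter fun c => Determines G a c v).card = 4)

/-! ### Solving one vertex after the other -/

variable {ℓ d : ℕ} {G : SimpleGraph (Fin ℓ)} {a : Fin d → Fin ℓ}

section Orientation

variable (hG : G.IsTree) {P : Ideal (CoordRing ℓ)} (hP : IsComponent G P) (h : lsDegree P a ≠ 0)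
include hG hP h

/-- The direction of the edges given by `Determines` has no directed cycles, like every direction
of the edges of a tree. -/
theorem wellFounded_determines : WellFounded (Determines G a) := by
  have key : ∀ n, ∀ c v, (branch G c v).card = n → Determines G a c v → Acc (Determines G a) c := by
    intro n
    induction n using Nat.strong_induction_on with
    | _ n ih =>
      rintro c v rfl hcv
      refine ⟨_, fun c' hc' => ?_⟩
      have hne : c' ≠ v := by
        rintro rfl
        exact (determines_swap_iff hG hP h hcv.1).1 hc' hcv
      exact ih _ (card_branch_lt hG hcv.1 hc'.1 hne) c' c rfl hc'
  exact ⟨fun v => ⟨_, fun c hc => key _ c v rfl hc⟩⟩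

end Orientation

/-- The line `L v` satisfies all conditions at the vertex `v` that involve the inputs of `v`. -/
structure SolvesAt (G : SimpleGraph (Fin ℓ)) (a : Fin d → Fin ℓ) (M : Fin d → Fin 6 → ℂ)
    (L : Fin ℓ → Fin 6 → ℂ) (v : Fin ℓ) : Prop where
  ne_zero : L v ≠ 0
  self : pairing (L v) (L v) = 0
  meets : ∀ y ∈ inputs G a v, pairing (Sum.elim M L y) (L v) = 0

/-- Solving the conditions vertex by vertex, one always finds four lines with two distinct common
transversals. Here `e v` enumerates the four inputs of the vertex `v`. -/
def Nondegenerate (G : SimpleGraph (Fin ℓ)) (a : Fin d → Fin ℓ)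
    (e : Fin ℓ → Fin 4 → Fin d ⊕ Fin ℓ) (M : Fin d → Fin 6 → ℂ) : Prop :=
  ∀ v L, (∀ w, Relation.TransGen (Determines G a) w v → SolvesAt G a M L w) →
    (Matrix.of fun i k =>
      pairing (Sum.elim M L (e v i)) (Sum.elim M L (e v k))).det ≠ 0

/-- The fiber of the Landau map of a tree, with every incidence attributed to one vertex. -/
theorem mem_fiber_iff_solvesAt (hG : G.IsTree) {P : Ideal (CoordRing ℓ)} (hP : IsComponent G P)
    (h : lsDegree P a ≠ 0) {M : Fin d → Fin 6 → ℂ} {L : Fin ℓ → ℙ ℂ (Fin 6 → ℂ)} :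
    L ∈ fiber P a M ↔ ∀ v, SolvesAt G a M (fun i => (L i).rep) v := by
  rw [mem_fiber_iff hG hP]
  constructor
  · rintro ⟨h1, h2⟩ v
    refine ⟨(L v).rep_nonzero, h1.self v, ?_⟩
    rintro (j | c) hy
    · obtain rfl := inl_mem_inputs.1 hy
      exact h2 j
    · exact h1.adj c v (inr_mem_inputs.1 hy).1
  · intro H
    refine ⟨⟨fun i => (H i).self, fun i j hij => ?_⟩, fun j => (H (a j)).meets (Sum.inl j)
      (inl_mem_inputs.2 rfl)⟩
    by_cases hd : Determines G a i j
    · exact (H j).meets (Sum.inr i) (inr_mem_inputs.2 hd)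
    · rw [pairing_comm]
      exact (H i).meets (Sum.inr j) (inr_mem_inputs.2 ((determines_swap_iff hG hP h hij).2 hd))

theorem rep_eq_smul {X : Fin 6 → ℂ} (hX : X ≠ 0) :
    ∃ c : ℂ, c ≠ 0 ∧ (Projectivization.mk ℂ X hX).rep = c • X := by
  obtain ⟨c, hc⟩ := Projectivization.exists_smul_eq_mk_rep ℂ X hX
  exact ⟨c, c.ne_zero, hc.symm⟩

/-- Four vectors with nonzero Gram determinant have exactly two common transversals, as points of
projective space. -/
theorem exists_two_points {X : Fin 4 → Fin 6 → ℂ}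
    (hX : (Matrix.of fun i j => pairing (X i) (X j)).det ≠ 0) :
    ∃ t : Bool → ℙ ℂ (Fin 6 → ℂ), Function.Injective t ∧
      (∀ b, pairing (t b).rep (t b).rep = 0 ∧ ∀ i, pairing (X i) (t b).rep = 0) ∧
      ∀ L : ℙ ℂ (Fin 6 → ℂ), pairing L.rep L.rep = 0 → (∀ i, pairing (X i) L.rep = 0) →
        ∃ b, L = t b := by
  obtain ⟨u, u', hu, hu', huu', hXu, hXu', huniq⟩ := exists_two_transversals hX
  have hu0 : u ≠ 0 := by rintro rfl; simp [pairing] at huu'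
  have hu0' : u' ≠ 0 := by rintro rfl; simp [pairing] at huu'
  obtain ⟨c, hc, hcu⟩ := rep_eq_smul hu0
  obtain ⟨c', hc', hcu'⟩ := rep_eq_smul hu0'
  refine ⟨fun b => bif b then Projectivization.mk ℂ u hu0 else Projectivization.mk ℂ u' hu0',
    ?_, ?_, ?_⟩
  · have hne : Projectivization.mk ℂ u hu0 ≠ Projectivization.mk ℂ u' hu0' := by
      intro heq
      obtain ⟨s, hs⟩ := (Projectivization.mk_eq_mk_iff' ℂ _ _ _ _).1 heq
      rw [← hs, smul_pairing, hu', mul_zero] at huu'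
      exact huu' rfl
    rintro (_ | _) (_ | _) hb
    exacts [rfl, (hne hb.symm).elim, (hne hb).elim, rfl]
  · rintro (_ | _)
    · simp [hcu', smul_pairing, pairing_smul, hu', hXu']
    · simp [hcu, smul_pairing, pairing_smul, hu, hXu]
  · intro L hL hXL
    obtain ⟨s, hs⟩ := huniq _ hL hXL
    rcases hs with hs | hs
    · refine ⟨true, ?_⟩
      rw [← L.mk_rep]
      refine (Projectivization.mk_eq_mk_iff' ℂ _ _ _ _).2 ⟨s, hs.symm⟩
    · refine ⟨false, ?_⟩
      rw [← L.mk_rep]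
      refine (Projectivization.mk_eq_mk_iff' ℂ _ _ _ _).2 ⟨s, hs.symm⟩

section Count

variable (hG : G.IsTree) {P : Ideal (CoordRing ℓ)} (hP : IsComponent G P) (h : lsDegree P a ≠ 0)
  {e : Fin ℓ → Fin 4 → Fin d ⊕ Fin ℓ} (he : ∀ v y, y ∈ inputs G a v ↔ ∃ k, e v k = y)
  {M : Fin d → Fin 6 → ℂ} (hM : Nondegenerate G a e M)
include hG hP h he hM

/-- There are two choices for the line at each vertex. -/
theorem encard_fiber_eq_two_pow : (fiber P a M).encard = (2 ^ ℓ : ℕ) := by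
  classical
  have hwf := wellFounded_determines hG hP h
  -- the four lines at `v`
  let X : (Fin ℓ → ℙ ℂ (Fin 6 → ℂ)) → Fin ℓ → Fin 4 → Fin 6 → ℂ := fun L v k =>
    Sum.elim M (fun i => (L i).rep) (e v k)
  have hXcongr : ∀ L L' v, (∀ c, Determines G a c v → L c = L' c) → X L v = X L' v := by
    intro L L' v hLL
    ext1 k
    simp only [X]
    have hk := (he v (e v k)).2 ⟨k, rfl⟩
    revert hk
    generalize e v k = y
    rintro hk
    rcases y with j | c
    · rfl
    · simp [hLL c (inr_mem_inputs.1 hk)]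
  have hex : ∀ X : Fin 4 → Fin 6 → ℂ, ∃ t : Bool → ℙ ℂ (Fin 6 → ℂ),
      (Matrix.of fun i j => pairing (X i) (X j)).det ≠ 0 → Function.Injective t ∧
      (∀ b, pairing (t b).rep (t b).rep = 0 ∧ ∀ i, pairing (X i) (t b).rep = 0) ∧
      ∀ L : ℙ ℂ (Fin 6 → ℂ), pairing L.rep L.rep = 0 → (∀ i, pairing (X i) L.rep = 0) →
        ∃ b, L = t b := by
    intro X
    by_cases hX : (Matrix.of fun i j => pairing (X i) (X j)).det ≠ 0
    · obtain ⟨t, ht⟩ := exists_two_points hX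
      exact ⟨t, fun _ => ht⟩
    · obtain ⟨v⟩ := hG.connected.nonempty
      exact ⟨fun _ => Projectivization.mk ℂ (Pi.single 0 1) (by simp), fun h => (hX h).elim⟩
  choose t ht using hex
  have hdet : ∀ L v, (∀ w, Relation.TransGen (Determines G a) w v →
      SolvesAt G a M (fun i => (L i).rep) w) →
      (Matrix.of fun i j => pairing (X L v i) (X L v j)).det ≠ 0 := fun L v hL => hM v _ hL
  have hsolve : ∀ L v, SolvesAt G a M (fun i => (L i).rep) v ↔
      (pairing (L v).rep (L v).rep = 0 ∧ ∀ k, pairing (X L v k) (L v).rep = 0) := by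
    intro L v
    constructor
    · exact fun H => ⟨H.self, fun k => H.meets _ ((he v _).2 ⟨k, rfl⟩)⟩
    · refine fun H => ⟨(L v).rep_nonzero, H.1, fun y hy => ?_⟩
      obtain ⟨k, rfl⟩ := (he v y).1 hy
      exact H.2 k
  have hchoice : ∀ L : fiber P a M, ∀ v, ∃ b, L.1 v = t (X L.1 v) b := by
    intro L v
    have hL := (mem_fiber_iff_solvesAt hG hP h).1 L.2
    exact (ht _ (hdet L.1 v fun w _ => hL w)).2.2 _ ((hsolve L.1 v).1 (hL v)).1
      ((hsolve L.1 v).1 (hL v)).2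
  choose s hs using hchoice
  have hbij : Function.Bijective s := by
    constructor
    · intro L L' hLL
      have : ∀ v, L.1 v = L'.1 v := by
        intro v
        induction v using hwf.induction with
        | _ v ih => rw [hs L v, hs L' v, hLL, hXcongr L.1 L'.1 v ih]
      exact Subtype.ext (funext this)
    · intro b
      -- define the lines by recursion
      let L₀ : ℙ ℂ (Fin 6 → ℂ) := Projectivization.mk ℂ (Pi.single 0 1) (by simp)
      let L : Fin ℓ → ℙ ℂ (Fin 6 → ℂ) := hwf.fix fun v f =>
        t (X (fun c => if hc : Determines G a c v then f c hc else L₀) v) (b v)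
      have hL : ∀ v, L v = t (X L v) (b v) := by
        intro v
        refine (hwf.fix_eq _ v).trans ?_
        refine congrFun (congrArg t (hXcongr _ _ v fun c hc => ?_)) (b v)
        simp only [dif_pos hc]
        rfl
      have hsol : ∀ v, SolvesAt G a M (fun i => (L i).rep) v := by
        intro v
        induction v using hwf.transGen.induction with
        | _ v ih =>
          rw [hsolve]
          have h1 := (ht _ (hdet L v ih)).2.1 (b v)
          rw [← hL v] at h1
          exact h1
      refine ⟨⟨L, (mem_fiber_iff_solvesAt hG hP h).2 hsol⟩, ?_⟩
      ext1 v
      refine (ht _ (hdet L v fun w _ => hsol w)).1 ?_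
      rw [← hL v]
      exact (hs ⟨L, _⟩ v).symm
  rw [Set.encard, ENat.card_congr (Equiv.ofBijective s hbij)]
  simp

end Count

/-- The degenerate external data are the image of a closed set under a projection along
a compact space, as the lines can be represented by vectors of norm one. -/
theorem isOpen_setOf_nondegenerate (e : Fin ℓ → Fin 4 → Fin d ⊕ Fin ℓ)
    (he : ∀ v y, y ∈ inputs G a v ↔ ∃ k, e v k = y) : IsOpen {M | Nondegenerate G a e M} := by
  let C : Fin ℓ → Set ((Fin d → Fin 6 → ℂ) × UnitConfig ℓ) := fun v =>
    {ML | (∀ w, Relation.TransGen (Determines G a) w v → pairing (ML.2 w).1 (ML.2 w).1 = 0) ∧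
      (∀ w, Relation.TransGen (Determines G a) w v → ∀ y ∈ inputs G a w,
        pairing (Sum.elim ML.1 (fun i => (ML.2 i).1) y) (ML.2 w).1 = 0) ∧
      (Matrix.of fun i k => pairing (Sum.elim ML.1 (fun i => (ML.2 i).1) (e v i))
        (Sum.elim ML.1 (fun i => (ML.2 i).1) (e v k))).det = 0}
  have hcont : ∀ y : Fin d ⊕ Fin ℓ, Continuous fun ML : (Fin d → Fin 6 → ℂ) × UnitConfig ℓ =>
      (Sum.elim ML.1 (fun i => (ML.2 i).1) y : Fin 6 → ℂ) := by
    rintro (j | c)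
    · simp only [Sum.elim_inl]; fun_prop
    · simp only [Sum.elim_inr]; fun_prop
  have hC : ∀ v, IsClosed (C v) := by
    intro v
    simp only [C, Set.ofPred_and, Set.ofPred_forall]
    refine (isClosed_iInter fun w => isClosed_iInter fun _ => isClosed_eq (continuous_pairing
      (by fun_prop) (by fun_prop)) continuous_const).inter ((isClosed_iInter fun w =>
      isClosed_iInter fun _ => isClosed_iInter fun y => isClosed_iInter fun _ => isClosed_eq
      (continuous_pairing (hcont y) (by fun_prop)) continuous_const).inter (isClosed_eq ?_
      continuous_const))
    refine Continuous.matrix_det (continuous_matrix fun i k => ?_)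
    exact continuous_pairing (hcont _) (hcont _)
  have hcompl : {M | Nondegenerate G a e M} = (⋃ v, {M | ∃ L, (M, L) ∈ C v})ᶜ := by
    ext M
    simp only [Set.mem_ofPred_eq, Set.mem_compl_iff, Set.mem_iUnion, not_exists]
    constructor
    · rintro H v L ⟨h1, h2, h3⟩
      refine H v (fun i => (L i).1) (fun w hw => ⟨fun h0 => ?_, h1 w hw, h2 w hw⟩) h3
      have := (L w).2
      rw [h0] at this
      simp at this
    · intro H v L hL hdet
      -- normalize the lines at the vertices before `v`
      have hex : ∀ w, ∃ (c : ℂ) (x : Metric.sphere (0 : Fin 6 → ℂ) 1), c ≠ 0 ∧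
          (L w ≠ 0 → x.1 = c • L w) := by
        intro w
        by_cases hw : L w ≠ 0
        · obtain ⟨c, hc, hcw⟩ := exists_smul_mem_sphere hw
          exact ⟨c, ⟨_, hcw⟩, hc, fun _ => rfl⟩
        · obtain ⟨c, hc, hcw⟩ := exists_smul_mem_sphere
            (x := (Pi.single 0 1 : Fin 6 → ℂ)) (by simp)
          exact ⟨c, ⟨_, hcw⟩, hc, fun h => (hw h).elim⟩
      choose c x hc hx using hex
      have hinput : ∀ w, (∀ u, Determines G a u w → Relation.TransGen (Determines G a) u v) →
          ∀ y ∈ inputs G a w, Sum.elim M (fun i => (x i).1) y =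
            (Sum.elim (fun _ => 1) c y : ℂ) • Sum.elim M L y := by
        rintro w hw (j | u) hy
        · simp
        · exact hx u (hL u (hw u (inr_mem_inputs.1 hy))).ne_zero
      refine H v x ⟨fun w hw => ?_, fun w hw y hy => ?_, ?_⟩
      · change pairing (x w).1 (x w).1 = 0
        rw [hx w (hL w hw).ne_zero, smul_pairing, pairing_smul, (hL w hw).self]; simp
      · change pairing (Sum.elim M (fun i => (x i).1) y) (x w).1 = 0
        rw [hx w (hL w hw).ne_zero, hinput w (fun u hu => .head hu hw) y hy, smul_pairing,
          pairing_smul, (hL w hw).meets y hy]; simp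
      · change (Matrix.of fun i k => pairing (Sum.elim M (fun i => (x i).1) (e v i))
          (Sum.elim M (fun i => (x i).1) (e v k))).det = 0
        have hk : ∀ k, Sum.elim M (fun i => (x i).1) (e v k) =
            (Sum.elim (fun _ => 1) c (e v k) : ℂ) • Sum.elim M L (e v k) := fun k =>
          hinput v (fun u hu => .single hu) _ ((he v _).2 ⟨k, rfl⟩)
        simp only [hk, smul_pairing, pairing_smul]
        have h1 := Matrix.det_mul_row (fun k => (Sum.elim (fun _ => 1) c (e v k) : ℂ))
          (Matrix.of fun i k => (Sum.elim (fun _ => 1) c (e v i) : ℂ) *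
            pairing (Sum.elim M L (e v i)) (Sum.elim M L (e v k)))
        have h2 := Matrix.det_mul_column (fun k => (Sum.elim (fun _ => 1) c (e v k) : ℂ))
          (Matrix.of fun i k => pairing (Sum.elim M L (e v i)) (Sum.elim M L (e v k)))
        simp only [Matrix.of_apply] at h1 h2
        rw [h1, h2, hdet, mul_zero, mul_zero]
  rw [hcompl, isOpen_compl_iff]
  exact isClosed_iUnion_of_finite fun v => isClosed_exists_unitConfig (hC v)

/-- Over nondegenerate external data, the fiber has as many points as the generic fiber. -/
theorem encard_fiber_eq_lsDegree (hG : G.IsTree) {P : Ideal (CoordRing ℓ)} (hP : IsComponent G P)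
    (h : lsDegree P a ≠ 0) {e : Fin ℓ → Fin 4 → Fin d ⊕ Fin ℓ}
    (he : ∀ v y, y ∈ inputs G a v ↔ ∃ k, e v k = y) {M : Fin d → Fin 6 → ℂ}
    (hM : Nondegenerate G a e M) : (fiber P a M).encard = lsDegree P a := by
  obtain ⟨F, hF, hFn⟩ := exists_generic_fiber_encard P a h
  obtain ⟨M', hM', hFM⟩ := exists_eval_ne_zero_of_isOpen hF (isOpen_setOf_nondegenerate e he)
    ⟨M, hM⟩
  rw [← hFn M' hFM, encard_fiber_eq_two_pow hG hP h he hM, encard_fiber_eq_two_pow hG hP h he hM']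

/-! ### The contour of a plane tree -/

section Perm

variable {α β : Type*}

theorem eq_of_sameCycle {f : Equiv.Perm α} {g : α → β} (hg : ∀ x, g (f x) = g x) {x y : α}
    (h : f.SameCycle x y) : g x = g y := by
  have hpow : ∀ n : ℕ, ∀ z, g ((f ^ n) z) = g z := by
    intro n
    induction n with
    | zero => simp
    | succ n ih => intro z; rw [pow_succ', Equiv.Perm.mul_apply, hg, ih]
  obtain ⟨i, rfl⟩ := h
  obtain ⟨n, rfl | rfl⟩ := i.eq_nat_or_neg
  · simp [hpow]
  · conv_lhs => rw [← (f ^ n).apply_symm_apply x]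
    rw [hpow, zpow_neg, zpow_natCast]
    rfl

/-- The first `n` points on the orbit of `x`. -/
def orbitList (f : Equiv.Perm α) (x : α) (n : ℕ) : List α := (List.range n).map fun i => f^[i] x

/-- The orbit of `x`, as a list that ends with `f⁻¹ x`. -/
theorem exists_orbitList_append [Finite α] (f : Equiv.Perm α) (x : α) : ∃ n,
    f^[n] (f x) = x ∧ (orbitList f (f x) n ++ [x]).Nodup ∧
      ∀ y, y ∈ orbitList f (f x) n ++ [x] ↔ f.SameCycle x y := by
  have hx : x ∈ Function.periodicPts f :=
    f.injective.mem_periodicPts x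
  have hpos := Function.minimalPeriod_pos_of_mem_periodicPts hx
  obtain ⟨n, hn⟩ : ∃ n, Function.minimalPeriod f x = n + 1 := ⟨_, (Nat.succ_pred hpos.ne').symm⟩
  have hfx : f^[n] (f x) = x := by
    rw [← Function.iterate_succ_apply, Nat.succ_eq_add_one, ← hn]
    exact Function.iterate_minimalPeriod
  have hlist : orbitList f (f x) n ++ [x] = orbitList f (f x) (n + 1) := by
    rw [orbitList, orbitList, List.range_succ, List.map_append, List.map_singleton, hfx]
  have hmin : Function.minimalPeriod f (f x) = n + 1 := by
    rw [Function.minimalPeriod_apply hx, hn]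
  refine ⟨n, hfx, ?_, fun y => ?_⟩
  · rw [hlist, orbitList]
    refine (List.nodup_map_iff_inj_on List.nodup_range).2 fun i hi j hj hij => ?_
    rw [List.mem_range] at hi hj
    exact (Function.iterate_eq_iterate_iff_of_lt_minimalPeriod (hmin ▸ hi) (hmin ▸ hj)).1 hij
  · rw [hlist, orbitList, List.mem_map]
    constructor
    · rintro ⟨i, -, rfl⟩
      refine ⟨(i + 1 : ℕ), ?_⟩
      rw [← Function.iterate_succ_apply, zpow_natCast, Equiv.Perm.iterate_eq_pow]
    · intro h
      have h' : f.SameCycle (f x) y := Equiv.Perm.sameCycle_apply_left.2 h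
      obtain ⟨i, hi⟩ := h'.exists_nat_pow_eq
      refine ⟨i % (n + 1), List.mem_range.2 (Nat.mod_lt _ n.succ_pos), ?_⟩
      rw [← hmin, Function.iterate_mod_minimalPeriod_eq, Equiv.Perm.iterate_eq_pow, hi]

end Perm

namespace LandauDiagram

variable {ℓ d : ℕ} {D : LandauDiagram ℓ d}

/-- A map of genus zero whose underlying graph is a tree with `d` pendant edges that are joined at
infinity has at least `d` faces. -/
theorem le_numCycles_faces (hG : D.G.IsTree) (hd : 0 < d) {ρ : Equiv.Perm D.HalfEdge}
    (hρ : ∀ x y, HalfEdge.base D x = HalfEdge.base D y ↔ ρ.SameCycle x y)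
    (hgenus : numCycles ρ + numCycles (ρ * D.edgePerm) =
      numCycles D.edgePerm + 2 * numOrbits ρ D.edgePerm) :
    d ≤ numCycles (ρ * D.edgePerm) := by
  classical
  have hV : numCycles ρ ≤ ℓ + 1 := by
    have := Nat.card_le_card_of_injective
      (Quotient.lift (s := Equiv.Perm.SameCycle.setoid ρ) (HalfEdge.base D)
        fun x y hxy => (hρ x y).2 hxy) (by
      intro x y
      induction x using Quotient.inductionOn
      induction y using Quotient.inductionOn
      exact fun hxy => Quotient.sound ((hρ _ _).1 hxy))
    rwa [Nat.card_eq_fintype_card (α := Option _), Fintype.card_option, Fintype.card_fin] at this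
  have hE : ℓ - 1 + d ≤ numCycles D.edgePerm := by
    let g : D.HalfEdge → D.G.edgeSet ⊕ Fin d := Sum.map (fun e => ⟨e.edge, e.edge_mem⟩) Prod.fst
    have hg : ∀ x, g (D.edgePerm x) = g x := by
      rintro (e | ⟨j, b⟩)
      · exact congrArg Sum.inl (Subtype.ext e.edge_symm)
      · rfl
    have := Nat.card_le_card_of_surjective
      (Quotient.lift (s := Equiv.Perm.SameCycle.setoid D.edgePerm) g
        fun x y hxy => eq_of_sameCycle hg hxy) (by
      rintro (⟨e, he⟩ | j)
      · induction e using Sym2.ind with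
        | _ u v => exact ⟨Quotient.mk _ (.inl ⟨(u, v), he⟩), rfl⟩
      · exact ⟨Quotient.mk _ (.inr (j, true)), rfl⟩)
    have hcard := hG.card_edgeFinset
    rw [Nat.card_sum, Nat.card_eq_fintype_card (α := D.G.edgeSet), ← SimpleGraph.edgeFinset_card,
      Nat.card_eq_fintype_card (α := Fin d), Fintype.card_fin] at this
    rw [Fintype.card_fin] at hcard
    rw [numCycles]
    omega
  have hO : 1 ≤ numOrbits ρ D.edgePerm := by
    have : Nonempty (MulAction.orbitRel.Quotient (Subgroup.closure {ρ, D.edgePerm}) D.HalfEdge) :=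
      ⟨Quotient.mk _ (.inr (⟨0, hd⟩, true))⟩
    exact Nat.card_pos
  omega

/-- A part of the contour of the tree: walking along the tree from the half-edge `x` one gets to
`y`; the list contains the external vertices that are visited, starting with the last one. -/
inductive Path (ρ : Equiv.Perm D.HalfEdge) : D.HalfEdge → List (Fin d) → D.HalfEdge → Prop
  | nil (x : D.HalfEdge) : Path ρ x [] x
  | dart {e : D.G.Dart} {l : List (Fin d)} {y : D.HalfEdge} (h : Path ρ (ρ (.inl e.symm)) l y) :
      Path ρ (.inl e) l y
  | external {j : Fin d} {l : List (Fin d)} {y : D.HalfEdge} (h : Path ρ (ρ (.inr (j, false))) l y) :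
      Path ρ (.inr (j, false)) (l ++ [j]) y

theorem Path.trans {ρ : Equiv.Perm D.HalfEdge} {x y z : D.HalfEdge} {l l' : List (Fin d)}
    (h : Path ρ x l y) (h' : Path ρ y l' z) : Path ρ x (l' ++ l) z := by
  induction h with
  | nil => simpa using h'
  | dart _ ih => exact .dart (ih h')
  | external _ ih => rw [← List.append_assoc]; exact .external (ih h')

/-- Going around a vertex, the contour runs through what lies beyond its half-edges in turn. -/
theorem Path.orbitList {ρ : Equiv.Perm D.HalfEdge} {F : D.HalfEdge → List (Fin d)}
    {x : D.HalfEdge} {n : ℕ} (h : ∀ y ∈ orbitList ρ x n, Path ρ y (F y) (ρ y)) :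
    Path ρ x ((orbitList ρ x n).reverse.flatMap F) (ρ^[n] x) := by
  induction n with
  | zero => exact .nil x
  | succ n ih =>
    simp only [Landau.orbitList, List.range_succ, List.map_append, List.map_singleton,
      List.reverse_append, List.reverse_singleton, List.singleton_append, List.flatMap_cons,
      List.mem_append] at h ⊢
    refine (ih fun y hy => h y (Or.inl hy)).trans ?_
    rw [Function.iterate_succ_apply']
    exact h _ (Or.inr (by simp))

section Contour

variable {ρ : Equiv.Perm D.HalfEdge}
  (hinf : ∀ j : Fin d, ρ (.inr (j, true)) = .inr (finRotate d j, true))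
include hinf

/-- The faces of the map lie between consecutive external vertices of the contour. -/
theorem Path.sameCycle {x y : D.HalfEdge} {l : List (Fin d)} (h : Path ρ x l y) :
    ∀ j ∈ l.getLast?, (ρ * D.edgePerm).SameCycle x (.inr (finRotate d j, true)) := by
  induction h with
  | nil => simp
  | @dart e l y _ ih =>
    intro j hj
    exact Equiv.Perm.sameCycle_apply_left.1 (ih j hj)
  | @external j l y _ ih =>
    intro j' hj
    simp only [List.getLast?_append, List.getLast?_singleton, Option.some_or, Option.mem_def,
      Option.some.injEq] at hj
    subst hj
    rw [← hinf]
    exact Equiv.Perm.sameCycle_apply_right.2 (Equiv.Perm.SameCycle.refl _ _)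

/-- The external vertices occur on the contour in their cyclic order if every face contains only one
half-edge at infinity: the face between two consecutive ones determines the later from the
earlier. -/
theorem Path.isChain
    (hinj : ∀ i j : Fin d, (ρ * D.edgePerm).SameCycle (.inr (i, true)) (.inr (j, true)) → i = j)
    {x y : D.HalfEdge} {l : List (Fin d)} (h : Path ρ x l y) :
    l.IsChain fun i j => j = finRotate d i := by
  induction h with
  | nil => simp
  | dart _ ih => exact ih
  | @external j l y h ih =>
    rw [List.isChain_append]
    refine ⟨ih, by simp, fun i hi j' hj => ?_⟩
    simp only [List.head?_cons, Option.mem_def, Option.some.injEq] at hj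
    subst hj
    refine hinj _ _ (.trans ?_ (h.sameCycle hinf i hi))
    exact Equiv.Perm.sameCycle_apply_right.2 (Equiv.Perm.SameCycle.refl _ _)

/-- If every contour gets to an external vertex, then every face contains exactly one of the `d`
half-edges at infinity. -/
theorem eq_of_sameCycle_infinity (hG : D.G.IsTree) (hd : 0 < d)
    (hρ : ∀ x y, HalfEdge.base D x = HalfEdge.base D y ↔ ρ.SameCycle x y)
    (hgenus : numCycles ρ + numCycles (ρ * D.edgePerm) =
      numCycles D.edgePerm + 2 * numOrbits ρ D.edgePerm)
    (hpath : ∀ x v, HalfEdge.base D x = some v → ∃ l y, Path ρ x l y ∧ l ≠ []) {i j : Fin d}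
    (hij : (ρ * D.edgePerm).SameCycle (.inr (i, true)) (.inr (j, true))) : i = j := by
  classical
  let f : Fin d → Quotient (Equiv.Perm.SameCycle.setoid (ρ * D.edgePerm)) := fun j =>
    Quotient.mk _ (.inr (j, true))
  have hf : Function.Surjective f := by
    intro q
    induction q using Quotient.inductionOn with
    | _ x =>
      have key : ∀ v, HalfEdge.base D x = some v → ∃ a, f a = Quotient.mk _ x := by
        intro v hv
        obtain ⟨l, y, hl, hne⟩ := hpath x v hv
        exact ⟨finRotate d (l.getLast hne), Quotient.sound
          (hl.sameCycle hinf _ (List.getLast?_eq_getLast_of_ne_nil hne)).symm⟩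
      rcases x with e | ⟨j, _ | _⟩
      · exact key _ rfl
      · exact key _ rfl
      · exact ⟨j, rfl⟩
  have := (hf.bijective_of_nat_card_le (by
    simpa [numCycles] using le_numCycles_faces hG hd hρ hgenus)).1
  exact this (Quotient.sound hij)

end Contour

end LandauDiagram

/-! ### Solving a plane tree along its contour -/

theorem orbitList_succ {α : Type*} (f : Equiv.Perm α) (x : α) (n : ℕ) :
    orbitList f x (n + 1) = orbitList f x n ++ [f^[n] x] := by
  rw [orbitList, orbitList, List.range_succ, List.map_append, List.map_singleton]

namespace LandauDiagram

variable {ℓ d : ℕ} {D : LandauDiagram ℓ d}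

/-- The line at the other end of a half-edge. -/
def HalfEdge.input : D.HalfEdge → Fin d ⊕ Fin ℓ
  | .inl e => .inr e.snd
  | .inr (j, _) => .inl j

/-- The number of external lines beyond a half-edge. -/
def HalfEdge.weight : D.HalfEdge → ℤ
  | .inl e => ∑ x ∈ branch D.G e.snd e.fst, (excess D.attach x + 3)
  | .inr _ => 1

theorem HalfEdge.input_injOn {x y : D.HalfEdge} {v : Fin ℓ} (hx : HalfEdge.base D x = some v)
    (hy : HalfEdge.base D y = some v) (h : x.input = y.input) : x = y := by
  rcases x with e | ⟨i, _ | _⟩ <;> rcases y with e' | ⟨j, _ | _⟩ <;>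
    simp only [HalfEdge.input, HalfEdge.base, reduceCtorEq, Sum.inr.injEq, Sum.inl.injEq,
      Option.some.injEq] at h hx hy
  · exact congrArg Sum.inl (SimpleGraph.Dart.ext _ _ (Prod.ext (hx.trans hy.symm) h))
  · rw [h]

theorem HalfEdge.exists_input_eq {v : Fin ℓ} {y : Fin d ⊕ Fin ℓ} (hy : y ∈ inputs D.G D.attach v) :
    ∃ x : D.HalfEdge, HalfEdge.base D x = some v ∧ x.input = y := by
  rcases y with j | c
  · exact ⟨.inr (j, false), congrArg some (inl_mem_inputs.1 hy), rfl⟩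
  · exact ⟨.inl ⟨(v, c), (inr_mem_inputs.1 hy).1.symm⟩, rfl, rfl⟩

theorem sum_excess_add_three : ∑ x, (excess D.attach x + 3) = d := by
  rw [Finset.sum_add_distrib, sum_excess]
  simp
  ring

/-- All external lines lie beyond exactly one of the half-edges at a given vertex. -/
theorem sum_weight (hG : D.G.IsTree) {v : Fin ℓ} {T : List D.HalfEdge} (hT : T.Nodup)
    (hTv : ∀ x, x ∈ T ↔ HalfEdge.base D x = some v) : (T.map HalfEdge.weight).sum = d := by
  classical
  rw [← List.sum_toFinset _ hT, ← sum_excess_add_three (D := D), univ_eq_insert_biUnion hG v,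
    sum_insert_biUnion_branch hG (fun c hc => by simpa using hc)]
  have hTf : T.toFinset = Finset.univ.filter fun x => HalfEdge.base D x = some v := by
    ext x; simp [hTv]
  rw [hTf, Finset.sum_filter, Fintype.sum_sum_type, Fintype.sum_prod_type, add_comm]
  congr 1
  · simp [HalfEdge.base, HalfEdge.weight, excess]
  · rw [← Finset.sum_filter]
    refine Finset.sum_nbij (fun e => e.snd) ?_ ?_ ?_ ?_
    · intro e he
      have : e.fst = v := by simpa [HalfEdge.base] using he
      simpa [← this] using e.adj.symm
    · intro e he e' he' h
      have h1 : e.fst = v := by simpa [HalfEdge.base] using he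
      have h2 : e'.fst = v := by simpa [HalfEdge.base] using he'
      exact SimpleGraph.Dart.ext _ _ (Prod.ext (h1.trans h2.symm) h)
    · intro c hc
      have : D.G.Adj c v := by simpa using hc
      exact ⟨⟨(v, c), this.symm⟩, by simp [HalfEdge.base], rfl⟩
    · intro e he
      have : e.fst = v := by simpa [HalfEdge.base] using he
      rw [HalfEdge.weight, this]

/-- The list `l` contains the external lines on the part of the contour beyond the half-edge `x`,
and they suffice to construct the line at the other end of `x` if it is an input. -/
structure IsResolution (ρ : Equiv.Perm D.HalfEdge) (x : D.HalfEdge) (l : List (Fin d)) : Prop where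
  path : Path ρ x l (ρ x)
  length : (l.length : ℤ) = x.weight
  construction : ∀ v, HalfEdge.base D x = some v → x.input ∈ inputs D.G D.attach v →
    ∃ t : Construction d, t.lines.Sublist l ∧ ∀ M L,
      (∀ w, Relation.TransGen (Determines D.G D.attach) w v → SolvesAt D.G D.attach M L w) →
      t.Yields M (Sum.elim M L x.input)

section Tree

variable (hG : D.G.IsTree) {P : Ideal (CoordRing ℓ)} (hP : IsComponent D.G P)
  (h : lsDegree P D.attach ≠ 0)
include hG hP h

/-- The four inputs of a vertex in their order on the contour. -/
theorem exists_four_constructions {ρ : Equiv.Perm D.HalfEdge} {v : Fin ℓ} {T : List D.HalfEdge}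
    (hT : T.Nodup) (hTv : ∀ x ∈ T, HalfEdge.base D x = some v)
    (hTi : ∀ y ∈ inputs D.G D.attach v, ∃ x ∈ T, x.input = y) {F : D.HalfEdge → List (Fin d)}
    (hF : ∀ x ∈ T, IsResolution ρ x (F x)) :
    ∃ (e : Fin 4 → Fin d ⊕ Fin ℓ) (t : Fin 4 → Construction d),
      (∀ y, y ∈ inputs D.G D.attach v ↔ ∃ k, e k = y) ∧
      (Construction.transversal (t 0) (t 1) (t 2) (t 3)).lines.Sublist (T.reverse.flatMap F) ∧
      ∀ M L, (∀ w, Relation.TransGen (Determines D.G D.attach) w v →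
        SolvesAt D.G D.attach M L w) → ∀ k, (t k).Yields M (Sum.elim M L (e k)) := by
  classical
  obtain ⟨T', hT'⟩ : ∃ T', T' = T.reverse.filter fun x => x.input ∈ inputs D.G D.attach v :=
    ⟨_, rfl⟩
  have hmem : ∀ x, x ∈ T' ↔ x ∈ T ∧ x.input ∈ inputs D.G D.attach v := by
    intro x; simp [hT']
  have hnd : (T'.map HalfEdge.input).Nodup := by
    refine (List.nodup_map_iff_inj_on ?_).2 fun x hx y hy hxy =>
      HalfEdge.input_injOn (hTv x ((hmem x).1 hx).1) (hTv y ((hmem y).1 hy).1) hxy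
    rw [hT']
    exact (List.nodup_reverse.2 hT).filter _
  have hset : (T'.map HalfEdge.input).toFinset = inputs D.G D.attach v := by
    ext y
    simp only [List.mem_toFinset, List.mem_map, hmem]
    constructor
    · rintro ⟨x, ⟨-, hx⟩, rfl⟩
      exact hx
    · intro hy
      obtain ⟨x, hx, rfl⟩ := hTi y hy
      exact ⟨x, ⟨hx, hy⟩, rfl⟩
  have hlen : T'.length = 4 := by
    rw [← List.length_map (as := T') HalfEdge.input, ← List.toFinset_card_of_nodup hnd, hset,
      card_inputs hG hP h]
  have hsub : (T'.flatMap F).Sublist (T.reverse.flatMap F) := by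
    rw [hT']
    exact List.Sublist.flatMap List.filter_sublist F
  obtain ⟨x₀, x₁, x₂, x₃, rfl⟩ : ∃ x₀ x₁ x₂ x₃, T' = [x₀, x₁, x₂, x₃] := by
    match T', hlen with
    | [x₀, x₁, x₂, x₃], _ => exact ⟨x₀, x₁, x₂, x₃, rfl⟩
  have hex : ∀ k : Fin 4, ![x₀, x₁, x₂, x₃] k ∈ [x₀, x₁, x₂, x₃] := by
    intro k; fin_cases k <;> simp
  have hcon := fun k : Fin 4 =>
    (hF _ ((hmem _).1 (hex k)).1).construction v (hTv _ ((hmem _).1 (hex k)).1)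
      ((hmem _).1 (hex k)).2
  choose t ht hyield using hcon
  refine ⟨fun k => (![x₀, x₁, x₂, x₃] k).input, t, fun y => ?_, ?_, fun M L hL k => hyield k M L hL⟩
  · rw [← hset]
    simp only [List.mem_toFinset, List.map_cons, List.map_nil, List.mem_cons, List.not_mem_nil,
      or_false, Fin.exists_fin_succ, Matrix.cons_val_zero, Matrix.cons_val_succ, eq_comm (a := y),
      IsEmpty.exists_iff]
  · refine List.Sublist.trans ?_ hsub
    simp only [Construction.lines, List.flatMap_cons, List.flatMap_nil, List.append_nil,
      List.append_assoc]
    exact (ht 0).append ((ht 1).append ((ht 2).append (ht 3)))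

/-- Induction on the size of the branch beyond the half-edge: going around the vertex at its other
end, the contour runs through the smaller branches. -/
theorem exists_isResolution {ρ : Equiv.Perm D.HalfEdge}
    (hρ : ∀ x y, HalfEdge.base D x = HalfEdge.base D y ↔ ρ.SameCycle x y) (x : D.HalfEdge)
    (v : Fin ℓ) (hx : HalfEdge.base D x = some v) : ∃ l, IsResolution ρ x l := by
  classical
  have hext : ∀ j, IsResolution ρ (.inr (j, false)) [j] := fun j =>
    ⟨.external (.nil _), rfl, fun v _ _ => ⟨.given j, .refl _, fun M L _ => rfl⟩⟩
  have key : ∀ n, ∀ e : D.G.Dart, (branch D.G e.snd e.fst).card = n →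
      ∃ l, IsResolution ρ (.inl e) l := by
    intro n
    induction n using Nat.strong_induction_on with
    | _ n ih =>
      rintro e rfl
      -- go around the vertex `e.snd`
      obtain ⟨n, hn, hnd, hmem⟩ := exists_orbitList_append ρ (.inl e.symm)
      have hbase : ∀ x, x ∈ orbitList ρ (ρ (.inl e.symm)) n ++ [.inl e.symm] ↔
          HalfEdge.base D x = some e.snd := fun x => by
        rw [hmem, ← hρ, eq_comm]; rfl
      have hTv : ∀ x ∈ orbitList ρ (ρ (.inl e.symm)) n, HalfEdge.base D x = some e.snd :=
        fun x hx => (hbase x).1 (List.mem_append_left _ hx)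
      have hne : ∀ x ∈ orbitList ρ (ρ (.inl e.symm)) n, x ≠ .inl e.symm := by
        rintro x hx rfl
        exact List.disjoint_of_nodup_append hnd hx (List.mem_singleton_self _)
      have hex : ∀ x, ∃ l, x ∈ orbitList ρ (ρ (.inl e.symm)) n → IsResolution ρ x l := by
        intro x
        by_cases hx : x ∈ orbitList ρ (ρ (.inl e.symm)) n
        · rcases x with e' | ⟨j, _ | _⟩
          · have h1 : e'.fst = e.snd := Option.some.inj (hTv _ hx)
            have h2 : e'.snd ≠ e.fst := fun h2 => hne _ hx (congrArg Sum.inl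
              (SimpleGraph.Dart.ext _ _ (Prod.ext h1 h2)))
            have h3 := card_branch_lt hG e.adj.symm (h1 ▸ e'.adj.symm) h2
            rw [← h1] at h3
            obtain ⟨l, hl⟩ := ih _ (h1 ▸ h3) e' rfl
            exact ⟨l, fun _ => hl⟩
          · exact ⟨_, fun _ => hext j⟩
          · exact absurd (hTv _ hx) (by simp [HalfEdge.base])
        · exact ⟨[], fun h => (hx h).elim⟩
      choose F hF using hex
      refine ⟨(orbitList ρ (ρ (.inl e.symm)) n).reverse.flatMap F, ?_, ?_, ?_⟩
      · have hp := Path.orbitList fun x hx => (hF x hx).path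
        rw [hn] at hp
        have hq : Path ρ (.inl e.symm) [] (ρ (.inl e)) := .dart (.nil _)
        exact .dart (hp.trans hq)
      · have hsum := sum_weight hG hnd hbase
        rw [List.map_append, List.sum_append, List.map_singleton, List.sum_singleton] at hsum
        have hb := sum_branch_add_sum_branch hG e.adj.symm fun x => excess D.attach x + 3
        rw [sum_excess_add_three] at hb
        have hl : ((((orbitList ρ (ρ (.inl e.symm)) n).reverse.flatMap F).length : ℕ) : ℤ) =
            ((orbitList ρ (ρ (.inl e.symm)) n).map HalfEdge.weight).sum := by
          rw [List.length_flatMap, List.map_reverse, List.sum_reverse, Nat.cast_list_sum,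
            List.map_map]
          congr 1
          exact List.map_congr_left fun x hx => (hF x hx).length
        rw [hl]
        have e1 : HalfEdge.weight (D := D) (.inl e.symm) =
          ∑ x ∈ branch D.G e.fst e.snd, (excess D.attach x + 3) := rfl
        have e2 : HalfEdge.weight (D := D) (.inl e) =
          ∑ x ∈ branch D.G e.snd e.fst, (excess D.attach x + 3) := rfl
        rw [e1] at hsum
        rw [e2]
        linarith
      · intro v hv hinput
        obtain rfl : e.fst = v := Option.some.inj hv
        have hd : Determines D.G D.attach e.snd e.fst := inr_mem_inputs.1 hinput
        obtain ⟨e₄, t, he, hsub, hyield⟩ := exists_four_constructions hG hP h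
          (List.nodup_append.1 hnd).1 hTv (fun y hy => by
            obtain ⟨x, hx, rfl⟩ := HalfEdge.exists_input_eq hy
            rcases List.mem_append.1 ((hbase x).2 hx) with hx' | hx'
            · exact ⟨x, hx', rfl⟩
            · rw [List.mem_singleton] at hx'
              subst hx'
              exact ((determines_swap_iff hG hP h hd.1).1 (inr_mem_inputs.1 hy) hd).elim) hF
        refine ⟨.transversal (t 0) (t 1) (t 2) (t 3), hsub, fun M L hL => ?_⟩
        have hs := hL e.snd (.single hd)
        have hy := hyield M L fun w hw => hL w (hw.tail hd)
        have hm := fun k => hs.meets _ ((he _).2 ⟨k, rfl⟩)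
        exact ⟨hs.ne_zero, hs.self, _, _, _, _, ⟨hy 0, hy 1, hy 2, hy 3⟩, hm 0, hm 1, hm 2, hm 3⟩
  rcases x with e | ⟨j, _ | _⟩
  · exact key _ e rfl
  · exact ⟨_, hext j⟩
  · simp [HalfEdge.base] at hx

/-- The contour from a half-edge back to itself visits all external vertices. -/
theorem exists_path_self {ρ : Equiv.Perm D.HalfEdge}
    (hρ : ∀ x y, HalfEdge.base D x = HalfEdge.base D y ↔ ρ.SameCycle x y) (x : D.HalfEdge)
    (v : Fin ℓ) (hx : HalfEdge.base D x = some v) :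
    ∃ l, Path ρ x l x ∧ l.length = d ∧ ∃ (e : Fin 4 → Fin d ⊕ Fin ℓ) (t : Fin 4 → Construction d),
      (∀ y, y ∈ inputs D.G D.attach v ↔ ∃ k, e k = y) ∧
      (Construction.transversal (t 0) (t 1) (t 2) (t 3)).lines.Sublist l ∧
      ∀ M L, (∀ w, Relation.TransGen (Determines D.G D.attach) w v →
        SolvesAt D.G D.attach M L w) → ∀ k, (t k).Yields M (Sum.elim M L (e k)) := by
  classical
  obtain ⟨x', rfl⟩ := ρ.surjective x
  obtain ⟨n, hn, hnd, hmem⟩ := exists_orbitList_append ρ x'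
  have hx' : HalfEdge.base D x' = some v := by
    rw [← hx, hρ]; exact Equiv.Perm.sameCycle_apply_right.2 (.refl _ _)
  have hO : orbitList ρ (ρ x') (n + 1) = orbitList ρ (ρ x') n ++ [x'] := by
    rw [orbitList_succ, hn]
  rw [← hO] at hnd hmem
  have hbase : ∀ x, x ∈ orbitList ρ (ρ x') (n + 1) ↔ HalfEdge.base D x = some v := fun x => by
    rw [hmem, ← hρ, hx', eq_comm]
  have hex : ∀ x, ∃ l, x ∈ orbitList ρ (ρ x') (n + 1) → IsResolution ρ x l := by
    intro x
    by_cases hx : x ∈ orbitList ρ (ρ x') (n + 1)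
    · obtain ⟨l, hl⟩ := exists_isResolution hG hP h hρ x v ((hbase x).1 hx)
      exact ⟨l, fun _ => hl⟩
    · exact ⟨[], fun h => (hx h).elim⟩
  choose F hF using hex
  refine ⟨(orbitList ρ (ρ x') (n + 1)).reverse.flatMap F, ?_, ?_, ?_⟩
  · have hp := Path.orbitList fun x hx => (hF x hx).path
    rwa [Function.iterate_succ_apply', hn] at hp
  · have hsum := sum_weight hG hnd hbase
    have hl : ((((orbitList ρ (ρ x') (n + 1)).reverse.flatMap F).length : ℕ) : ℤ) =
        ((orbitList ρ (ρ x') (n + 1)).map HalfEdge.weight).sum := by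
      rw [List.length_flatMap, List.map_reverse, List.sum_reverse, Nat.cast_list_sum,
        List.map_map]
      congr 1
      exact List.map_congr_left fun x hx => (hF x hx).length
    exact_mod_cast hl.trans hsum
  · exact exists_four_constructions hG hP h hnd (fun x hx => (hbase x).1 hx) (fun y hy => by
      obtain ⟨x, hx, rfl⟩ := HalfEdge.exists_input_eq hy
      exact ⟨x, (hbase x).2 hx, rfl⟩) hF

end Tree

/-- A list in which every entry is the cyclic successor of the one before is, up to a rotation,
increasing. -/
theorem exists_append_of_isChain {l : List (Fin d)} (hl : l.IsChain fun i j => j = finRotate d i)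
    (hd : l.length ≤ d) : ∃ A B, l = A ++ B ∧ (B ++ A).Pairwise (· < ·) := by
  rcases l.eq_nil_or_concat' with rfl | ⟨l', x, hlx⟩
  · exact ⟨[], [], rfl, by simp⟩
  have hne : 0 < l.length := by rw [hlx]; simp
  obtain ⟨k, hk⟩ : ∃ k, k = (l[0]).val := ⟨_, rfl⟩
  have hkd : k < d := hk ▸ (l[0]).2
  have hval : ∀ i (hi : i < l.length), (l[i]).val = if k + i < d then k + i else k + i - d := by
    intro i
    induction i with
    | zero => intro hi; rw [if_pos (by omega)]; omega
    | succ i ih =>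
      intro hi
      have h1 := List.isChain_iff_getElem.1 hl i hi
      rw [h1, val_finRotate, ih (by omega)]
      split_ifs <;> omega
  refine ⟨l.take (d - k), l.drop (d - k), (List.take_append_drop _ _).symm, ?_⟩
  rw [List.pairwise_append]
  refine ⟨List.pairwise_iff_getElem.2 fun i j hi hj hij => ?_,
    List.pairwise_iff_getElem.2 fun i j hi hj hij => ?_, fun x hx y hy => ?_⟩
  · rw [List.length_drop] at hi hj
    rw [List.getElem_drop, List.getElem_drop, Fin.lt_def, hval, hval]
    rw [if_neg (by omega), if_neg (by omega)]
    omega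
  · rw [List.length_take] at hi hj
    rw [List.getElem_take, List.getElem_take, Fin.lt_def, hval, hval]
    rw [if_pos (by omega), if_pos (by omega)]
    omega
  · obtain ⟨i, hi, rfl⟩ := List.getElem_of_mem hx
    obtain ⟨j, hj, rfl⟩ := List.getElem_of_mem hy
    rw [List.length_drop] at hi
    rw [List.length_take] at hj
    rw [List.getElem_drop, List.getElem_take, Fin.lt_def, hval, hval]
    rw [if_neg (by omega), if_pos (by omega)]
    omega

/-- In a planar diagram whose graph is a tree, the four inputs of every vertex can be constructed
from external lines in such a way that the external lines occur in their cyclic order. -/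
theorem IsPlanar.exists_constructions (hplanar : D.IsPlanar) (hG : D.G.IsTree)
    {P : Ideal (CoordRing ℓ)} (hP : IsComponent D.G P) (h : lsDegree P D.attach ≠ 0) (v : Fin ℓ) :
    ∃ (e : Fin 4 → Fin d ⊕ Fin ℓ) (t : Fin 4 → Construction d) (A B : List (Fin d)),
      (∀ y, y ∈ inputs D.G D.attach v ↔ ∃ k, e k = y) ∧
      (Construction.transversal (t 0) (t 1) (t 2) (t 3)).lines = A ++ B ∧
      (B ++ A).Pairwise (· < ·) ∧
      ∀ M L, (∀ w, Relation.TransGen (Determines D.G D.attach) w v →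
        SolvesAt D.G D.attach M L w) → ∀ k, (t k).Yields M (Sum.elim M L (e k)) := by
  obtain ⟨-, ρ, hρ, hinf, hgenus⟩ := hplanar
  have hd : 0 < d := by
    have := three_mul_add_one_le hG hP h
    omega
  obtain ⟨y, hy⟩ : (inputs D.G D.attach v).Nonempty := by
    rw [← Finset.card_pos, card_inputs hG hP h]; norm_num
  obtain ⟨x, hx, -⟩ := HalfEdge.exists_input_eq hy
  obtain ⟨l, hl, hlen, e, t, he, hsub, hyield⟩ := exists_path_self hG hP h hρ x v hx
  have hchain := hl.isChain hinf fun i j hij =>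
    eq_of_sameCycle_infinity hinf hG hd hρ hgenus (fun x v hx => by
      obtain ⟨l, hl, hlen, -⟩ := exists_path_self hG hP h hρ x v hx
      exact ⟨l, x, hl, List.ne_nil_of_length_pos (by omega)⟩) hij
  obtain ⟨A, B, rfl, hAB⟩ := exists_append_of_isChain hchain hlen.le
  obtain ⟨A', B', hA', hA, hB⟩ := List.sublist_append_iff.1 hsub
  exact ⟨e, t, A', B', he, hA', hAB.sublist (hB.append hA), hyield⟩

end LandauDiagram

/-! ### Consecutive columns of totally positive matrices -/

/-- The columns of a totally positive matrix with `n` columns, followed by the negative of the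
first one: all brackets of increasing sequences are positive, except those with the first and
the last column. -/
structure IsPositiveLoop (n : ℕ) (z : ℕ → Fin 4 → ℝ) : Prop where
  pos : ∀ i j k m, i < j → j < k → k < m → m ≤ n → ¬(i = 0 ∧ m = n) →
    0 < br (z i) (z j) (z k) (z m)
  nonneg : ∀ i j k m, i ≤ j → j ≤ k → k ≤ m → m ≤ n → 0 ≤ br (z i) (z j) (z k) (z m)

/-- The columns of a matrix, followed by the negative of the first one. -/
def loopColumn {n : ℕ} (Z : Matrix (Fin 4) (Fin n) ℝ) (c : ℕ) : Fin 4 → ℝ :=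
  if h : c < n then fun r => Z r ⟨c, h⟩ else if h : 0 < n then fun r => -Z r ⟨0, h⟩ else 0

/-- A bracket that ends with the negative of the first column is, after a cyclic permutation of its
four entries, one that starts with the first column. -/
theorem TotallyPositive.isPositiveLoop {n : ℕ} {Z : Matrix (Fin 4) (Fin n) ℝ}
    (hZ : TotallyPositive Z) : IsPositiveLoop n (loopColumn Z) := by
  rw [totallyPositive_iff_br] at hZ
  have hlt : ∀ i j k m, i < j → j < k → k < m → m < n →
      0 < br (loopColumn Z i) (loopColumn Z j) (loopColumn Z k) (loopColumn Z m) := by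
    intro i j k m hij hjk hkm hm
    simp only [loopColumn, dif_pos hm, dif_pos (hkm.trans hm), dif_pos (hjk.trans (hkm.trans hm)),
      dif_pos (hij.trans (hjk.trans (hkm.trans hm)))]
    exact hZ _ _ _ _ hij hjk hkm
  have hlast : 0 < n → loopColumn Z n = -loopColumn Z 0 := by
    intro hn
    simp only [loopColumn, lt_irrefl, dif_neg, not_false_eq_true, dif_pos hn]
    rfl
  have hpos : ∀ i j k m, i < j → j < k → k < m → m ≤ n → ¬(i = 0 ∧ m = n) →
      0 < br (loopColumn Z i) (loopColumn Z j) (loopColumn Z k) (loopColumn Z m) := by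
    intro i j k m hij hjk hkm hm hne
    rcases hm.lt_or_eq with hm | rfl
    · exact hlt i j k m hij hjk hkm hm
    · have := hlt 0 i j k (by omega) hij hjk hkm
      rw [hlast (by omega)]
      convert this using 1
      simp only [br_eq, Pi.neg_apply]; ring
  refine ⟨hpos, fun i j k m hij hjk hkm hm => ?_⟩
  rcases hij.lt_or_eq with hij | rfl
  · rcases hjk.lt_or_eq with hjk | rfl
    · rcases hkm.lt_or_eq with hkm | rfl
      · by_cases hne : i = 0 ∧ m = n
        · obtain ⟨rfl, rfl⟩ := hne
          rw [hlast (by omega)]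
          refine le_of_eq ?_
          simp only [br_eq, Pi.neg_apply]; ring
        · exact (hpos i j k m hij hjk hkm hm hne).le
      · exact le_of_eq (by simp only [br_eq]; ring)
    · exact le_of_eq (by simp only [br_eq]; ring)
  · exact le_of_eq (by simp only [br_eq]; ring)

/-- Two points of the line through consecutive columns, between these columns; which one depends
on the parity of `i`. They are used to span the line instead of the columns, because lines through
adjacent pairs of columns share a column. -/
def between (z : ℕ → Fin 4 → ℝ) (c i : ℕ) : Fin 4 → ℝ :=
  if i % 2 = 0 then z c + (1 / 2 : ℝ) • z (c + 1) else z (c + 1) + (1 / 2 : ℝ) • z c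

theorem between_nonneg {f : (Fin 4 → ℝ) → ℝ} (hf : IsLinearMap ℝ f) {z : ℕ → Fin 4 → ℝ} {c : ℕ}
    (i : ℕ) (h0 : 0 ≤ f (z c)) (h1 : 0 ≤ f (z (c + 1))) : 0 ≤ f (between z c i) := by
  unfold between
  split_ifs <;> rw [hf.map_add, hf.map_smul, smul_eq_mul] <;> positivity

theorem between_pos {f : (Fin 4 → ℝ) → ℝ} (hf : IsLinearMap ℝ f) {z : ℕ → Fin 4 → ℝ} {c : ℕ}
    (i : ℕ) (h0 : 0 ≤ f (z c)) (h1 : 0 ≤ f (z (c + 1))) (h : 0 < f (z c) ∨ 0 < f (z (c + 1))) :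
    0 < f (between z c i) := by
  unfold between
  rcases h with h | h <;> split_ifs <;> rw [hf.map_add, hf.map_smul, smul_eq_mul] <;> positivity

theorem isLinearMap_br_first (v w x : Fin 4 → ℝ) : IsLinearMap ℝ fun u => br u v w x where
  map_add a b := by simp only [br_eq, Pi.add_apply]; ring
  map_smul c a := by simp only [br_eq, Pi.smul_apply, smul_eq_mul]; ring

theorem isLinearMap_br_second (u w x : Fin 4 → ℝ) : IsLinearMap ℝ fun v => br u v w x where
  map_add a b := by simp only [br_eq, Pi.add_apply]; ring
  map_smul c a := by simp only [br_eq, Pi.smul_apply, smul_eq_mul]; ring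

theorem isLinearMap_br_third (u v x : Fin 4 → ℝ) : IsLinearMap ℝ fun w => br u v w x where
  map_add a b := by simp only [br_eq, Pi.add_apply]; ring
  map_smul c a := by simp only [br_eq, Pi.smul_apply, smul_eq_mul]; ring

theorem plucker_between (z : ℕ → Fin 4 → ℝ) (c : ℕ) {i j : ℕ} (hi : i % 2 = 0) (hj : j % 2 = 1) :
    plucker (between z c i) (between z c j) = (3 / 4 : ℝ) • plucker (z c) (z (c + 1)) := by
  rw [between, between, if_pos hi, if_neg (by omega)]
  ext k
  fin_cases k <;> simp [plucker] <;> ring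

section Cases

variable (z : ℕ → Fin 4 → ℝ) {i j : ℕ} (hi : i % 2 = 0) (hj : j % 2 = 1) (c : ℕ)
include hi hj

theorem br_between_first (w x : Fin 4 → ℝ) : br (between z c i) (between z c j) w x =
    3 / 4 * br (z c) (z (c + 1)) w x := by
  simp only [br, plucker_between z c hi hj, smul_pairing]

theorem br_between_last (u v : Fin 4 → ℝ) : br u v (between z c i) (between z c j) =
    3 / 4 * br u v (z c) (z (c + 1)) := by
  simp only [br, plucker_between z c hi hj, pairing_smul]

theorem br_between_middle (u x : Fin 4 → ℝ) : br u (between z c i) (between z c j) x =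
    3 / 4 * br u (z c) (z (c + 1)) x := by
  have e : ∀ v w : Fin 4 → ℝ, br u v w x = br v w x u * (-1) := by
    intro v w; simp only [br_eq]; ring
  rw [e, e, br_between_first z hi hj c]
  ring

end Cases

namespace IsPositiveLoop

variable {n : ℕ} {z : ℕ → Fin 4 → ℝ} (hz : IsPositiveLoop n z) {c₁ c₂ c₃ c₄ : ℕ}
  (i₁ i₂ i₃ i₄ : ℕ)
include hz

/-- Expanding a bracket of such points by linearity yields nonnegative brackets of columns, one of
which is positive. -/
theorem br_of_four_lines (h₁ : c₁ < c₂) (h₂ : c₂ < c₃) (h₃ : c₃ < c₄) (h₄ : c₄ < n) :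
    0 < br (between z c₁ i₁) (between z c₂ i₂) (between z c₃ i₃) (between z c₄ i₄) := by
  have n3 : ∀ a b c, a ≤ b → b ≤ c → c ≤ c₄ → 0 ≤ br (z a) (z b) (z c) (between z c₄ i₄) :=
    fun a b c hab hbc hc => between_nonneg (isLinearMap_br _ _ _) _
      (hz.nonneg _ _ _ _ (by omega) (by omega) (by omega) (by omega))
      (hz.nonneg _ _ _ _ (by omega) (by omega) (by omega) (by omega))
  have n2 : ∀ a b, a ≤ b → b ≤ c₃ → 0 ≤ br (z a) (z b) (between z c₃ i₃) (between z c₄ i₄) :=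
    fun a b hab hb => between_nonneg (isLinearMap_br_third _ _ _) _
      (n3 _ _ _ (by omega) (by omega) (by omega)) (n3 _ _ _ (by omega) (by omega) (by omega))
  have n1 : ∀ a, a ≤ c₂ →
      0 ≤ br (z a) (between z c₂ i₂) (between z c₃ i₃) (between z c₄ i₄) :=
    fun a ha => between_nonneg (isLinearMap_br_second _ _ _) _
      (n2 _ _ (by omega) (by omega)) (n2 _ _ (by omega) (by omega))
  refine between_pos (isLinearMap_br_first _ _ _) _ (n1 _ (by omega)) (n1 _ (by omega)) (Or.inl ?_)
  refine between_pos (isLinearMap_br_second _ _ _) _ (n2 _ _ (by omega) (by omega))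
    (n2 _ _ (by omega) (by omega)) (Or.inl ?_)
  refine between_pos (isLinearMap_br_third _ _ _) _ (n3 _ _ _ (by omega) (by omega) (by omega))
    (n3 _ _ _ (by omega) (by omega) (by omega)) (Or.inl ?_)
  refine between_pos (isLinearMap_br _ _ _) _
    (hz.nonneg _ _ _ _ (by omega) (by omega) (by omega) (by omega))
    (hz.nonneg _ _ _ _ (by omega) (by omega) (by omega) (by omega)) (Or.inl ?_)
  exact hz.pos _ _ _ _ h₁ h₂ h₃ h₄.le (by omega)

/-- If two of the points lie on the same line, then the three lines involved have at least four
columns in total only if `4 ≤ n`. -/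
theorem br_of_first_line (hn : 4 ≤ n) (h₁ : i₁ % 2 = 0) (h₂ : i₂ % 2 = 1) (h₃ : c₁ < c₃)
    (h₄ : c₃ < c₄) (h₅ : c₄ < n) :
    0 < br (between z c₁ i₁) (between z c₁ i₂) (between z c₃ i₃) (between z c₄ i₄) := by
  rw [br_between_first z h₁ h₂]
  refine mul_pos (by norm_num) ?_
  have n3 : ∀ c, c₁ + 1 ≤ c → c ≤ c₄ → 0 ≤ br (z c₁) (z (c₁ + 1)) (z c) (between z c₄ i₄) :=
    fun c hc hc' => between_nonneg (isLinearMap_br _ _ _) _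
      (hz.nonneg _ _ _ _ (by omega) (by omega) (by omega) (by omega))
      (hz.nonneg _ _ _ _ (by omega) (by omega) (by omega) (by omega))
  have p3 : ∀ c, c₁ + 1 < c → c ≤ c₄ → (c < c₄ ∨ ¬(c₁ = 0 ∧ c₄ + 1 = n)) →
      0 < br (z c₁) (z (c₁ + 1)) (z c) (between z c₄ i₄) := by
    intro c hc hc' hor
    refine between_pos (isLinearMap_br _ _ _) _
      (hz.nonneg _ _ _ _ (by omega) (by omega) (by omega) (by omega))
      (hz.nonneg _ _ _ _ (by omega) (by omega) (by omega) (by omega)) ?_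
    rcases hor with hlt | hne
    · exact Or.inl (hz.pos _ _ _ _ (by omega) (by omega) (by omega) (by omega) (by omega))
    · exact Or.inr (hz.pos _ _ _ _ (by omega) (by omega) (by omega) (by omega) (by omega))
  refine between_pos (isLinearMap_br_third _ _ _) _ (n3 _ (by omega) (by omega))
    (n3 _ (by omega) (by omega)) ?_
  by_cases h : c₁ + 1 < c₃
  · exact Or.inl (p3 _ h (by omega) (Or.inl h₄))
  · exact Or.inr (p3 _ (by omega) (by omega) (by omega))

theorem br_of_last_line (hn : 4 ≤ n) (h₁ : i₃ % 2 = 0) (h₂ : i₄ % 2 = 1) (h₃ : c₁ < c₂)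
    (h₄ : c₂ < c₃) (h₅ : c₃ < n) :
    0 < br (between z c₁ i₁) (between z c₂ i₂) (between z c₃ i₃) (between z c₃ i₄) := by
  rw [br_between_last z h₁ h₂]
  refine mul_pos (by norm_num) ?_
  have n2 : ∀ a, a ≤ c₂ → 0 ≤ br (z a) (between z c₂ i₂) (z c₃) (z (c₃ + 1)) :=
    fun a ha => between_nonneg (isLinearMap_br_second _ _ _) _
      (hz.nonneg _ _ _ _ (by omega) (by omega) (by omega) (by omega))
      (hz.nonneg _ _ _ _ (by omega) (by omega) (by omega) (by omega))
  refine between_pos (isLinearMap_br_first _ _ _) _ (n2 _ (by omega)) (n2 _ (by omega)) ?_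
  by_cases h : c₁ = 0 ∧ c₃ + 1 = n
  · refine Or.inr (between_pos (isLinearMap_br_second _ _ _) _
      (hz.nonneg _ _ _ _ (by omega) (by omega) (by omega) (by omega))
      (hz.nonneg _ _ _ _ (by omega) (by omega) (by omega) (by omega)) ?_)
    by_cases h' : c₁ + 1 < c₂
    · exact Or.inl (hz.pos _ _ _ _ (by omega) (by omega) (by omega) (by omega) (by omega))
    · exact Or.inr (hz.pos _ _ _ _ (by omega) (by omega) (by omega) (by omega) (by omega))
  · refine Or.inl (between_pos (isLinearMap_br_second _ _ _) _
      (hz.nonneg _ _ _ _ (by omega) (by omega) (by omega) (by omega))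
      (hz.nonneg _ _ _ _ (by omega) (by omega) (by omega) (by omega)) (Or.inl ?_))
    exact hz.pos _ _ _ _ (by omega) (by omega) (by omega) (by omega) (by omega)

theorem br_of_middle_line (hn : 4 ≤ n) (h₁ : i₂ % 2 = 0) (h₂ : i₃ % 2 = 1) (h₃ : c₁ < c₂)
    (h₄ : c₂ < c₄) (h₅ : c₄ < n) :
    0 < br (between z c₁ i₁) (between z c₂ i₂) (between z c₂ i₃) (between z c₄ i₄) := by
  rw [br_between_middle z h₁ h₂]
  refine mul_pos (by norm_num) ?_
  have n3 : ∀ a, a ≤ c₂ → 0 ≤ br (z a) (z c₂) (z (c₂ + 1)) (between z c₄ i₄) :=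
    fun a ha => between_nonneg (isLinearMap_br _ _ _) _
      (hz.nonneg _ _ _ _ (by omega) (by omega) (by omega) (by omega))
      (hz.nonneg _ _ _ _ (by omega) (by omega) (by omega) (by omega))
  have p3 : ∀ a, a < c₂ → (c₂ + 1 < c₄ ∨ ¬(a = 0 ∧ c₄ + 1 = n)) →
      0 < br (z a) (z c₂) (z (c₂ + 1)) (between z c₄ i₄) := by
    intro a ha hor
    refine between_pos (isLinearMap_br _ _ _) _
      (hz.nonneg _ _ _ _ (by omega) (by omega) (by omega) (by omega))
      (hz.nonneg _ _ _ _ (by omega) (by omega) (by omega) (by omega)) ?_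
    rcases hor with hlt | hne
    · exact Or.inl (hz.pos _ _ _ _ (by omega) (by omega) (by omega) (by omega) (by omega))
    · exact Or.inr (hz.pos _ _ _ _ (by omega) (by omega) (by omega) (by omega) (by omega))
  refine between_pos (isLinearMap_br_first _ _ _) _ (n3 _ (by omega)) (n3 _ (by omega)) ?_
  by_cases h : c₂ + 1 < c₄ ∨ ¬(c₁ = 0 ∧ c₄ + 1 = n)
  · exact Or.inl (p3 _ h₃ h)
  · exact Or.inr (p3 _ (by omega) (by omega))

/-- The lines through consecutive columns of a totally positive matrix, in increasing order, are in
positive position. -/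
theorem positivePosition {d : ℕ} (hn : 4 ≤ n) {p : Fin d → Fin n} (hp : StrictMono p)
    {l : List (Fin d)} (hl : l.Pairwise (· < ·)) :
    PositivePosition (l.map fun j => (between z (p j) 0, between z (p j) 1)) := by
  have hpt : ∀ i (hi : i / 2 < l.length),
      pt (l.map fun j => (between z (p j) 0, between z (p j) 1)) i =
        between z (p l[i / 2]) i := by
    intro i hi
    rw [pt, List.getD_eq_getElem _ _ (by simpa using hi), List.getElem_map]
    by_cases h : i % 2 = 0 <;> simp [between, h]
  have hlt : ∀ i j (hj : j < l.length) (hij : i < j), (p l[i]).val < (p l[j]).val :=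
    fun i j hj hij => hp (List.pairwise_iff_getElem.1 hl i j (by omega) hj hij)
  intro i j k m hij hjk hkm hm
  rw [List.length_map] at hm ⊢
  rw [hpt i (by omega), hpt j (by omega), hpt k (by omega), hpt m (by omega)]
  have hlast := (p (l[m / 2]'(by omega))).2
  rcases (Nat.div_le_div_right hij.le : i / 2 ≤ j / 2).lt_or_eq with h1 | h1
  · rcases (Nat.div_le_div_right hjk.le : j / 2 ≤ k / 2).lt_or_eq with h2 | h2
    · rcases (Nat.div_le_div_right hkm.le : k / 2 ≤ m / 2).lt_or_eq with h3 | h3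
      · have := hz.br_of_four_lines i j k m (hlt _ _ (by omega) h1) (hlt _ _ (by omega) h2)
          (hlt _ _ (by omega) h3) hlast
        exact ⟨this.le, fun _ => this⟩
      · simp only [h3] at *
        have := hz.br_of_last_line i j k m hn (by omega) (by omega) (hlt _ _ (by omega) h1)
          (hlt _ _ (by omega) h2) hlast
        exact ⟨this.le, fun _ => this⟩
    · have h3 : k / 2 < m / 2 := by omega
      simp only [h2] at *
      have := hz.br_of_middle_line i j k m hn (by omega) (by omega) (hlt _ _ (by omega) h1)
        (hlt _ _ (by omega) h3) hlast
      exact ⟨this.le, fun _ => this⟩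
  · have h2 : j / 2 < k / 2 := by omega
    rcases (Nat.div_le_div_right hkm.le : k / 2 ≤ m / 2).lt_or_eq with h3 | h3
    · simp only [h1] at *
      have := hz.br_of_first_line i j k m hn (by omega) (by omega) (hlt _ _ (by omega) h2)
        (hlt _ _ (by omega) h3) hlast
      exact ⟨this.le, fun _ => this⟩
    · simp only [h1, h3] at *
      rw [br_between_first z (by omega) (by omega), br_between_last z (by omega) (by omega)]
      have hc := hlt _ _ (by omega) h2
      refine ⟨mul_nonneg (by norm_num) (mul_nonneg (by norm_num)
        (hz.nonneg _ _ _ _ (by omega) (by omega) (by omega) (by omega))), fun hadj =>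
        mul_pos (by norm_num) (mul_pos (by norm_num)
          (hz.pos _ _ _ _ (by omega) ?_ (by omega) (by omega) ?_))⟩
      · have h4 : j / 2 + 1 < m / 2 := by
          by_contra h4
          exact hadj ⟨by omega, by omega, by omega, by omega, Or.inl (by omega)⟩
        have h5 := hlt (j / 2) (j / 2 + 1) (by omega) (by omega)
        have h6 := hlt (j / 2 + 1) (m / 2) (by omega) (by omega)
        omega
      · rintro ⟨h4, h5⟩
        by_cases h6 : j / 2 = 0
        · have h7 : m / 2 + 1 < l.length := by
            by_contra h7
            exact hadj ⟨by omega, by omega, by omega, by omega, Or.inr (by omega)⟩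
          have h8 := hlt (m / 2) (m / 2 + 1) h7 (by omega)
          have h9 := (p l[m / 2 + 1]).2
          omega
        · have := hlt 0 (j / 2) (by omega) (by omega)
          omega

end IsPositiveLoop

/-! ### The fibers over positive external data -/

theorem plucker_neg_right {R : Type*} [CommRing R] (v w : Fin 4 → R) :
    plucker v (-w) = -plucker v w := by
  ext k; fin_cases k <;> simp [plucker] <;> ring

/-- The sign is due to the line through the last and the first column. -/
theorem consecutiveLines_eq_smul {n d : ℕ} (Z : Matrix (Fin 4) (Fin n) ℝ) (p : Fin d → Fin n)
    (j : Fin d) : ∃ c : ℝ, c ≠ 0 ∧ consecutiveLines Z p j = c • plucker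
      (between (loopColumn Z) (p j) 0) (between (loopColumn Z) (p j) 1) := by
  rw [plucker_between _ _ rfl rfl]
  have h0 : loopColumn Z (p j) = fun r => Z r (p j) := by
    simp only [loopColumn, dif_pos (p j).2]
  have hn : 0 < n := (Nat.zero_le _).trans_lt (p j).2
  by_cases h : (p j).val + 1 = n
  · have h1 : loopColumn Z ((p j).val + 1) = -fun r => Z r (finRotate n (p j)) := by
      have : finRotate n (p j) = ⟨0, hn⟩ := Fin.ext (by rw [val_finRotate, if_pos h])
      rw [this, h]
      simp only [loopColumn, lt_irrefl, dif_neg, not_false_eq_true, dif_pos hn]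
      rfl
    refine ⟨-(4 / 3), by norm_num, ?_⟩
    rw [h0, h1, plucker_neg_right, smul_smul, smul_neg, ← neg_smul,
      show -(-(4 / 3 : ℝ) * (3 / 4)) = 1 by norm_num, one_smul]
    rfl
  · have h1 : loopColumn Z ((p j).val + 1) = fun r => Z r (finRotate n (p j)) := by
      have : finRotate n (p j) = ⟨(p j).val + 1, by omega⟩ :=
        Fin.ext (by rw [val_finRotate, if_neg h])
      rw [this]
      simp only [loopColumn, dif_pos (show (p j).val + 1 < n by omega)]
    refine ⟨4 / 3, by norm_num, ?_⟩
    rw [h0, h1, smul_smul, show (4 / 3 : ℝ) * (3 / 4) = 1 by norm_num, one_smul]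
    rfl

namespace LandauDiagram

variable {ℓ d : ℕ} {D : LandauDiagram ℓ d}

/-- In a planar diagram whose graph is a tree, the fibers over positive external data have as many
points as the generic fiber. -/
theorem IsPlanar.encard_fiber_eq_lsDegree (hplanar : D.IsPlanar) (hG : D.G.IsTree)
    {P : Ideal (CoordRing ℓ)} (hP : IsComponent D.G P) (h : lsDegree P D.attach ≠ 0)
    {M : Fin d → Fin 6 → ℝ} (hM : D.IsPositive M) :
    (fiber P D.attach (fun j k => (M j k : ℂ))).encard = lsDegree P D.attach := by
  classical
  obtain ⟨n, p, Z, hp, hZ, rfl⟩ := hM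
  have hn : 4 ≤ n := by
    have h1 := three_mul_add_one_le hG hP h
    have h2 : d ≤ n := by simpa using Fintype.card_le_of_injective p hp.strictMono.injective
    have h3 : 0 < ℓ := Fin.pos_iff_nonempty.2 hG.connected.nonempty
    omega
  have hcon := hplanar.exists_constructions hG hP h
  choose e t A B he hlines hpair hyield using hcon
  refine Landau.encard_fiber_eq_lsDegree hG hP h he fun v L hL => ?_
  set M : Fin d → Fin 6 → ℂ := fun j k => ((consecutiveLines Z p j k : ℝ) : ℂ)
  have hM : ∀ j, M j = toComplex (consecutiveLines Z p j) := fun j => rfl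
  -- the lines that come after the last line of the increasing list are negated
  let x : Fin d → (Fin 4 → ℝ) × (Fin 4 → ℝ) := fun j =>
    (between (loopColumn Z) (p j) 0, between (loopColumn Z) (p j) 1)
  let y : Fin d → (Fin 4 → ℝ) × (Fin 4 → ℝ) := fun j => if j ∈ B v then -x j else x j
  have hdisj : ∀ j ∈ A v, j ∉ B v := fun j hA hB =>
    lt_irrefl j ((List.pairwise_append.1 (hpair v)).2.2 j hB j hA)
  have hpos := (hZ.isPositiveLoop.positivePosition hn hp.strictMono (hpair v))
  rw [List.map_append] at hpos
  have hpos' : PositivePosition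
      ((Construction.transversal (t v 0) (t v 1) (t v 2) (t v 3)).lines.map y) := by
    rw [hlines, List.map_append]
    convert hpos.rotate using 2
    · exact List.map_congr_left fun j hj => if_neg (hdisj j hj)
    · rw [List.map_map]
      exact List.map_congr_left fun j hj => if_pos hj
  have hMy : ∀ j, ∃ c : ℂ, c ≠ 0 ∧ M j = c • toComplex (plucker (y j).1 (y j).2) := by
    intro j
    obtain ⟨c, hc, hcj⟩ := consecutiveLines_eq_smul Z p j
    refine ⟨c, by exact_mod_cast hc, ?_⟩
    have hy : plucker (y j).1 (y j).2 = plucker (x j).1 (x j).2 := by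
      simp only [y]
      split_ifs
      · ext k; fin_cases k <;> simp [plucker]
      · rfl
    rw [hM, hcj, toComplex_smul, hy]
  have hY := hyield v M L hL
  rw [det_pairing_eq_gram]
  · exact Construction.gram_ne_zero (X := fun k => Sum.elim M L (e v k)) hMy hpos'
      (hY 0) (hY 1) (hY 2) (hY 3)
  · intro k
    have hk := (he v (e v k)).2 ⟨k, rfl⟩
    revert hk
    generalize e v k = u
    rcases u with j | c
    · intro _
      simp only [Sum.elim_inl]
      rw [hM, pairing_toComplex, consecutiveLines, pairing_plucker_self, Complex.ofReal_zero]
    · exact fun hc => (hL c (.single (inr_mem_inputs.1 hc))).self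

theorem IsPlanar.discriminantsCopositive (hplanar : D.IsPlanar) (hG : D.G.IsTree) :
    D.DiscriminantsCopositive := fun _ hP h2 =>
  copositive_of_encard_fiber h2 fun _ hM =>
    hplanar.encard_fiber_eq_lsDegree hG hP (by omega) hM

end LandauDiagram

end Landau

end

theorem mainTheorem8 {ℓ d : ℕ} (D : Landau.LandauDiagram ℓ d) (hplanar : D.IsPlanar)
    (hdim : Landau.HasIncidenceDim D.G d) :
    (D.RealityHolds → D.DiscriminantsCopositive) ∧
      (D.G.IsTree → D.DiscriminantsCopositive) :=
  ⟨fun h => h.discriminantsCopositive, hplanar.discriminantsCopositive⟩
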